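/- A map is a finite graph with at least one edge (loops and parallel edges are allowed), drawn without crossings on the unit sphere $\mathbb S^2\subset\mathbb R^3$, all of whose faces (the connected components of the complement of the drawing) are simply connected. Let $\alpha_2:\mathbb S^2\to\mathbb S^2$, $x\mapsto -x$, be the antipodal function; it sends maps to maps. A dual map $G^*$ of $G$ is drawn on the same sphere, with one vertex inside each face of $G$ and, for each edge $e$ of $G$, one edge $e^*$ that crosses $e$ once, from one side of $e$ to the other, meets no other edge of $G$, and joins the vertices of $G^*$ in the faces on the two sides of $e$. The medial map $\mathrm{med}(G)$ is drawn on the same sphere, with one vertex in the interior of each edge of $G$ and, for each corner of each face $f$ of $G$, one edge that runs inside $f$, cuts off this corner and joins the vertices on the two consecutive boundary edges of $f$ that meet there. The drawings of $G^*$ and $\mathrm{med}(G)$ are unique only up to isotopy. A map $M$ is antipodally symmetric if $\alpha_2(M)=M$. A proper 2-coloring of the faces of $M$ gives different colors to any two distinct faces that share an edge. Let $G$ be an antipodally self-dual map, that is, a map for which $\alpha_2(G)$ is a dual map $G^*$ of $G$. Then $\mathrm{med}(G)$ can be drawn so that it is antipodally symmetric. Moreover, for every antipodally symmetric drawing $M$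 of $\mathrm{med}(G)$ as above, the faces of $M$ have a proper 2-coloring, and for every proper 2-coloring of the faces of $M$ the antipodal function is color-reversing: for every face $f$ of $M$, $\alpha_2(f)$ is a face of $M$ and its color differs from that of $f$. -/

import Mathlib

open Set Metric

noncomputable section

/-- The unit sphere of Euclidean 3-space. -/
abbrev S2 : Type := sphere (0 : EuclideanSpace ℝ (Fin 3)) 1

/-- The antipodal function `x ↦ -x` of the sphere. -/
def antipodal (x : S2) : S2 := -x

theorem antipodal_continuous : Continuous antipodal := continuous_neg

theorem antipodal_injective : Function.Injective antipodal := neg_injective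

/-- `e` is a simple arc (or a simple closed curve, when the two ends agree) whose ends lie in `V`
and whose other points lie outside `V`. -/
def IsEdgeCurve (V e : Set S2) : Prop :=
  ∃ γ : ℝ → S2, ContinuousOn γ (Icc 0 1) ∧ InjOn γ (Ioo 0 1) ∧ γ 0 ∈ V ∧ γ 1 ∈ V ∧
    (∀ t ∈ Ioo (0 : ℝ) 1, γ t ∉ V) ∧ e = γ '' Icc 0 1

/-- A finite graph drawn on the sphere without crossings: a finite set of points (the vertices) and
a finite set of (closed) curves joining vertices (the edges), two of which meet in vertices only.
Parallel edges and loops are allowed. -/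
@[ext]
structure SphereGraph where
  verts : Set S2
  edges : Set (Set S2)
  verts_finite : verts.Finite
  edges_finite : edges.Finite
  edge_curve : ∀ e ∈ edges, IsEdgeCurve verts e
  edge_inter : ∀ e ∈ edges, ∀ e' ∈ edges, e ≠ e' → e ∩ e' ⊆ verts

namespace SphereGraph

/-- All points of the drawing. -/
def carrier (G : SphereGraph) : Set S2 := G.verts ∪ ⋃₀ G.edges

/-- The faces: the connected components of the complement of the drawing. -/
def faces (G : SphereGraph) : Set (Set S2) :=
  {f | ∃ x ∈ G.carrierᶜ, f = connectedComponentIn G.carrierᶜ x}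

/-- The antipodal image of a drawn graph. -/
def antipode (G : SphereGraph) : SphereGraph where
  verts := antipodal '' G.verts
  edges := (fun e => antipodal '' e) '' G.edges
  verts_finite := G.verts_finite.image _
  edges_finite := G.edges_finite.image _
  edge_curve := by
    rintro _ ⟨e, he, rfl⟩
    obtain ⟨γ, hc, hi, h0, h1, hV, rfl⟩ := G.edge_curve e he
    refine ⟨fun t => antipodal (γ t), antipodal_continuous.comp_continuousOn hc,
      fun s hs t ht h => hi hs ht (antipodal_injective h), ⟨_, h0, rfl⟩, ⟨_, h1, rfl⟩, ?_,
      image_image _ _ _⟩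
    rintro t ht ⟨v, hv, h⟩
    exact hV t ht (antipodal_injective h ▸ hv)
  edge_inter := by
    rintro _ ⟨e, he, rfl⟩ _ ⟨e', he', rfl⟩ hne
    have h : e ≠ e' := fun h => hne (by rw [h])
    show antipodal '' e ∩ antipodal '' e' ⊆ antipodal '' G.verts
    rw [← image_inter antipodal_injective]
    exact image_mono (G.edge_inter e he e' he' h)

/-- The drawing is mapped to itself by the antipodal function (vertices to vertices and edges to
edges). -/
def IsAntipodallySymmetric (G : SphereGraph) : Prop := G.antipode = G

end SphereGraph

/-- The point `r · exp (2πit/n)`. The closed unit disc is used as an `n`-gon whose `k`-th corner is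
`discPoint n 1 k`, whose `k`-th side is the circular arc `discPoint n 1 t`, `k ≤ t ≤ k + 1`, and
where `discPoint n 1 (k + 1/2)` is the midpoint of that side. -/
def discPoint (n : ℕ) (r t : ℝ) : ℂ :=
  r * Complex.exp (2 * Real.pi * t / n * Complex.I)

/-- The segment from the centre to the midpoint of side `i`. -/
def spoke (n : ℕ) (i : Fin n) : Set ℂ :=
  (fun r : ℝ => discPoint n r ((i : ℝ) + 1 / 2)) '' Icc 0 1

/-- An arc that cuts off corner `k` of the `n`-gon: it joins the midpoint of the side before the
corner to the midpoint of the side after it, inside the sector between these two midpoints. -/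
def cornerArc (n : ℕ) (k : Fin n) : Set ℂ :=
  (fun s : ℝ => discPoint n (1 / 2 + |s|) ((k : ℝ) + s)) '' Icc (-(1 / 2)) (1 / 2)

/-- A description of the faces of a drawn graph as polygons: every face is the homeomorphic image
of the open disc, under a map that extends continuously to the closed disc and runs on the boundary
through a closed walk of `deg f ≥ 1` edges; the open `i`-th side is mapped bijectively onto the
edge `side f i` without its ends, and corners go to vertices. Every edge is a side exactly twice,
and one point `mark e` inside each edge is the image of the midpoints of both these sides.
A drawing of a finite graph with an edge has such a description precisely when its faces are simply
connected, that is, when it is a map in the sense of topological graph theory. -/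
structure FaceCharts (G : SphereGraph) where
  deg : G.faces → ℕ
  deg_pos : ∀ f, 0 < deg f
  chart : G.faces → ℂ → S2
  side : (f : G.faces) → Fin (deg f) → G.edges
  mark : G.edges → S2
  chart_continuousOn : ∀ f, ContinuousOn (chart f) (closedBall 0 1)
  chart_injOn : ∀ f, InjOn (chart f) (ball 0 1)
  chart_image : ∀ f, chart f '' ball 0 1 = (f : Set S2)
  corner_mem : ∀ f (i : Fin (deg f)), chart f (discPoint (deg f) 1 (i : ℝ)) ∈ G.verts
  side_injOn : ∀ f (i : Fin (deg f)),
    InjOn (fun t : ℝ => chart f (discPoint (deg f) 1 t)) (Ioo (i : ℝ) ((i : ℝ) + 1))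
  side_image : ∀ f (i : Fin (deg f)),
    (fun t : ℝ => chart f (discPoint (deg f) 1 t)) '' Ioo (i : ℝ) ((i : ℝ) + 1)
      = (side f i : Set S2) \ G.verts
  two_sides : ∀ e : G.edges,
    {p : (f : G.faces) × Fin (deg f) | side p.1 p.2 = e}.ncard = 2
  chart_mid : ∀ f (i : Fin (deg f)),
    chart f (discPoint (deg f) 1 ((i : ℝ) + 1 / 2)) = mark (side f i)

/-- The dual edge crossing `e`: it runs from the centre of the face on one side of `e` to the marked
point of `e`, and on to the centre of the face on the other side. -/
def FaceCharts.dualEdge {G : SphereGraph} (P : FaceCharts G) (e : G.edges) : Set S2 :=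
  {x | ∃ (f : G.faces) (i : Fin (P.deg f)), P.side f i = e ∧ x ∈ P.chart f '' spoke (P.deg f) i}

namespace SphereGraph

/-- `H` is a dual map of `G`, drawn on the same sphere as `G`: it has one vertex in each face of
`G`, and for each edge `e` of `G` one edge, which joins the vertices in the faces on the two sides
of `e`, crosses `e` once and meets no other edge of `G`. The polygonal description of the faces
may be chosen to fit `H`, so the requirement that the vertices and edges of `H` be centres and
spokes is no restriction on how `H` is drawn. -/
def IsDual (G H : SphereGraph) : Prop :=
  ∃ P : FaceCharts G, H.verts = range (fun f => P.chart f 0) ∧ H.edges = range P.dualEdge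

/-- `M` is the medial map of `G`, drawn on the same sphere as `G`: it has one vertex on each edge of
`G`, and for any two consecutive edges along the boundary of a face of `G` (one pair for each corner
of the face) an edge joining their vertices inside the face and cutting off that corner. The
polygonal description of the faces may again be chosen to fit `M`. -/
def IsMedial (G M : SphereGraph) : Prop :=
  ∃ P : FaceCharts G, M.verts = range P.mark ∧
    M.edges = {a | ∃ (f : G.faces) (k : Fin (P.deg f)), a = P.chart f '' cornerArc (P.deg f) k}

/-- The antipodal image of `G` is a dual map of `G`. -/
def IsAntipodallySelfDual (G : SphereGraph) : Prop := G.IsDual G.antipode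

/-- A proper coloring of the faces by two colors: different faces that share an edge have different
colors. -/
def IsProperFaceColoring (G : SphereGraph) (C : G.faces → Bool) : Prop :=
  ∀ f g : G.faces, f ≠ g →
    (∃ e ∈ G.edges, e ⊆ closure (f : Set S2) ∧ e ⊆ closure (g : Set S2)) → C f ≠ C g

/-- The antipodal function maps each face to a face of the other color. -/
def AntipodalColorReversing (G : SphereGraph) (C : G.faces → Bool) : Prop :=
  ∀ f : G.faces, ∃ g : G.faces, (g : Set S2) = antipodal '' (f : Set S2) ∧ C g ≠ C f

end SphereGraph

end

/-!
# Medial graphs of antipodally self-dual maps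

Let `G` be a map whose antipodal image is the dual map drawn by the centres and spokes of the face
charts `P`. Since a dual edge meets `G` in one marked point only, the marked points are exactly
the common points of `G` and its antipodal image (`FaceCharts.IsAntipodalDual.mem_range_mark`).
Hence they are permuted by the antipodal function.

**Existence.** Together, `G` and its antipodal image divide the sphere into quadrilaterals, one
for each corner of each face of `G`: the sectors between two consecutive spokes. The antipodal
function permutes the quadrilaterals, and no quadrilateral is mapped to itself, because an
involution of an open disc has a fixed point (`exists_fixed_of_involution`). The corner arcs are
diagonals of the quadrilaterals that join marked points. In one quadrilateral of each antipodal
pair the diagonal is replaced by the antipodal image of the diagonal in the other one, by means of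
a homeomorphism of the quadrilateral that fixes the boundary (`exists_twist`). These
homeomorphisms fit together to a homeomorphism of the sphere (`FaceCharts.exists_glue`), and the
charts composed with it draw a symmetric medial graph. Comparing two parametrizations of a
quadrilateral up to and including its boundary needs an extension of a homeomorphism between open
discs to the closed discs (`IsCell.exists_homeo`). It exists because the parametrizations are
finite-to-one on the boundary and cluster sets are connected.

**Colour reversal.** Let `M` be any symmetric drawing of the medial graph, given by charts `Q`.
Its faces are the inner polygons of the faces of `G` and the faces around the vertices of `G`, and
a common edge always separates one kind from the other (`IsMedialOf.cases_of_share`). So "contains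
a vertex of `G`" is a proper colouring. As the dual graph is connected, every proper colouring
gives one colour to the inner polygons and the other one to the faces around vertices
(`IsMedialOf.exists_color`), and it suffices to find one inner polygon whose antipodal image
contains a vertex, that is, a face `f` whose centre with respect to `P` lies in the inner polygon
with respect to `Q` (`IsAntipodalDual.colorReversing_of_center`). The marked points of `P` and `Q`
agree by the characterization above, and the open spokes of `P` avoid `M`, since their antipodal
images lie on `G` but contain no marked points. If the centre of `f` were beyond a corner arc of
`Q`, then all spokes would stay there and end in the only two marked points on that side of the
arc, hence `f` would have degree at most two (`IsAntipodalDual.deg_le_two`).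

It remains to see that some face has degree at least three (`IsAntipodalDual.exists_two_lt_deg`).
Otherwise `G` has two edges, two faces, and two vertices, whose antipodes lie in different faces.
The two faces are the two sides of a closed curve that meets its antipodal image in just two
points `m` and `-m`. Let `δ` be a continuous function that is zero on the curve, positive on one
side and negative on the other. The map `x ↦ δ x + i δ (-x)` has no zero outside `m` and `-m`, and
as it is compatible with the antipodal function it has an argument there that satisfies
`θ (-x) = c - θ x`. Evaluated at the two vertices, this gives contradictory values
(`false_of_inter_antipode_eq_pair`).
-/

noncomputable section

/-! ### Logarithms, involutions, and extension of homeomorphisms to the boundary -/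

/-- A continuous function without zeros on a convex open set has a logarithm, by lifting along the
covering `exp`. -/
theorem exists_continuousOn_log {U : Set ℂ} (hU : IsOpen U) (hc : Convex ℝ U) {g : ℂ → ℂ}
    (hg : ContinuousOn g U) (h0 : ∀ x ∈ U, g x ≠ 0) :
    ∃ L : ℂ → ℂ, ContinuousOn L U ∧ ∀ x ∈ U, Complex.exp (L x) = g x := by
  rcases U.eq_empty_or_nonempty with rfl | ⟨a, ha⟩
  · exact ⟨0, continuousOn_empty _, by simp⟩
  have : ContractibleSpace U := hc.contractibleSpace ⟨a, ha⟩
  have : LocallyPathConnectedSpace U := hU.locallyPathConnectedSpace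
  obtain ⟨F, ⟨-, hF⟩, -⟩ := Complex.isCoveringMapOn_exp.existsUnique_continuousMap_lifts
    (A := U) ⟨U.domRestrict g, hg.domRestrict⟩ (a₀ := ⟨a, ha⟩) (e₀ := Complex.log (g a))
    (Complex.exp_log (h0 a ha)) (fun x => h0 x x.2)
  classical
  refine ⟨fun x => if h : x ∈ U then F ⟨x, h⟩ else 0, ?_, fun x hx => ?_⟩
  · rw [continuousOn_iff_continuous_domRestrict]
    convert F.continuous using 1
    ext x
    simp
  · have := congrFun hF ⟨x, hx⟩
    simp only [Function.comp_apply, ContinuousMap.coe_mk, domRestrict_apply] at this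
    simpa [hx] using this

/-- A continuous function on a preconnected set with values in the discrete set `2πiℤ` is constant.
-/
theorem eq_of_exp_eq_one {α : Type*} [TopologicalSpace α] {S : Set α} (hS : IsPreconnected S)
    {f : α → ℂ} (hf : ContinuousOn f S) (h1 : ∀ x ∈ S, Complex.exp (f x) = 1) {x y : α}
    (hx : x ∈ S) (hy : y ∈ S) : f x = f y := by
  have key : ∀ z ∈ S, ∃ n : ℤ, f z = n * (2 * Real.pi * Complex.I) := fun z hz =>
    Complex.exp_eq_one_iff.1 (h1 z hz)
  have hT : IsDiscrete (range ((↑) : ℤ → ℝ)) := by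
    refine ⟨?_⟩
    exact (Int.isClosedEmbedding_coe_real.isEmbedding.toHomeomorph).symm.isEmbedding.discreteTopology
  have him : ∀ z (n : ℤ), f z = n * (2 * Real.pi * Complex.I) → (f z).im / (2 * Real.pi) = n := by
    intro z n hn
    rw [hn]
    have := Real.pi_pos
    simp
  have := hS.constant_of_mapsTo hT (f := fun z => (f z).im / (2 * Real.pi))
    ((Complex.continuous_im.comp_continuousOn hf).div_const _)
    (fun z hz => by obtain ⟨n, hn⟩ := key z hz; exact ⟨n, (him z n hn).symm⟩) hx hy
  obtain ⟨n, hn⟩ := key x hx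
  obtain ⟨m, hm⟩ := key y hy
  simp only [him x n hn, him y m hm, Int.cast_inj] at this
  rw [hn, hm, this]

/-- An involution `τ` of a convex open set has a fixed point. Otherwise `τ x - x` has a logarithm
`L`, and `L (τ x) - L x` is a constant odd multiple of `πi`, but changes sign when `x` is replaced
by `τ x`. -/
theorem exists_fixed_of_involution {U : Set ℂ} (hU : IsOpen U) (hc : Convex ℝ U)
    (hne : U.Nonempty) {τ : ℂ → ℂ} (hτ : ContinuousOn τ U) (hm : MapsTo τ U U)
    (hinv : ∀ x ∈ U, τ (τ x) = x) : ∃ x ∈ U, τ x = x := by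
  by_contra! hfree
  obtain ⟨L, hL, hexp⟩ := exists_continuousOn_log hU hc (g := fun x => τ x - x)
    (hτ.sub continuousOn_id) (fun x hx => sub_ne_zero.2 (hfree x hx))
  obtain ⟨a, ha⟩ := hne
  have h2 := eq_of_exp_eq_one hc.isPreconnected (f := fun x => L (τ x) - L x - Real.pi * Complex.I)
    (((hL.comp hτ hm).sub hL).sub continuousOn_const) (fun x hx => by
      rw [Complex.exp_sub, Complex.exp_sub, hexp _ (hm hx), hexp _ hx, Complex.exp_pi_mul_I,
        hinv x hx]
      have := sub_ne_zero.2 (hfree x hx)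
      rw [← neg_sub (τ x) x]
      field_simp) ha (hm ha)
  obtain ⟨n, hn⟩ := Complex.exp_eq_one_iff.1
    (show Complex.exp (L (τ a) - L a - Real.pi * Complex.I) = 1 by
      rw [Complex.exp_sub, Complex.exp_sub, hexp _ (hm ha), hexp _ ha, Complex.exp_pi_mul_I,
        hinv a ha]
      have := sub_ne_zero.2 (hfree a ha)
      rw [← neg_sub (τ a) a]
      field_simp)
  simp only [hinv a ha] at h2
  have h3 : (2 * (n : ℂ) + 1) * (2 * Real.pi * Complex.I) = 0 := by
    linear_combination (-2 : ℂ) * hn + h2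
  have hne := Complex.two_pi_I_ne_zero
  have : (2 * (n : ℂ) + 1) = 0 := (mul_eq_zero.1 h3).resolve_right hne
  have : (2 * n + 1 : ℤ) = 0 := by exact_mod_cast this
  omega

/-- If the cluster set of `τ` at a boundary point of a convex set is contained in a finite set, then
`τ` has a limit there: cluster sets along connected neighbourhoods are connected. -/
theorem exists_tendsto_of_finite_cluster {U : Set ℂ} (hU : Convex ℝ U) {Z : Set ℂ}
    (hZ : Z.Finite) {ζ : ℂ} (hζ : ζ ∈ closure U) {τ : ℂ → ℂ} (hτ : ContinuousOn τ U)
    (hcl : ∀ O, IsOpen O → Z ⊆ O → ∀ᶠ x in nhdsWithin ζ U, τ x ∈ O) :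
    ∃ z ∈ Z, Filter.Tendsto τ (nhdsWithin ζ U) (nhds z) := by
  have hne : (nhdsWithin ζ U).NeBot := mem_closure_iff_nhdsWithin_neBot.1 hζ
  obtain ⟨V, hV, hd⟩ := hZ.t2_separation
  have hopen : ∀ Y : Set ℂ, IsOpen (⋃ z ∈ Y, V z) := fun Y =>
    isOpen_biUnion fun z _ => (hV z).2
  have h1 := hcl _ (hopen Z) fun z hz => mem_biUnion hz (hV z).1
  obtain ⟨δ, hδ, hball⟩ := Metric.mem_nhdsWithin_iff.1 h1
  obtain ⟨x₀, hx₀, hx₀U⟩ := mem_closure_iff.1 hζ _ isOpen_ball (mem_ball_self hδ)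
  obtain ⟨z₀, hz₀, hxz⟩ := mem_iUnion₂.1 (hball ⟨hx₀, hx₀U⟩)
  have hin : τ '' (ball ζ δ ∩ U) ⊆ V z₀ := by
    refine IsPreconnected.subset_left_of_subset_union (hV z₀).2 (hopen (Z \ {z₀})) ?_ ?_
      ⟨τ x₀, mem_image_of_mem _ ⟨hx₀, hx₀U⟩, hxz⟩
      ((((convex_ball ζ δ).inter hU).isPreconnected).image _ (hτ.mono inter_subset_right))
    · rw [disjoint_iUnion₂_right]
      exact fun z hz => hd hz₀ hz.1 (Ne.symm hz.2)
    · rintro _ ⟨x, hx, rfl⟩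
      obtain ⟨z, hz, hxz'⟩ := mem_iUnion₂.1 (hball hx)
      by_cases h : z = z₀
      · exact Or.inl (h ▸ hxz')
      · exact Or.inr (mem_biUnion (show z ∈ Z \ {z₀} from ⟨hz, h⟩) hxz')
  refine ⟨z₀, hz₀, fun O hO => ?_⟩
  obtain ⟨O', hO', hO'o, hzO'⟩ := _root_.mem_nhds_iff.1 hO
  have h2 := hcl ((O' ∩ V z₀) ∪ ⋃ z ∈ Z \ {z₀}, V z)
    ((hO'o.inter (hV z₀).2).union (hopen _)) fun z hz => by
      by_cases h : z = z₀
      · exact Or.inl (by rw [h]; exact ⟨hzO', (hV z₀).1⟩)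
      · exact Or.inr (mem_biUnion (show z ∈ Z \ {z₀} from ⟨hz, h⟩) (hV z).1)
  have h3 : ∀ᶠ x in nhdsWithin ζ U, τ x ∈ V z₀ :=
    Metric.mem_nhdsWithin_iff.2 ⟨δ, hδ, fun x hx => hin (mem_image_of_mem _ hx)⟩
  filter_upwards [h2, h3] with x hx2 hx3
  rcases hx2 with h | h
  · exact hO' h.1
  · obtain ⟨z, hz, hxz'⟩ := mem_iUnion₂.1 h
    exact ((hd hz₀ hz.1 (Ne.symm hz.2)).le_bot ⟨hx3, hxz'⟩).elim

/-- A parametrization of a subset of `Y` by a planar compact set `K` with dense convex open interior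
`U`: continuous on `K`, injective on `U`, finite-to-one on `K`, and keeping the images of `U` and
of `K \ U` apart. -/
structure IsCell {Y : Type*} [TopologicalSpace Y] (K U : Set ℂ) (κ : ℂ → Y) : Prop where
  compact : IsCompact K
  isOpen : IsOpen U
  convex : Convex ℝ U
  subset : U ⊆ K
  dense : K ⊆ closure U
  cont : ContinuousOn κ K
  inj : InjOn κ U
  apart : ∀ x ∈ K, ∀ y ∈ U, κ x = κ y → x ∈ U
  finite : ∀ y, {x ∈ K | κ x = y}.Finite

namespace IsCell
variable {Y : Type*} [TopologicalSpace Y] {K U : Set ℂ} {κ κ' : ℂ → Y}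

/-- A map between open cells that commutes with the parametrizations has its cluster points over a
boundary point `ζ` among the points of the other cell with the same image as `ζ`. -/
theorem eventually_mem [T2Space Y] (h : IsCell K U κ') (hc : ContinuousOn κ K) {τ : ℂ → ℂ}
    (hτ : ∀ x ∈ U, τ x ∈ K ∧ κ' (τ x) = κ x) {ζ : ℂ} (hζ : ζ ∈ K) {O : Set ℂ} (hO : IsOpen O)
    (hZ : {z ∈ K | κ' z = κ ζ} ⊆ O) : ∀ᶠ x in nhdsWithin ζ U, τ x ∈ O := by
  have hC : IsClosed (κ' '' (K \ O)) :=
    ((h.compact.diff hO).image_of_continuousOn (h.cont.mono sdiff_subset)).isClosed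
  have h1 : κ ζ ∈ (κ' '' (K \ O))ᶜ := by
    rintro ⟨z, hz, hzζ⟩
    exact hz.2 (hZ ⟨hz.1, hzζ⟩)
  have h2 := ((hc ζ hζ).mono h.subset).eventually (hC.isOpen_compl.mem_nhds h1)
  filter_upwards [h2, self_mem_nhdsWithin] with x hx hxU
  by_contra hxO
  exact hx ⟨τ x, ⟨(hτ x hxU).1, hxO⟩, (hτ x hxU).2⟩

theorem isOpen_image [T2Space Y] (h : IsCell K U κ) (ho : IsOpen (κ '' U)) {W : Set ℂ}
    (hW : IsOpen W) (hWU : W ⊆ U) : IsOpen (κ '' W) := by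
  have hC : IsClosed (κ '' (K \ W)) :=
    ((h.compact.diff hW).image_of_continuousOn (h.cont.mono sdiff_subset)).isClosed
  convert ho.sdiff hC using 1
  ext y
  constructor
  · rintro ⟨x, hx, rfl⟩
    refine ⟨mem_image_of_mem _ (hWU hx), ?_⟩
    rintro ⟨z, hz, hzx⟩
    have := h.inj (h.apart z hz.1 x (hWU hx) hzx) (hWU hx) hzx
    exact hz.2 (this ▸ hx)
  · rintro ⟨⟨x, hx, rfl⟩, hn⟩
    by_contra hxW
    exact hn ⟨x, ⟨h.subset hx, fun hw => hxW (mem_image_of_mem _ hw)⟩, rfl⟩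

/-- The homeomorphism between the open cells extends continuously to the boundary. -/
theorem exists_extension [T2Space Y] (h : IsCell K U κ) (h' : IsCell K U κ')
    (him : κ '' U = κ' '' U) :
    ∃ T : ℂ → ℂ, ContinuousOn T K ∧ MapsTo T K K ∧ MapsTo T U U ∧ ∀ x ∈ K, κ' (T x) = κ x := by
  have hex : ∀ x, ∃ y, x ∈ U → y ∈ U ∧ κ' y = κ x := fun x => by
    by_cases hx : x ∈ U
    · obtain ⟨y, hy, hyx⟩ := him ▸ mem_image_of_mem κ hx
      exact ⟨y, fun _ => ⟨hy, hyx⟩⟩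
    · exact ⟨0, fun h => (hx h).elim⟩
  choose τ hτ using hex
  have hτK : ∀ x ∈ U, τ x ∈ K ∧ κ' (τ x) = κ x := fun x hx => ⟨h.subset (hτ x hx).1, (hτ x hx).2⟩
  have hcont : ContinuousOn τ U := by
    intro x hx O hO
    obtain ⟨O', hO', hO'o, hzO'⟩ := _root_.mem_nhds_iff.1 hO
    refine (h'.eventually_mem h.cont hτK (h.subset hx) hO'o ?_).mono fun _ hy => hO' hy
    rintro z ⟨hz, hzx⟩
    rw [← (hτ x hx).2] at hzx
    exact h'.inj (h'.apart z hz _ (hτ x hx).1 hzx) (hτ x hx).1 hzx ▸ hzO'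
  have hlim : ∀ ζ ∈ K, ∃ z ∈ {z ∈ K | κ' z = κ ζ},
      Filter.Tendsto τ (nhdsWithin ζ U) (nhds z) := fun ζ hζ =>
    exists_tendsto_of_finite_cluster h.convex (h'.finite _) (h.dense hζ) hcont
      fun O hO hZ => h'.eventually_mem h.cont hτK hζ hO hZ
  have hval : ∀ ζ ∈ K, extendFrom U τ ζ ∈ {z ∈ K | κ' z = κ ζ} := fun ζ hζ => by
    obtain ⟨z, hz, hzt⟩ := hlim ζ hζ
    rwa [extendFrom_eq (h.dense hζ) hzt]
  refine ⟨extendFrom U τ, continuousOn_extendFrom h.dense fun ζ hζ => ?_, fun ζ hζ => (hval ζ hζ).1,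
    fun x hx => ?_, fun ζ hζ => (hval ζ hζ).2⟩
  · obtain ⟨z, -, hzt⟩ := hlim ζ hζ
    exact ⟨z, hzt⟩
  · have := hval x (h.subset hx)
    rw [mem_ofPred, ← (hτ x hx).2] at this
    exact h'.apart _ this.1 _ (hτ x hx).1 this.2

/-- A map of a cell to itself that commutes with the parametrization is the identity, on the
boundary by continuity. -/
theorem eqOn_id [T2Space Y] (h : IsCell K U κ) {T : ℂ → ℂ} (hT : ContinuousOn T K)
    (hm : MapsTo T U U) (hκ : ∀ x ∈ K, κ (T x) = κ x) : ∀ x ∈ K, T x = x := by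
  have : EqOn T id U := fun x hx => h.inj (hm hx) hx (hκ x (h.subset hx))
  exact this.of_subset_closure hT continuousOn_id h.subset h.dense

/-- Two cells with the same open cell as image differ by a homeomorphism of `K`. -/
theorem exists_homeo [T2Space Y] (h : IsCell K U κ) (h' : IsCell K U κ')
    (him : κ '' U = κ' '' U) :
    ∃ T S : ℂ → ℂ, ContinuousOn T K ∧ ContinuousOn S K ∧ MapsTo T K K ∧ MapsTo S K K ∧
      MapsTo T U U ∧ MapsTo S U U ∧ (∀ x ∈ K, κ' (T x) = κ x) ∧ (∀ x ∈ K, κ (S x) = κ' x) ∧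
      (∀ x ∈ K, S (T x) = x) ∧ ∀ x ∈ K, T (S x) = x := by
  obtain ⟨T, hT, hTK, hTU, hκT⟩ := h.exists_extension h' him
  obtain ⟨S, hS, hSK, hSU, hκS⟩ := h'.exists_extension h him.symm
  refine ⟨T, S, hT, hS, hTK, hSK, hTU, hSU, hκT, hκS, ?_, ?_⟩
  · exact h.eqOn_id (hS.comp hT hTK) (hSU.comp hTU) fun x hx => by
      simp only [hκS _ (hTK hx), hκT x hx]
  · exact h'.eqOn_id (hT.comp hS hSK) (hTU.comp hSU) fun x hx => by
      simp only [hκT _ (hSK hx), hκS x hx]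

end IsCell

/-! ### Curves on the sphere that meet their antipodal image in two points -/

/-- If `δ x` and `δ (-x)` do not vanish together outside the poles `±m`, then `δ x + i δ (-x)` has a
continuous argument `θ` there, and `θ (-x) = c - θ x`. The proof lifts to the universal cover `p` of
the doubly punctured sphere, where the antipodal function becomes `w ↦ π + conj w`. Since
`δ x + i δ (-x)` is conjugated and multiplied by `i` under the antipodal function, its lifted
logarithm `L` satisfies `L (π + conj w) = conj (L w) + c₀` with imaginary `c₀`. Using this twice shows that `L`
has period `2π`. -/
theorem exists_angle {δ : S2 → ℝ} (hδ : Continuous δ) (m : S2)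
    (h0 : ∀ x, x ≠ m → x ≠ -m → δ x ≠ 0 ∨ δ (-x) ≠ 0) :
    ∃ (θ : S2 → ℝ) (c : ℝ), (∀ x, x ≠ m → x ≠ -m → ContinuousAt θ x ∧ θ (-x) = c - θ x ∧
      ∃ r > 0, δ x = r * Real.cos (θ x) ∧ δ (-x) = r * Real.sin (θ x)) := by
  obtain ⟨b, hb⟩ : ∃ b : OrthonormalBasis (Fin 3) ℝ (EuclideanSpace ℝ (Fin 3)), b 2 = m := by
    obtain ⟨b, hb⟩ := Orthonormal.exists_orthonormalBasis_extension_of_card_eq (𝕜 := ℝ)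
      (E := EuclideanSpace ℝ (Fin 3)) (ι := Fin 3) (by simp)
      (v := fun _ => (m : EuclideanSpace ℝ (Fin 3))) (s := {2}) (by
        rw [orthonormal_iff_ite]
        rintro ⟨i, rfl⟩ ⟨j, rfl⟩
        simp)
    exact ⟨b, hb 2 rfl⟩
  -- coordinates with respect to `b`
  have hsph : ∀ x : S2, inner ℝ (b 0) (x : EuclideanSpace ℝ (Fin 3)) ^ 2 + inner ℝ (b 1) x.1 ^ 2 +
      inner ℝ (b 2) x.1 ^ 2 = 1 := fun x => by
    have h := b.sum_sq_norm_inner_right (x : EuclideanSpace ℝ (Fin 3))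
    rw [Fin.sum_univ_three] at h
    simpa using h
  have hext : ∀ u v : EuclideanSpace ℝ (Fin 3), (∀ i, inner ℝ (b i) u = inner ℝ (b i) v) → u = v :=
    fun u v h => b.repr.injective (by ext i; simpa [b.repr_apply_apply] using h i)
  let v : ℂ → EuclideanSpace ℝ (Fin 3) := fun w =>
    Real.cos w.re • b 0 + Real.sin w.re • b 1 + w.im • b 2
  have hv0 : ∀ w, inner ℝ (b 0) (v w) = Real.cos w.re := fun w => by
    simp [v, inner_add_right, inner_smul_right, b.inner_eq_ite]
  have hv1 : ∀ w, inner ℝ (b 1) (v w) = Real.sin w.re := fun w => by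
    simp [v, inner_add_right, inner_smul_right, b.inner_eq_ite]
  have hv2 : ∀ w, inner ℝ (b 2) (v w) = w.im := fun w => by
    simp [v, inner_add_right, inner_smul_right, b.inner_eq_ite]
  have hvne : ∀ w, v w ≠ 0 := fun w h => by
    have h0 := hv0 w
    have h1 := hv1 w
    rw [h, inner_zero_right] at h0 h1
    have := Real.sin_sq_add_cos_sq w.re
    rw [← h0, ← h1] at this
    norm_num at this
  have hvpos : ∀ w, 0 < ‖v w‖ := fun w => norm_pos_iff.2 (hvne w)
  have hvc : Continuous v := by fun_prop
  let p : ℂ → S2 := fun w => ⟨‖v w‖⁻¹ • v w, by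
    rw [mem_sphere_zero_iff_norm, norm_smul, norm_inv, norm_norm, inv_mul_cancel₀ (hvpos w).ne']⟩
  have hpc : Continuous p := by
    refine Continuous.subtype_mk ((hvc.norm.inv₀ fun w => (hvpos w).ne').smul hvc) _
  have hp : ∀ w (x : S2) (r : ℝ), 0 < r → v w = r • (x : EuclideanSpace ℝ (Fin 3)) → p w = x := by
    intro w x r hr h
    apply Subtype.ext
    have hx : ‖(x : EuclideanSpace ℝ (Fin 3))‖ = 1 := by simp
    show ‖v w‖⁻¹ • v w = _
    rw [h, norm_smul, hx, Real.norm_of_nonneg hr.le, smul_smul]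
    simp [hr.ne']
  have hpi : ∀ w i, inner ℝ (b i) (p w).1 = ‖v w‖⁻¹ * inner ℝ (b i) (v w) := fun w i =>
    inner_smul_right _ _ _
  have hpm : ∀ w, p w ≠ m ∧ p w ≠ -m := by
    intro w
    have key : ∀ s : ℝ, (p w).1 ≠ s • b 2 := by
      intro s h
      have h0 := hpi w 0
      have h1 := hpi w 1
      rw [h, inner_smul_right, b.inner_eq_ite] at h0 h1
      simp only [hv0, hv1] at h0 h1
      have hi := inv_pos.2 (hvpos w)
      have hc : Real.cos w.re = 0 := by simpa [hi.ne'] using h0.symm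
      have hs : Real.sin w.re = 0 := by simpa [hi.ne'] using h1.symm
      have := Real.sin_sq_add_cos_sq w.re
      rw [hc, hs] at this
      norm_num at this
    refine ⟨fun h => key 1 (by rw [h, hb, one_smul]), fun h => key (-1) (by rw [h, hb]; simp)⟩
  have hinj : ∀ w w', p w = p w' → ∃ n : ℤ, w = w' + n * (2 * Real.pi) := by
    intro w w' h
    have hi : ∀ i, ‖v w‖⁻¹ * inner ℝ (b i) (v w) = ‖v w'‖⁻¹ * inner ℝ (b i) (v w') := fun i => by
      rw [← hpi, ← hpi, h]
    have h0 := hi 0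
    have h1 := hi 1
    have h2 := hi 2
    simp only [hv0, hv1, hv2] at h0 h1 h2
    have hA := inv_pos.2 (hvpos w)
    have hB := inv_pos.2 (hvpos w')
    have hAB : ‖v w‖⁻¹ = ‖v w'‖⁻¹ := by
      have e1 := Real.sin_sq_add_cos_sq w.re
      have e2 := Real.sin_sq_add_cos_sq w'.re
      have : ‖v w‖⁻¹ ^ 2 = ‖v w'‖⁻¹ ^ 2 := by
        calc ‖v w‖⁻¹ ^ 2 = (‖v w‖⁻¹ * Real.sin w.re) ^ 2 + (‖v w‖⁻¹ * Real.cos w.re) ^ 2 := by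
              rw [mul_pow, mul_pow, ← mul_add, e1, mul_one]
          _ = ‖v w'‖⁻¹ ^ 2 := by rw [h0, h1, mul_pow, mul_pow, ← mul_add, e2, mul_one]
      nlinarith
    rw [hAB] at h0 h1 h2
    have hc := mul_left_cancel₀ hB.ne' h0
    have hs := mul_left_cancel₀ hB.ne' h1
    have ht := mul_left_cancel₀ hB.ne' h2
    obtain ⟨n, hn⟩ := Real.Angle.angle_eq_iff_two_pi_dvd_sub.1 (Real.Angle.cos_sin_inj hc hs)
    refine ⟨n, Complex.ext ?_ ?_⟩
    · simp
      linarith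
    · simp [ht]
  have hanti : ∀ w, p (Complex.ofReal Real.pi + (starRingEnd ℂ) w) = -p w := by
    intro w
    refine hp _ _ ‖v w‖ (hvpos w) ?_
    have : (((-p w : S2)) : EuclideanSpace ℝ (Fin 3)) = -(‖v w‖⁻¹ • v w) := rfl
    rw [this, smul_neg, smul_smul, mul_inv_cancel₀ (hvpos w).ne', one_smul]
    simp only [v, Complex.add_re, Complex.ofReal_re, Complex.conj_re, Complex.add_im,
      Complex.ofReal_im, Complex.conj_im, zero_add, add_comm Real.pi, Real.cos_add_pi, Real.sin_add_pi]
    module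
  -- the logarithm of `δ x + i δ (-x)` on the universal cover
  let Φ : S2 → ℂ := fun x => δ x + δ (-x) * Complex.I
  have hΦc : Continuous Φ := by
    have : Continuous fun x : S2 => δ (-x) := hδ.comp continuous_neg
    fun_prop
  have hΦ0 : ∀ x, x ≠ m → x ≠ -m → Φ x ≠ 0 := fun x h1 h2 h => by
    have hr := congrArg Complex.re h
    have hi := congrArg Complex.im h
    simp [Φ] at hr hi
    exact (h0 x h1 h2).elim (· hr) (· hi)
  have hΦI : ∀ x, Φ (-x) = Complex.I * (starRingEnd ℂ) (Φ x) := fun x => by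
    simp only [Φ, neg_neg, map_add, map_mul, Complex.conj_ofReal, Complex.conj_I]
    linear_combination (δ (-x) : ℂ) * Complex.I_sq
  obtain ⟨Lg, hLc, hL⟩ := exists_continuousOn_log isOpen_univ convex_univ (g := Φ ∘ p)
    (hΦc.comp hpc).continuousOn fun w _ => hΦ0 _ (hpm w).1 (hpm w).2
  rw [continuousOn_univ] at hLc
  replace hL : ∀ w, Complex.exp (Lg w) = Φ (p w) := fun w => hL w (mem_univ w)
  have hconst := fun w => eq_of_exp_eq_one isPreconnected_univ
    (f := fun w => Lg (Real.pi + (starRingEnd ℂ) w) - (starRingEnd ℂ) (Lg w) - Complex.log Complex.I)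
    (by
      apply Continuous.continuousOn
      have := Complex.continuous_conj
      fun_prop) (fun w _ => by
      rw [Complex.exp_sub, Complex.exp_sub, Complex.exp_conj, hL, hL, hanti,
        Complex.exp_log Complex.I_ne_zero]
      have h1 := hΦ0 _ (hpm w).1 (hpm w).2
      have h3 : (starRingEnd ℂ) (Φ (p w)) ≠ 0 := (map_ne_zero _).2 h1
      rw [hΦI]
      field_simp) (mem_univ w) (mem_univ 0)
  set c₀ := Lg (Real.pi + (starRingEnd ℂ) 0) - (starRingEnd ℂ) (Lg 0) with hc₀
  have hLs : ∀ w, Lg (Real.pi + (starRingEnd ℂ) w) = (starRingEnd ℂ) (Lg w) + c₀ := fun w => by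
    have := hconst w
    beta_reduce at this
    linear_combination this
  have hc₀re : c₀.re = 0 := by
    have h1 : Complex.exp c₀ = Complex.I := by
      have h3 : (starRingEnd ℂ) (Φ (p 0)) ≠ 0 := (map_ne_zero _).2 (hΦ0 _ (hpm 0).1 (hpm 0).2)
      rw [hc₀, Complex.exp_sub, Complex.exp_conj, hL, hL, hanti, hΦI, mul_div_cancel_right₀ _ h3]
    have h2 := congrArg norm h1
    rwa [Complex.norm_exp, Complex.norm_I, Real.exp_eq_one_iff] at h2
  have hper : Function.Periodic Lg ((2 * Real.pi : ℝ) : ℂ) := fun w => by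
    have h1 := hLs (Real.pi + (starRingEnd ℂ) w)
    rw [hLs w] at h1
    simp only [map_add, Complex.conj_ofReal, Complex.conj_conj] at h1
    have h2 : (starRingEnd ℂ) c₀ + c₀ = 0 := by
      rw [add_comm, Complex.add_conj, hc₀re]; simp
    rw [add_assoc, h2, add_zero] at h1
    rw [← h1]
    congr 1
    push_cast
    ring
  have hLp : ∀ w w', p w = p w' → Lg w = Lg w' := fun w w' h => by
    obtain ⟨n, rfl⟩ := hinj w w' h
    have := hper.int_mul n w'
    push_cast at this
    exact this
  -- local sections of `p`
  let z : S2 → ℂ := fun x => inner ℝ (b 0) x.1 + inner ℝ (b 1) x.1 * Complex.I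
  have hzc : Continuous z := by
    have : Continuous fun x : S2 => x.1 := continuous_subtype_val
    fun_prop
  have hzn : ∀ x, ‖z x‖ ^ 2 + inner ℝ (b 2) x.1 ^ 2 = 1 := fun x => by
    rw [Complex.sq_norm, Complex.normSq_add_mul_I, hsph]
  have hz0 : ∀ x, x ≠ m → x ≠ -m → z x ≠ 0 := by
    intro x h1 h2 h
    have hr : inner ℝ (b 0) x.1 = 0 := by simpa [z] using congrArg Complex.re h
    have hi : inner ℝ (b 1) x.1 = 0 := by simpa [z] using congrArg Complex.im h
    have h3 := hsph x
    rw [hr, hi] at h3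
    have h4 : x.1 = inner ℝ (b 2) x.1 • b 2 := hext _ _ fun i => by
      rw [inner_smul_right, b.inner_eq_ite]
      fin_cases i <;> simp [hr, hi]
    rcases sq_eq_sq_iff_eq_or_eq_neg.1 (by simpa using h3 : inner ℝ (b 2) x.1 ^ 2 = 1 ^ 2) with h5 | h5
    · exact h1 (Subtype.ext (by rw [h4, h5, one_smul, hb]))
    · exact h2 (Subtype.ext (by rw [h4, h5, hb]; simp))
  let t : S2 → ℝ := fun x => inner ℝ (b 2) x.1 / ‖z x‖
  have htc : ∀ x, x ≠ m → x ≠ -m → ContinuousAt t x := fun x h1 h2 =>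
    ContinuousAt.div (by
      have : Continuous fun x : S2 => x.1 := continuous_subtype_val
      fun_prop) hzc.norm.continuousAt (norm_ne_zero_iff.2 (hz0 x h1 h2))
  have hsec : ∀ x, x ≠ m → x ≠ -m → ∀ s : ℝ, z x = ‖z x‖ * Complex.exp (s * Complex.I) →
      p (s + t x * Complex.I) = x := by
    intro x h1 h2 s hs
    have hzp : 0 < ‖z x‖ := norm_pos_iff.2 (hz0 x h1 h2)
    refine hp _ _ ‖z x‖⁻¹ (inv_pos.2 hzp) (hext _ _ fun i => ?_)
    rw [inner_smul_right, eq_inv_mul_iff_mul_eq₀ hzp.ne']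
    have hr : inner ℝ (b 0) x.1 = ‖z x‖ * Real.cos s := by
      have := congrArg Complex.re hs
      rw [Complex.re_ofReal_mul, Complex.exp_ofReal_mul_I_re] at this
      rw [← this]; simp [z]
    have hi : inner ℝ (b 1) x.1 = ‖z x‖ * Real.sin s := by
      have := congrArg Complex.im hs
      rw [Complex.im_ofReal_mul, Complex.exp_ofReal_mul_I_im] at this
      rw [← this]; simp [z]
    fin_cases i
    · simp [hv0, hr]
    · simp [hv1, hi]
    · simp only [Fin.reduceFinMk, hv2]
      simp [t, mul_div_cancel₀ _ hzp.ne']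
  have hs1 : ∀ x, z x = ‖z x‖ * Complex.exp ((z x).arg * Complex.I) := fun x =>
    (Complex.norm_mul_exp_arg_mul_I _).symm
  have hs2 : ∀ x, z x = ‖z x‖ * Complex.exp (((-z x).arg + Real.pi : ℝ) * Complex.I) := fun x => by
    have := Complex.norm_mul_exp_arg_mul_I (-z x)
    rw [norm_neg] at this
    rw [Complex.ofReal_add, add_mul, Complex.exp_add, Complex.exp_pi_mul_I, ← mul_assoc, this]
    ring
  let θ : S2 → ℝ := fun x => (Lg ((z x).arg + t x * Complex.I)).im
  have hθ : ∀ w, θ (p w) = (Lg w).im := fun w => by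
    show (Lg _).im = _
    rw [hLp _ w (hsec _ (hpm w).1 (hpm w).2 _ (hs1 _))]
  have hpq : ∀ x, x ≠ m → x ≠ -m → ∃ w, p w = x := fun x h1 h2 => ⟨_, hsec x h1 h2 _ (hs1 x)⟩
  refine ⟨θ, c₀.im, fun x h1 h2 => ⟨?_, ?_, ?_⟩⟩
  · have harg : ∀ a : S2 → ℝ, ContinuousAt a x →
        ContinuousAt (fun y => (Lg (a y + t y * Complex.I)).im) x := fun a ha => by
      refine Complex.continuous_im.continuousAt.comp (hLc.continuousAt.comp ?_)
      exact (Complex.continuous_ofReal.continuousAt.comp ha).add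
        ((Complex.continuous_ofReal.continuousAt.comp (htc x h1 h2)).mul continuousAt_const)
    by_cases hsl : z x ∈ Complex.slitPlane
    · exact harg _ ((Complex.continuousAt_arg hsl).comp hzc.continuousAt)
    · have hsl' : -z x ∈ Complex.slitPlane := by
        rw [Complex.mem_slitPlane_iff] at hsl ⊢
        push Not at hsl
        have hne := hz0 x h1 h2
        refine Or.inl ?_
        rw [Complex.neg_re, neg_pos]
        refine lt_of_le_of_ne hsl.1 fun h => hne (Complex.ext h hsl.2)
      have hc := harg (fun y => (-z y).arg + Real.pi)
        ((ContinuousAt.comp (f := fun y => -z y) (Complex.continuousAt_arg hsl')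
          hzc.neg.continuousAt).add continuousAt_const)
      refine hc.congr ?_
      filter_upwards [isOpen_ne.mem_nhds h1, isOpen_ne.mem_nhds h2] with y hy1 hy2
      rw [hLp _ _ ((hsec y hy1 hy2 _ (hs2 y)).trans (hsec y hy1 hy2 _ (hs1 y)).symm)]
  · obtain ⟨w, rfl⟩ := hpq x h1 h2
    rw [← hanti, hθ, hθ, hLs]
    simp
    ring
  · obtain ⟨w, rfl⟩ := hpq x h1 h2
    refine ⟨Real.exp (Lg w).re, Real.exp_pos _, ?_, ?_⟩
    · have := congrArg Complex.re (hL w)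
      rw [Complex.exp_re] at this
      simpa [Φ, hθ] using this.symm
    · have := congrArg Complex.im (hL w)
      rw [Complex.exp_im] at this
      simpa [Φ, hθ] using this.symm

/-- Let `δ` have the sign `s` on a preconnected set `f`, and let `a` be a zero of `δ` in the closure
of `f` with `-a` in `f`. Then `θ` stays within `π/2` of `θ (-a)` on `f`, so `θ a = θ (-a) + π/2`. -/
theorem angle_of_component {δ θ : S2 → ℝ} {c s : ℝ} {m a : S2} {f : Set S2}
    (hθ : ∀ x, x ≠ m → x ≠ -m → ContinuousAt θ x ∧ θ (-x) = c - θ x ∧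
      ∃ r > 0, δ x = r * Real.cos (θ x) ∧ δ (-x) = r * Real.sin (θ x))
    (hf : IsPreconnected f) (hm : m ∉ f) (hm' : -m ∉ f)
    (hpos : ∀ x ∈ f, 0 < s * δ x) (ha : δ a = 0) (hac : a ∈ closure f) (haf : -a ∈ f) :
    0 < s * Real.cos (θ (-a)) ∧ c = 2 * θ (-a) + Real.pi / 2 := by
  have hne : ∀ x ∈ f, x ≠ m ∧ x ≠ -m := fun x hx =>
    ⟨fun h => hm (h ▸ hx), fun h => hm' (h ▸ hx)⟩
  have ham : a ≠ m ∧ a ≠ -m :=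
    ⟨fun h => (hne _ haf).2 (by rw [h]), fun h => (hne _ haf).1 (by rw [h, neg_neg])⟩
  have hcos : ∀ x ∈ f, 0 < s * Real.cos (θ x) := fun x hx => by
    obtain ⟨-, -, r, hr, h1, -⟩ := hθ x (hne x hx).1 (hne x hx).2
    have := hpos x hx
    rw [h1, mul_left_comm] at this
    exact (pos_iff_pos_of_mul_pos this).1 hr
  set β := θ (-a) with hβ
  have hsinβ : Real.sin β = 0 := by
    obtain ⟨-, -, r, hr, -, h2⟩ := hθ _ (hne _ haf).1 (hne _ haf).2
    rw [neg_neg, ha, ← hβ] at h2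
    exact (mul_eq_zero.1 h2.symm).resolve_left hr.ne'
  have hshift : ∀ y, Real.cos (β + y) = Real.cos β * Real.cos y := fun y => by
    rw [Real.cos_add, hsinβ]; ring
  have hcont : ContinuousOn θ f := fun x hx =>
    (hθ x (hne x hx).1 (hne x hx).2).1.continuousWithinAt
  have hIcc : θ '' f ⊆ Icc (β - Real.pi / 2) (β + Real.pi / 2) := by
    have hord := (hf.image θ hcont).ordConnected
    have hno : ∀ y ∈ θ '' f, Real.cos y ≠ 0 := by
      rintro _ ⟨x, hx, rfl⟩ h
      have := hcos x hx
      rw [h, mul_zero] at this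
      exact this.false
    rintro y hy
    have hβm : β ∈ θ '' f := ⟨-a, haf, rfl⟩
    constructor
    · by_contra! h
      refine hno (β + -(Real.pi / 2)) (hord.out hy hβm ⟨?_, ?_⟩) ?_
      · linarith
      · linarith [Real.pi_pos]
      · rw [hshift, Real.cos_neg, Real.cos_pi_div_two, mul_zero]
    · by_contra! h
      refine hno (β + Real.pi / 2) (hord.out hβm hy ⟨?_, h.le⟩) ?_
      · linarith [Real.pi_pos]
      · rw [hshift, Real.cos_pi_div_two, mul_zero]
  have hθa : θ a ∈ Icc (β - Real.pi / 2) (β + Real.pi / 2) := by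
    have h1 := (hθ a ham.1 ham.2).1.continuousWithinAt (s := f)
    have := h1.mem_closure_image hac
    exact isClosed_Icc.closure_subset_iff.2 hIcc this
  obtain ⟨-, hc, r, hr, h1, h2⟩ := hθ a ham.1 ham.2
  rw [ha] at h1
  have hcosa : Real.cos (θ a) = 0 := (mul_eq_zero.1 h1.symm).resolve_left hr.ne'
  have hsina : 0 < s * Real.sin (θ a) := by
    have := hpos _ haf
    rw [h2, mul_left_comm] at this
    exact (pos_iff_pos_of_mul_pos this).1 hr
  have hsβ := hcos _ haf
  rw [← hβ] at hsβ
  refine ⟨hsβ, ?_⟩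
  obtain ⟨u, hu⟩ : ∃ u, θ a = β + u := ⟨θ a - β, by ring⟩
  rw [hu] at hθa hcosa hsina
  rw [hshift] at hcosa
  rw [Real.sin_add, hsinβ, zero_mul, zero_add, ← mul_assoc] at hsina
  have hcu : Real.cos u = 0 := (mul_eq_zero.1 hcosa).resolve_left fun h => by simp [h] at hsβ
  have hsu : 0 < Real.sin u := (pos_iff_pos_of_mul_pos hsina).1 hsβ
  have hu1 : u = Real.pi / 2 := by
    rcases lt_trichotomy u (Real.pi / 2) with h | h | h
    · rcases eq_or_lt_of_le (show -(Real.pi / 2) ≤ u by linarith [hθa.1]) with h' | h'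
      · rw [← h', Real.sin_neg, Real.sin_pi_div_two] at hsu
        linarith
      · exact ((Real.cos_pos_of_mem_Ioo ⟨h', h⟩).ne' hcu).elim
    · exact h
    · linarith [hθa.2]
  linarith

/-- A closed curve `K` on the sphere, with sides `f` and `g`, that meets its antipodal image in `±m`
only cannot have points `a`, `b` whose antipodes lie in `f` and in `g`: by `angle_of_component` the
arguments at `-a` and `-b` would be equal, while `δ` has different signs there. -/
theorem false_of_inter_antipode_eq_pair {K f g : Set S2} (hf : IsOpen f)
    (hg : IsOpen g) (hfg : Disjoint f g) (hun : Kᶜ = f ∪ g) (hfc : IsPreconnected f)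
    (hgc : IsPreconnected g) {m a b : S2} (hm : m ∈ K) (hm' : -m ∈ K)
    (hKm : ∀ x ∈ K, -x ∈ K → x = m ∨ x = -m) (ha : a ∈ K) (hac : a ∈ closure f) (haf : -a ∈ f)
    (hb : b ∈ K) (hbc : b ∈ closure g) (hbg : -b ∈ g) : False := by
  have hKf : ∀ x ∈ K, x ∈ fᶜ := fun x hx h => (hun.symm.subset (Or.inl h) : x ∈ Kᶜ) hx
  have hKg : ∀ x ∈ K, x ∈ gᶜ := fun x hx h => (hun.symm.subset (Or.inr h) : x ∈ Kᶜ) hx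
  have hfg' : ∀ x ∈ f, x ∈ gᶜ := fun x hx h => hfg.le_bot ⟨hx, h⟩
  have hgf' : ∀ x ∈ g, x ∈ fᶜ := fun x hx h => hfg.le_bot ⟨h, hx⟩
  let δ : S2 → ℝ := fun x => infDist x fᶜ - infDist x gᶜ
  have hδc : Continuous δ := (continuous_infDist_pt _).sub (continuous_infDist_pt _)
  have hδK : ∀ x ∈ K, δ x = 0 := fun x hx => by
    simp only [δ, infDist_zero_of_mem (hKf x hx), infDist_zero_of_mem (hKg x hx), sub_zero]
  have hδf : ∀ x ∈ f, 0 < 1 * δ x := fun x hx => by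
    simp only [δ, infDist_zero_of_mem (hfg' x hx), sub_zero, one_mul]
    exact (hf.isClosed_compl.notMem_iff_infDist_pos ⟨m, hKf m hm⟩).1 (by simpa using hx)
  have hδg : ∀ x ∈ g, 0 < (-1) * δ x := fun x hx => by
    simp only [δ, infDist_zero_of_mem (hgf' x hx), zero_sub, neg_mul, one_mul, neg_neg]
    exact (hg.isClosed_compl.notMem_iff_infDist_pos ⟨m, hKg m hm⟩).1 (by simpa using hx)
  have hδ0 : ∀ x, δ x = 0 → x ∈ K := fun x hx => by
    by_contra h
    rcases hun.subset h with h | h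
    · simpa [hx] using hδf x h
    · simpa [hx] using hδg x h
  obtain ⟨θ, c, hθ⟩ := exists_angle hδc m fun x h1 h2 => by
    by_contra! h
    exact (hKm x (hδ0 x h.1) (hδ0 _ h.2)).elim h1 h2
  obtain ⟨h1, h2⟩ := angle_of_component hθ hfc (hKf m hm) (hKf _ hm') hδf
    (hδK a ha) hac haf
  obtain ⟨h3, h4⟩ := angle_of_component hθ hgc (hKg m hm) (hKg _ hm') hδg
    (hδK b hb) hbc hbg
  have : θ (-a) = θ (-b) := by linarith
  rw [this] at h1
  linarith

theorem S2.locallyConnectedSpace : LocallyConnectedSpace S2 := by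
  have : Fact (Module.finrank ℝ (EuclideanSpace ℝ (Fin 3)) = 2 + 1) := ⟨by simp⟩
  exact ChartedSpace.locallyConnectedSpace (EuclideanSpace ℝ (Fin 2)) S2

theorem S2.one_lt_rank : 1 < Module.rank ℝ (EuclideanSpace ℝ (Fin 3)) := by
  rw [← Module.finrank_eq_rank]
  simp

theorem S2.connectedSpace : ConnectedSpace S2 :=
  isConnected_iff_connectedSpace.1 (isConnected_sphere S2.one_lt_rank 0 zero_le_one)

theorem isPreconnected_compl_of_finite {V : Set S2} (hV : V.Finite) (hne : V.Nonempty) :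
    IsPreconnected Vᶜ := by
  obtain ⟨v, hv⟩ := hne
  have hv1 : ‖(v : EuclideanSpace ℝ (Fin 3))‖ = 1 := by simp
  let e := stereographic hv1
  have hrank : 1 < Module.rank ℝ (Submodule.span ℝ {(v : EuclideanSpace ℝ (Fin 3))})ᗮ := by
    have : Fact (Module.finrank ℝ (EuclideanSpace ℝ (Fin 3)) = 2 + 1) := ⟨by simp⟩
    rw [← Module.finrank_eq_rank, Submodule.finrank_orthogonal_span_singleton (n := 2)]
    · simp
    · intro h; simp [h] at hv1
  have hc := (((hV.subset sdiff_subset).image e (s := V \ {v})).countable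
    |>.isPathConnected_compl_of_one_lt_rank hrank).isConnected.isPreconnected
  have hsrc : e.source = {v}ᶜ := stereographic_source hv1
  have htgt : e.target = univ := stereographic_target hv1
  have := hc.image e.symm (e.continuousOn_symm.mono (by rw [htgt]; exact subset_univ _))
  convert this using 1
  ext x
  constructor
  · intro hx
    have hxs : x ∈ e.source := by
      rw [hsrc]; exact fun h => hx (h ▸ hv)
    refine ⟨e x, ?_, e.left_inv hxs⟩
    rintro ⟨w, hw, hwx⟩
    exact hx (e.injOn (by rw [hsrc]; exact hw.2) hxs hwx ▸ hw.1)
  · rintro ⟨y, hy, rfl⟩ hyV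
    have hyt : y ∈ e.target := by rw [htgt]; trivial
    exact hy ⟨_, ⟨hyV, by have := e.map_target hyt; rwa [hsrc] at this⟩, e.right_inv hyt⟩

/-! ### Polar coordinates of a polygon -/

theorem discPoint_norm (n : ℕ) (r t : ℝ) : ‖discPoint n r t‖ = |r| := by
  have : (2 * Real.pi * t / n * Complex.I : ℂ) = ((2 * Real.pi * t / n : ℝ) : ℂ) * Complex.I := by
    push_cast; ring
  rw [discPoint, norm_mul, this, Complex.norm_exp_ofReal_mul_I, mul_one, Complex.norm_real,
    Real.norm_eq_abs]

theorem discPoint_zero (n : ℕ) (t : ℝ) : discPoint n 0 t = 0 := by simp [discPoint]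

theorem discPoint_continuous (n : ℕ) : Continuous fun p : ℝ × ℝ => discPoint n p.1 p.2 := by
  unfold discPoint
  fun_prop

theorem discPoint_mul (n : ℕ) (c r t : ℝ) : discPoint n (c * r) t = c * discPoint n r t := by
  simp [discPoint, mul_assoc]

theorem discPoint_eq_iff {n : ℕ} (hn : 0 < n) {r r' t t' : ℝ} (hr : 0 < r) (hr' : 0 ≤ r') :
    discPoint n r t = discPoint n r' t' ↔ r = r' ∧ ∃ m : ℤ, t = t' + m * n := by
  have hn' : (n : ℂ) ≠ 0 := by exact_mod_cast hn.ne'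
  have key : ∀ m : ℤ, (2 * Real.pi * t / n * Complex.I : ℂ) =
      2 * Real.pi * t' / n * Complex.I + m * (2 * Real.pi * Complex.I) ↔ t = t' + m * n := fun m => by
    rw [← Complex.ofReal_inj]
    have h2 := Complex.two_pi_I_ne_zero
    have : (2 * Real.pi * t' / n * Complex.I + m * (2 * Real.pi * Complex.I) : ℂ)
      = 2 * Real.pi * (t' + m * n) / n * Complex.I := by field_simp
    rw [this]
    push_cast
    constructor
    · intro h
      field_simp at h
      rw [h, mul_comm (n : ℂ)]
    · intro h
      rw [h]
  constructor
  · intro h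
    have hrr : r = r' := by
      have := congrArg norm h
      rwa [discPoint_norm, discPoint_norm, abs_of_pos hr, abs_of_nonneg hr'] at this
    subst hrr
    refine ⟨rfl, ?_⟩
    have := mul_left_cancel₀ (by exact_mod_cast hr.ne') h
    obtain ⟨m, hm⟩ := Complex.exp_eq_exp_iff_exists_int.1 this
    exact ⟨m, (key m).1 hm⟩
  · rintro ⟨rfl, m, hm⟩
    unfold discPoint
    rw [Complex.exp_eq_exp_iff_exists_int.2 ⟨m, (key m).2 hm⟩]

theorem discPoint_congr {n : ℕ} (hn : 0 < n) {r t t' : ℝ} (hr : 0 ≤ r) (m : ℤ)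
    (h : t = t' + m * n) : discPoint n r t = discPoint n r t' := by
  rcases hr.eq_or_lt with rfl | hr
  · simp [discPoint_zero]
  · exact (discPoint_eq_iff hn hr hr.le).2 ⟨rfl, m, h⟩

theorem exists_fin_add_mul {n : ℕ} (hn : 0 < n) (N : ℤ) :
    ∃ (k : Fin n) (m : ℤ), (N : ℝ) = (k : ℝ) + m * n := by
  have hn' : (0 : ℤ) < n := by exact_mod_cast hn
  refine ⟨⟨(N % n).toNat, ?_⟩, N / n, ?_⟩
  · have := Int.emod_lt_of_pos N hn'
    have := Int.emod_nonneg N hn'.ne'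
    omega
  · have h1 : (((N % n).toNat : ℤ)) = N % n := Int.toNat_of_nonneg (Int.emod_nonneg N hn'.ne')
    have h2 := Int.emod_add_mul_ediv N n
    have : (N : ℝ) = ((((N % n).toNat : ℤ) + n * (N / n) : ℤ) : ℝ) := by rw [h1, h2]
    rw [this]
    push_cast
    ring

theorem exists_eq_discPoint {n : ℕ} (hn : 0 < n) (z : ℂ) : ∃ t, z = discPoint n ‖z‖ t := by
  refine ⟨n * z.arg / (2 * Real.pi), ?_⟩
  conv_lhs => rw [← Complex.norm_mul_exp_arg_mul_I z]
  unfold discPoint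
  congr 3
  have : (n : ℂ) ≠ 0 := by exact_mod_cast hn.ne'
  have : (Real.pi : ℂ) ≠ 0 := by exact_mod_cast Real.pi_ne_zero
  push_cast
  field_simp

theorem exists_sector {n : ℕ} (hn : 0 < n) (t : ℝ) :
    ∃ (k : Fin n) (s : ℝ) (m : ℤ), |s| ≤ 1 / 2 ∧ t = k + s + m * n := by
  obtain ⟨k, m, h⟩ := exists_fin_add_mul hn (round t)
  refine ⟨k, t - round t, m, abs_sub_round t, ?_⟩
  rw [h]; ring

theorem exists_side {n : ℕ} (hn : 0 < n) (t : ℝ) :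
    ∃ (k : Fin n) (s : ℝ) (m : ℤ), 0 ≤ s ∧ s < 1 ∧ t = k + s + m * n := by
  obtain ⟨k, m, h⟩ := exists_fin_add_mul hn ⌊t⌋
  refine ⟨k, t - ⌊t⌋, m, by linarith [Int.floor_le t], by linarith [Int.lt_floor_add_one t], ?_⟩
  rw [h]; ring

theorem exists_sector_point {n : ℕ} (hn : 0 < n) (z : ℂ) :
    ∃ (k : Fin n) (s : ℝ), |s| ≤ 1 / 2 ∧ z = discPoint n ‖z‖ (k + s) := by
  obtain ⟨t, ht⟩ := exists_eq_discPoint hn z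
  obtain ⟨k, s, m, hs, h⟩ := exists_sector hn t
  exact ⟨k, s, hs, ht.trans (discPoint_congr hn (norm_nonneg z) m h)⟩

theorem exists_side_point {n : ℕ} (hn : 0 < n) (z : ℂ) :
    ∃ (k : Fin n) (s : ℝ), 0 ≤ s ∧ s < 1 ∧ z = discPoint n ‖z‖ (k + s) := by
  obtain ⟨t, ht⟩ := exists_eq_discPoint hn z
  obtain ⟨k, s, m, hs, hs1, h⟩ := exists_side hn t
  exact ⟨k, s, hs, hs1, ht.trans (discPoint_congr hn (norm_nonneg z) m h)⟩

theorem fin_eq_of_eq_add_mul {n : ℕ} {k k' : Fin n} {m : ℤ} (h : (k : ℤ) = k' + m * n) :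
    k = k' := by
  have h1 := k.2
  have h2 := k'.2
  have : m = 0 := by
    by_contra hm
    rcases lt_or_gt_of_ne hm with h3 | h3
    · nlinarith
    · nlinarith
  subst this
  ext
  omega

theorem sector_inj {n : ℕ} {k k' : Fin n} {s s' : ℝ} {m : ℤ} (hs : |s - s'| < 1)
    (h : (k : ℝ) + s = k' + s' + m * n) : k = k' ∧ s = s' := by
  have h1 : ((k - k' - m * n : ℤ) : ℝ) = s' - s := by push_cast; linarith
  have h2 : (k - k' - m * n : ℤ) = 0 := by
    rw [abs_sub_comm, ← h1] at hs
    rw [← Int.abs_lt_one_iff]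
    exact_mod_cast hs
  refine ⟨fin_eq_of_eq_add_mul (m := m) (by omega), ?_⟩
  rw [h2] at h1
  simp at h1
  linarith

theorem discPoint_inj {n : ℕ} {k k' : Fin n} {r r' s s' : ℝ} (hr : 0 < r)
    (hr' : 0 ≤ r') (hs : |s - s'| < 1) (h : discPoint n r (k + s) = discPoint n r' (k' + s')) :
    r = r' ∧ k = k' ∧ s = s' := by
  obtain ⟨hrr, m, hm⟩ := (discPoint_eq_iff k.pos hr hr').1 h
  exact ⟨hrr, sector_inj hs hm⟩

/-- A point determines its radius and, up to sign, its angular coordinate in a sector. -/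
theorem discPoint_abs_eq {n : ℕ} {k k' : Fin n} {r r' s s' : ℝ} (hr : 0 < r)
    (hr' : 0 ≤ r') (hs : |s| ≤ 1 / 2) (hs' : |s'| ≤ 1 / 2)
    (h : discPoint n r (k + s) = discPoint n r' (k' + s')) : r = r' ∧ |s| = |s'| := by
  rcases lt_or_ge |s - s'| 1 with h1 | h1
  · obtain ⟨h2, -, rfl⟩ := discPoint_inj hr hr' h1 h
    exact ⟨h2, rfl⟩
  · obtain ⟨h2, -⟩ := (discPoint_eq_iff k.pos hr hr').1 h
    refine ⟨h2, ?_⟩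
    have := abs_sub s s'
    linarith

/-! ### The pieces of the disc cut out by the corner arcs -/

/-- The `k`-th sector in polar coordinates: distance to the centre and angular coordinate relative
to the `k`-th corner. -/
def polar (n : ℕ) (k : Fin n) (p : ℝ × ℝ) : ℂ := discPoint n p.1 (k + p.2)

theorem polar_continuous (n : ℕ) (k : Fin n) : Continuous (polar n k) :=
  (discPoint_continuous n).comp (by fun_prop : Continuous fun p : ℝ × ℝ => (p.1, (k : ℝ) + p.2))

/-- The open region between the `k`-th corner arc and the circle. -/
def cornerRegion (n : ℕ) (k : Fin n) : Set ℂ :=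
  polar n k '' {p | |p.2| < 1 / 2 ∧ 1 / 2 + |p.2| < p.1 ∧ p.1 < 1}

/-- The closed region between the `k`-th corner arc and the circle. -/
def closedCorner (n : ℕ) (k : Fin n) : Set ℂ :=
  polar n k '' {p | |p.2| ≤ 1 / 2 ∧ 1 / 2 + |p.2| ≤ p.1 ∧ p.1 ≤ 1}

/-- The closed inner polygon bounded by the corner arcs. -/
def closedInner (n : ℕ) : Set ℂ :=
  ⋃ k, polar n k '' {p | |p.2| ≤ 1 / 2 ∧ 0 ≤ p.1 ∧ p.1 ≤ 1 / 2 + |p.2|}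

/-- The open inner polygon bounded by the corner arcs. -/
def innerRegion (n : ℕ) : Set ℂ := ball 0 1 \ ⋃ k, closedCorner n k

theorem mem_cornerArc {n : ℕ} {k : Fin n} {z : ℂ} :
    z ∈ cornerArc n k ↔ ∃ s, |s| ≤ 1 / 2 ∧ z = polar n k (1 / 2 + |s|, s) := by
  constructor
  · rintro ⟨s, hs, rfl⟩
    exact ⟨s, abs_le.2 hs, rfl⟩
  · rintro ⟨s, hs, rfl⟩
    exact ⟨s, abs_le.1 hs, rfl⟩

theorem polar_norm {n : ℕ} {k : Fin n} {p : ℝ × ℝ} (h : 0 ≤ p.1) : ‖polar n k p‖ = p.1 := by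
  rw [polar, discPoint_norm, abs_of_nonneg h]

theorem polar_abs_eq {n : ℕ} {k k' : Fin n} {p p' : ℝ × ℝ} (hp : 0 < p.1) (hp' : 0 ≤ p'.1)
    (h2 : |p.2| ≤ 1 / 2) (h2' : |p'.2| ≤ 1 / 2) (h : polar n k p = polar n k' p') :
    p.1 = p'.1 ∧ |p.2| = |p'.2| :=
  discPoint_abs_eq hp hp' h2 h2' h

theorem polar_inj {n : ℕ} {k k' : Fin n} {p p' : ℝ × ℝ} (hp : 0 < p.1) (hp' : 0 ≤ p'.1)
    (h2 : |p.2| < 1 / 2) (h2' : |p'.2| ≤ 1 / 2) (h : polar n k p = polar n k' p') :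
    k = k' ∧ p = p' := by
  have := abs_sub p.2 p'.2
  obtain ⟨h3, h4, h5⟩ := discPoint_inj hp hp' (by linarith) h
  exact ⟨h4, Prod.ext h3 h5⟩

theorem exists_polar {n : ℕ} (hn : 0 < n) (z : ℂ) :
    ∃ (k : Fin n) (p : ℝ × ℝ), |p.2| ≤ 1 / 2 ∧ p.1 = ‖z‖ ∧ z = polar n k p := by
  obtain ⟨k, s, hs, h⟩ := exists_sector_point hn z
  exact ⟨k, (‖z‖, s), hs, rfl, h⟩

theorem isCompact_closedCorner (n : ℕ) (k : Fin n) : IsCompact (closedCorner n k) := by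
  refine IsCompact.image ?_ (polar_continuous n k)
  refine (isCompact_Icc (a := ((0, -1) : ℝ × ℝ)) (b := (1, 1))).of_isClosed_subset ?_ ?_
  · exact (isClosed_le (f := fun p : ℝ × ℝ => |p.2|) (g := fun _ => 1 / 2) (by fun_prop)
      (by fun_prop)).inter ((isClosed_le (f := fun p : ℝ × ℝ => 1 / 2 + |p.2|) (g := fun p => p.1)
      (by fun_prop) (by fun_prop)).inter (isClosed_le (f := fun p : ℝ × ℝ => p.1) (g := fun _ => 1)
      (by fun_prop) (by fun_prop)))
  · rintro ⟨r, s⟩ ⟨h1, h2, h3⟩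
    have := abs_le.1 h1
    have h0 := abs_nonneg s
    simp only at h1 h2 h3 this h0
    exact ⟨⟨show (0 : ℝ) ≤ r by linarith, show (-1 : ℝ) ≤ s by linarith⟩,
      ⟨show r ≤ 1 by linarith, show s ≤ 1 by linarith⟩⟩

theorem isCompact_closedInner (n : ℕ) : IsCompact (closedInner n) := by
  refine isCompact_iUnion fun k => IsCompact.image ?_ (polar_continuous n k)
  refine (isCompact_Icc (a := ((0, -1) : ℝ × ℝ)) (b := (1, 1))).of_isClosed_subset ?_ ?_
  · exact (isClosed_le (f := fun p : ℝ × ℝ => |p.2|) (g := fun _ => 1 / 2) (by fun_prop)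
      (by fun_prop)).inter ((isClosed_le (f := fun _ : ℝ × ℝ => 0) (g := fun p => p.1)
      (by fun_prop) (by fun_prop)).inter (isClosed_le (f := fun p : ℝ × ℝ => p.1)
      (g := fun p => 1 / 2 + |p.2|) (by fun_prop) (by fun_prop)))
  · rintro ⟨r, s⟩ ⟨h1, h2, h3⟩
    have := abs_le.1 h1
    have h0 := abs_nonneg s
    simp only at h1 h2 h3 this h0
    exact ⟨⟨show (0 : ℝ) ≤ r by linarith, show (-1 : ℝ) ≤ s by linarith⟩,
      ⟨show r ≤ 1 by linarith, show s ≤ 1 by linarith⟩⟩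

theorem mem_ball_iff_norm_lt {z : ℂ} : z ∈ ball (0 : ℂ) 1 ↔ ‖z‖ < 1 := mem_ball_zero_iff

theorem mem_disc_cases {n : ℕ} (hn : 0 < n) {z : ℂ} (hz : ‖z‖ ≤ 1) :
    z ∈ closedInner n ∨ ∃ k, z ∈ closedCorner n k := by
  obtain ⟨k, p, hp, hpz, rfl⟩ := exists_polar hn z
  rcases le_total p.1 (1 / 2 + |p.2|) with h | h
  · exact Or.inl (mem_iUnion.2 ⟨k, p, ⟨hp, hpz ▸ norm_nonneg _, h⟩, rfl⟩)
  · exact Or.inr ⟨k, p, ⟨hp, h, hpz ▸ hz⟩, rfl⟩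

theorem closedInner_subset {n : ℕ} : closedInner n ⊆ innerRegion n ∪ ⋃ k, cornerArc n k := by
  intro z hz
  obtain ⟨k, p, ⟨h1, h2, h3⟩, rfl⟩ := mem_iUnion.1 hz
  rcases h3.eq_or_lt with h | h
  · exact Or.inr (mem_iUnion.2 ⟨k, mem_cornerArc.2 ⟨p.2, h1, by rw [← h]⟩⟩)
  · refine Or.inl ⟨?_, fun hc => ?_⟩
    · rw [mem_ball_iff_norm_lt, polar_norm h2]
      linarith
    · obtain ⟨j, q, ⟨h4, h5, h6⟩, h7⟩ := mem_iUnion.1 hc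
      have := abs_nonneg q.2
      obtain ⟨h8, h9⟩ := polar_abs_eq (by linarith) h2 h4 h1 h7
      linarith

theorem closedCorner_subset {n : ℕ} {k : Fin n} {z : ℂ} (hz : z ∈ closedCorner n k) (h1 : ‖z‖ < 1) :
    z ∈ cornerRegion n k ∨ z ∈ cornerArc n k := by
  obtain ⟨p, ⟨h2, h3, h4⟩, rfl⟩ := hz
  have := abs_nonneg p.2
  rw [polar_norm (by linarith)] at h1
  rcases h3.eq_or_lt with h | h
  · exact Or.inr (mem_cornerArc.2 ⟨p.2, h2, by rw [h]⟩)
  · exact Or.inl ⟨p, ⟨by linarith, h, h1⟩, rfl⟩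

theorem ball_cases {n : ℕ} (hn : 0 < n) {z : ℂ} (hz : ‖z‖ < 1) :
    z ∈ innerRegion n ∨ ∃ k, z ∈ cornerRegion n k ∨ z ∈ cornerArc n k := by
  rcases mem_disc_cases hn hz.le with h | ⟨k, h⟩
  · rcases closedInner_subset h with h | h
    · exact Or.inl h
    · obtain ⟨k, hk⟩ := mem_iUnion.1 h
      exact Or.inr ⟨k, Or.inr hk⟩
  · exact Or.inr ⟨k, closedCorner_subset h hz⟩

/-- A corner region is the complement in the open disc of finitely many compact sets, hence open. -/
theorem cornerRegion_eq {n : ℕ} {k : Fin n} :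
    cornerRegion n k = ball 0 1 \ (closedInner n ∪ ⋃ j ∈ ({k}ᶜ : Set (Fin n)), closedCorner n j) := by
  ext z
  constructor
  · rintro ⟨p, ⟨h1, h2, h3⟩, rfl⟩
    have hp := abs_nonneg p.2
    refine ⟨?_, ?_⟩
    · rw [mem_ball_iff_norm_lt, polar_norm (by linarith)]
      exact h3
    · rintro (h | h)
      · obtain ⟨j, q, ⟨h4, h5, h6⟩, h7⟩ := mem_iUnion.1 h
        obtain ⟨h8, h9⟩ := polar_abs_eq (by linarith) h5 h1.le h4 h7.symm
        linarith
      · obtain ⟨j, hj, q, ⟨h4, h5, h6⟩, h7⟩ := mem_iUnion₂.1 h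
        have := abs_nonneg q.2
        exact hj (polar_inj (by linarith) (by linarith) h1 h4 h7.symm).1.symm
  · rintro ⟨h1, h2⟩
    rw [mem_ball_iff_norm_lt] at h1
    rcases mem_disc_cases k.pos h1.le with h | ⟨j, hj⟩
    · exact (h2 (Or.inl h)).elim
    · by_cases hjk : j = k
      · subst hjk
        rcases closedCorner_subset hj h1 with h | h
        · exact h
        · obtain ⟨s, hs, rfl⟩ := mem_cornerArc.1 h
          exact (h2 (Or.inl (mem_iUnion.2
            ⟨j, (1 / 2 + |s|, s), ⟨hs, by positivity, le_rfl⟩, rfl⟩))).elim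
      · exact (h2 (Or.inr (mem_biUnion (show j ∈ ({k}ᶜ : Set _) from hjk) hj))).elim

theorem isOpen_cornerRegion {n : ℕ} (k : Fin n) : IsOpen (cornerRegion n k) := by
  rw [cornerRegion_eq]
  exact isOpen_ball.sdiff ((isCompact_closedInner n).isClosed.union
    ((toFinite _).isClosed_biUnion fun j _ => (isCompact_closedCorner n j).isClosed))

theorem isOpen_innerRegion (n : ℕ) : IsOpen (innerRegion n) :=
  isOpen_ball.sdiff (isClosed_iUnion_of_finite fun k => (isCompact_closedCorner n k).isClosed)

theorem isPreconnected_cornerRegion {n : ℕ} (k : Fin n) : IsPreconnected (cornerRegion n k) := by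
  refine IsPreconnected.image (Convex.isPreconnected ?_) _ (polar_continuous n k).continuousOn
  have habs : ConvexOn ℝ univ fun p : ℝ × ℝ => |p.2| :=
    (convexOn_norm convex_univ).comp_linearMap (LinearMap.snd ℝ ℝ ℝ)
  have h1 : Convex ℝ {p : ℝ × ℝ | |p.2| < 1 / 2} := by simpa using habs.convex_lt (1 / 2)
  have h2 : Convex ℝ {p : ℝ × ℝ | 1 / 2 + |p.2| < p.1} := by
    have := (habs.sub (g := fun p : ℝ × ℝ => p.1)
      ((LinearMap.fst ℝ ℝ ℝ).concaveOn convex_univ)).convex_lt (-(1 / 2))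
    have e : {p : ℝ × ℝ | 1 / 2 + |p.2| < p.1} = {p | p ∈ (univ : Set (ℝ × ℝ)) ∧
        ((fun p : ℝ × ℝ => |p.2|) - fun p : ℝ × ℝ => p.1) p < -(1 / 2)} := by
      ext p
      constructor
      · intro h
        refine ⟨trivial, ?_⟩
        change 1 / 2 + |p.2| < p.1 at h
        show |p.2| - p.1 < _
        linarith
      · rintro ⟨-, h⟩
        change |p.2| - p.1 < _ at h
        show 1 / 2 + |p.2| < p.1
        linarith
    rw [e]
    exact this
  have h3 : Convex ℝ {p : ℝ × ℝ | p.1 < 1} := convex_halfSpace_lt (IsLinearMap.mk (by simp) (by simp)) 1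
  exact h1.inter (h2.inter h3)

theorem zero_mem_innerRegion (n : ℕ) : (0 : ℂ) ∈ innerRegion n := by
  refine ⟨mem_ball_self one_pos, fun h => ?_⟩
  obtain ⟨k, p, ⟨h1, h2, h3⟩, h4⟩ := mem_iUnion.1 h
  have := abs_nonneg p.2
  have h5 := polar_norm (n := n) (k := k) (p := p) (by linarith)
  rw [h4, norm_zero] at h5
  linarith

theorem isPreconnected_innerRegion (n : ℕ) : IsPreconnected (innerRegion n) := by
  refine (StarConvex.isPathConnected (a := (0 : ℂ)) ?_
    (zero_mem_innerRegion n)).isConnected.isPreconnected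
  rw [starConvex_zero_iff]
  rintro z hz a ha0 ha1
  have hzb := mem_ball_iff_norm_lt.1 hz.1
  refine ⟨?_, fun h => ?_⟩
  · rw [mem_ball_iff_norm_lt, norm_smul, Real.norm_of_nonneg ha0]
    nlinarith [norm_nonneg z]
  · obtain ⟨k, p, ⟨h1, h2, h3⟩, h4⟩ := mem_iUnion.1 h
    have hp := abs_nonneg p.2
    have hp0 : 0 < p.1 := by linarith
    have h5 := polar_norm (n := n) (k := k) hp0.le
    rw [h4, norm_smul, Real.norm_of_nonneg ha0] at h5
    have ha : 0 < a := by
      rcases ha0.eq_or_lt with h | h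
      · rw [← h] at h5; linarith
      · exact h
    refine hz.2 (mem_iUnion.2 ⟨k, (‖z‖, p.2), ⟨h1, ?_, hzb.le⟩, ?_⟩)
    · show 1 / 2 + |p.2| ≤ ‖z‖
      nlinarith [norm_nonneg z]
    · have h6 : polar n k p = a * polar n k (‖z‖, p.2) := by
        show discPoint _ _ _ = a * discPoint _ _ _
        rw [← discPoint_mul, h5]
      rw [h6, Complex.real_smul] at h4
      exact mul_left_cancel₀ (by exact_mod_cast ha.ne') h4

theorem polar_mem_closure {n : ℕ} {k : Fin n} {S : Set (ℝ × ℝ)} {p q : ℝ × ℝ} {W : Set ℂ}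
    (hW : polar n k '' S ⊆ W)
    (h : ∀ t ∈ Ioo (0 : ℝ) 1, (p.1 + t * (q.1 - p.1), p.2 + t * (q.2 - p.2)) ∈ S) :
    polar n k p ∈ closure W := by
  have hc : Continuous fun t : ℝ => polar n k (p.1 + t * (q.1 - p.1), p.2 + t * (q.2 - p.2)) :=
    (polar_continuous n k).comp (by fun_prop)
  have ht := (hc.tendsto 0).mono_left (nhdsWithin_le_nhds (s := Ioi 0))
  simp only [zero_mul, add_zero] at ht
  refine mem_closure_of_tendsto ht ?_
  filter_upwards [Ioo_mem_nhdsGT (zero_lt_one' ℝ)] with t h'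
  exact hW (mem_image_of_mem _ (h t h'))

theorem closedCorner_subset_closure {n : ℕ} (k : Fin n) :
    closedCorner n k ⊆ closure (cornerRegion n k) := by
  rintro _ ⟨p, ⟨h1, h2, h3⟩, rfl⟩
  refine polar_mem_closure (q := (3 / 4, 0)) subset_rfl ?_
  rintro t ⟨ht0, ht1⟩
  have e : p.2 + t * (0 - p.2) = (1 - t) * p.2 := by ring
  have e2 : |p.2 + t * (0 - p.2)| = (1 - t) * |p.2| := by
    rw [e, abs_mul, abs_of_pos (by linarith)]
  have := abs_nonneg p.2
  refine ⟨?_, ?_, ?_⟩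
  · simp only [e2]; nlinarith
  · simp only [e2]; nlinarith
  · show p.1 + t * (3 / 4 - p.1) < 1
    nlinarith

theorem cornerArc_subset_closedCorner {n : ℕ} (k : Fin n) : cornerArc n k ⊆ closedCorner n k := by
  intro z hz
  obtain ⟨s, hs, rfl⟩ := mem_cornerArc.1 hz
  exact ⟨_, ⟨hs, le_rfl, by show 1 / 2 + |s| ≤ 1; linarith⟩, rfl⟩

theorem polar_mem_innerRegion {n : ℕ} {k : Fin n} {p : ℝ × ℝ} (h1 : |p.2| ≤ 1 / 2) (h2 : 0 ≤ p.1)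
    (h3 : p.1 < 1 / 2 + |p.2|) : polar n k p ∈ innerRegion n := by
  refine ⟨?_, fun hc => ?_⟩
  · rw [mem_ball_iff_norm_lt, polar_norm h2]
    linarith
  · obtain ⟨j, q, ⟨h4, h5, h6⟩, h7⟩ := mem_iUnion.1 hc
    have := abs_nonneg q.2
    obtain ⟨h8, h9⟩ := polar_abs_eq (by linarith) h2 h4 h1 h7
    linarith

theorem cornerArc_subset_closure_innerRegion {n : ℕ} (k : Fin n) :
    cornerArc n k ⊆ closure (innerRegion n) := by
  intro z hz
  obtain ⟨s, hs, rfl⟩ := mem_cornerArc.1 hz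
  refine polar_mem_closure (q := (0, s)) (S := {p | |p.2| ≤ 1 / 2 ∧ 0 ≤ p.1 ∧ p.1 < 1 / 2 + |p.2|}) ?_ ?_
  · rintro _ ⟨p, ⟨h1, h2, h3⟩, rfl⟩
    exact polar_mem_innerRegion h1 h2 h3
  · rintro t ⟨ht0, ht1⟩
    have := abs_nonneg s
    simp only [sub_self, mul_zero, add_zero]
    refine ⟨hs, ?_, ?_⟩
    · show 0 ≤ 1 / 2 + |s| + t * (0 - (1 / 2 + |s|))
      nlinarith
    · show 1 / 2 + |s| + t * (0 - (1 / 2 + |s|)) < 1 / 2 + |s|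
      nlinarith

theorem closure_innerRegion_subset {n : ℕ} (hn : 0 < n) :
    closure (innerRegion n) ⊆ closedInner n := by
  refine closure_minimal (fun z hz => ?_) (isCompact_closedInner n).isClosed
  rcases mem_disc_cases hn (mem_ball_iff_norm_lt.1 hz.1).le with h | h
  · exact h
  · exact (hz.2 (mem_iUnion.2 h)).elim

/-- Near an inner point of a corner arc there are only the arc and the two regions beside it. -/
theorem cornerArc_nhd {n : ℕ} {k : Fin n} {z : ℂ} (hz : z ∈ cornerArc n k) (h1 : ‖z‖ < 1) :
    ∃ N, IsOpen N ∧ z ∈ N ∧ N ⊆ ball 0 1 ∧ N ⊆ innerRegion n ∪ cornerArc n k ∪ cornerRegion n k := by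
  refine ⟨ball 0 1 \ ⋃ j ∈ ({k}ᶜ : Set (Fin n)), closedCorner n j, isOpen_ball.sdiff
    ((toFinite _).isClosed_biUnion fun j _ => (isCompact_closedCorner n j).isClosed), ⟨?_, ?_⟩,
    sdiff_subset, ?_⟩
  · exact mem_ball_iff_norm_lt.2 h1
  · intro h
    obtain ⟨s, hs, rfl⟩ := mem_cornerArc.1 hz
    obtain ⟨j, hj, q, ⟨h4, h5, h6⟩, h7⟩ := mem_iUnion₂.1 h
    rw [polar_norm (by positivity)] at h1
    have := abs_nonneg q.2
    have := abs_nonneg s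
    exact hj (polar_inj (by simp; positivity) (by linarith) (by simp at *; linarith) h4 h7.symm).1.symm
  · rintro w ⟨hw, hwn⟩
    rw [mem_ball_iff_norm_lt] at hw
    by_cases h : w ∈ ⋃ j, closedCorner n j
    · obtain ⟨j, hj⟩ := mem_iUnion.1 h
      by_cases hjk : j = k
      · subst hjk
        rcases closedCorner_subset hj hw with h | h
        · exact Or.inr h
        · exact Or.inl (Or.inr h)
      · exact (hwn (mem_biUnion (show j ∈ ({k}ᶜ : Set _) from hjk) hj)).elim
    · exact Or.inl (Or.inl ⟨mem_ball_iff_norm_lt.2 hw, h⟩)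

/-! ### Faces and charts of a map -/

namespace SphereGraph
variable {G : SphereGraph}

theorem isCompact_edge {e : Set S2} (he : e ∈ G.edges) : IsCompact e := by
  obtain ⟨γ, hc, -, -, -, -, rfl⟩ := G.edge_curve e he
  exact isCompact_Icc.image_of_continuousOn hc

theorem edge_subset_closure {e : Set S2} (he : e ∈ G.edges) : e ⊆ closure (e \ G.verts) := by
  obtain ⟨γ, hc, -, -, -, hV, rfl⟩ := G.edge_curve e he
  rintro _ ⟨t, ht, rfl⟩
  have h1 : t ∈ closure (Ioo (0 : ℝ) 1) := by rwa [closure_Ioo zero_ne_one]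
  refine closure_mono ?_ (((hc t ht).mono Ioo_subset_Icc_self).mem_closure_image h1)
  rintro _ ⟨s, hs, rfl⟩
  exact ⟨mem_image_of_mem _ (Ioo_subset_Icc_self hs), hV s hs⟩

theorem exists_vert_mem_edge {e : Set S2} (he : e ∈ G.edges) : ∃ v ∈ G.verts, v ∈ e := by
  obtain ⟨γ, hc, -, h0, -, hV, rfl⟩ := G.edge_curve e he
  exact ⟨_, h0, 0, by simp, rfl⟩

theorem edge_subset_carrier {e : Set S2} (he : e ∈ G.edges) : e ⊆ G.carrier :=
  fun _ hx => Or.inr ⟨e, he, hx⟩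

theorem vert_mem_carrier {v : S2} (hv : v ∈ G.verts) : v ∈ G.carrier := Or.inl hv

theorem isClosed_carrier (G : SphereGraph) : IsClosed G.carrier :=
  G.verts_finite.isClosed.union (by
    rw [sUnion_eq_biUnion]
    exact G.edges_finite.isClosed_biUnion fun _ he => (isCompact_edge he).isClosed)

theorem face_subset (f : G.faces) : (f : Set S2) ⊆ G.carrierᶜ := by
  obtain ⟨_, x, hx, rfl⟩ := f
  exact connectedComponentIn_subset _ _

theorem face_isOpen (f : G.faces) : IsOpen (f : Set S2) := by
  obtain ⟨_, x, hx, rfl⟩ := f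
  have := S2.locallyConnectedSpace
  exact G.isClosed_carrier.isOpen_compl.connectedComponentIn

theorem face_isPreconnected (f : G.faces) : IsPreconnected (f : Set S2) := by
  obtain ⟨_, x, hx, rfl⟩ := f
  exact isPreconnected_connectedComponentIn

/-- The face that contains a given point of the complement of the drawing. -/
def faceOf {x : S2} (hx : x ∉ G.carrier) : G.faces :=
  ⟨connectedComponentIn G.carrierᶜ x, x, hx, rfl⟩

theorem mem_faceOf {x : S2} (hx : x ∉ G.carrier) : x ∈ (faceOf hx : Set S2) :=
  mem_connectedComponentIn hx

theorem face_eq_component (f : G.faces) {x : S2} (hx : x ∈ (f : Set S2)) :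
    (f : Set S2) = connectedComponentIn G.carrierᶜ x := by
  obtain ⟨_, y, hy, rfl⟩ := f
  exact connectedComponentIn_eq hx

theorem face_eq {f g : G.faces} {x : S2} (hf : x ∈ (f : Set S2)) (hg : x ∈ (g : Set S2)) : f = g :=
  Subtype.ext ((face_eq_component f hf).trans (face_eq_component g hg).symm)

theorem subset_face {f : G.faces} {S : Set S2} (hS : IsPreconnected S) (hd : S ⊆ G.carrierᶜ)
    {x : S2} (hx : x ∈ S) (hxf : x ∈ (f : Set S2)) : S ⊆ f := by
  rw [face_eq_component f hxf]
  exact hS.subset_connectedComponentIn hx hd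

theorem exists_face {x : S2} (hx : x ∉ G.carrier) : ∃ f : G.faces, x ∈ (f : Set S2) :=
  ⟨faceOf hx, mem_faceOf hx⟩

theorem edge_eq {e e' : G.edges} {x : S2} (h : x ∈ (e : Set S2)) (h' : x ∈ (e' : Set S2))
    (hx : x ∉ G.verts) : e = e' := by
  by_contra hne
  exact hx (G.edge_inter e e.2 e' e'.2 (fun h => hne (Subtype.ext h)) ⟨h, h'⟩)

end SphereGraph

namespace FaceCharts
open SphereGraph
variable {G : SphereGraph} (P : FaceCharts G)

theorem chart_mem_side (f : G.faces) (i : Fin (P.deg f)) {s : ℝ} (h0 : 0 < s) (h1 : s < 1) :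
    P.chart f (discPoint (P.deg f) 1 (i + s)) ∈ (P.side f i : Set S2) \ G.verts := by
  rw [← P.side_image f i]
  exact ⟨i + s, ⟨by linarith, by linarith⟩, rfl⟩

theorem exists_of_mem_side (f : G.faces) (i : Fin (P.deg f)) {x : S2}
    (hx : x ∈ (P.side f i : Set S2)) (hV : x ∉ G.verts) :
    ∃ s, 0 < s ∧ s < 1 ∧ x = P.chart f (discPoint (P.deg f) 1 (i + s)) := by
  have : x ∈ (P.side f i : Set S2) \ G.verts := ⟨hx, hV⟩
  rw [← P.side_image f i] at this
  obtain ⟨t, ht, rfl⟩ := this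
  exact ⟨t - i, by linarith [ht.1], by linarith [ht.2], by simp⟩

theorem side_inj (f : G.faces) (i : Fin (P.deg f)) {s s' : ℝ} (h0 : 0 < s) (h1 : s < 1)
    (h0' : 0 < s') (h1' : s' < 1) (h : P.chart f (discPoint (P.deg f) 1 (i + s)) =
      P.chart f (discPoint (P.deg f) 1 (i + s'))) : s = s' := by
  have := P.side_injOn f i (x₁ := i + s) ⟨by linarith, by linarith⟩ (x₂ := i + s')
    ⟨by linarith, by linarith⟩ h
  linarith

theorem circle_cases (f : G.faces) {z : ℂ} (hz : ‖z‖ = 1) :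
    (∃ i : Fin (P.deg f), z = discPoint (P.deg f) 1 i) ∨ ∃ (i : Fin (P.deg f)) (s : ℝ),
      0 < s ∧ s < 1 ∧ z = discPoint (P.deg f) 1 (i + s) := by
  obtain ⟨k, s, h0, h1, h⟩ := exists_side_point (P.deg_pos f) z
  rw [hz] at h
  rcases h0.eq_or_lt with h2 | h2
  · exact Or.inl ⟨k, by rw [h, ← h2, add_zero]⟩
  · exact Or.inr ⟨k, s, h2, h1, h⟩

theorem chart_mem_carrier (f : G.faces) {z : ℂ} (hz : ‖z‖ = 1) : P.chart f z ∈ G.carrier := by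
  rcases P.circle_cases f hz with ⟨i, rfl⟩ | ⟨i, s, h0, h1, rfl⟩
  · exact vert_mem_carrier (P.corner_mem f i)
  · exact edge_subset_carrier (P.side f i).2 (P.chart_mem_side f i h0 h1).1

theorem chart_mem_face (f : G.faces) {z : ℂ} (hz : ‖z‖ < 1) : P.chart f z ∈ (f : Set S2) := by
  rw [← P.chart_image f]
  exact mem_image_of_mem _ (mem_ball_iff_norm_lt.2 hz)

theorem chart_notMem_carrier (f : G.faces) {z : ℂ} (hz : ‖z‖ < 1) : P.chart f z ∉ G.carrier :=
  face_subset f (P.chart_mem_face f hz)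

/-- A point inside a face has only one preimage under all the charts of closed faces. -/
theorem chart_eq {f g : G.faces} {z w : ℂ} (hz : ‖z‖ < 1) (hw : ‖w‖ ≤ 1)
    (h : P.chart f z = P.chart g w) : f = g ∧ z = w := by
  rcases hw.eq_or_lt with h1 | h1
  · exact (P.chart_notMem_carrier f hz (h ▸ P.chart_mem_carrier g h1)).elim
  · have : f = g := face_eq (P.chart_mem_face f hz) (h ▸ P.chart_mem_face g h1)
    subst this
    exact ⟨rfl, P.chart_injOn f (mem_ball_iff_norm_lt.2 hz) (mem_ball_iff_norm_lt.2 h1) h⟩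

theorem mem_closedBall_iff {z : ℂ} : z ∈ closedBall (0 : ℂ) 1 ↔ ‖z‖ ≤ 1 := mem_closedBall_zero_iff

/-- The fibres on the circle are finite: a vertex comes from corners only, and any other point comes
from at most one point of each side. -/
theorem isCell (f : G.faces) : IsCell (closedBall 0 1) (ball 0 1) (P.chart f) where
  compact := isCompact_closedBall 0 1
  isOpen := isOpen_ball
  convex := convex_ball 0 1
  subset := ball_subset_closedBall
  dense := by rw [closure_ball _ one_ne_zero]
  cont := P.chart_continuousOn f
  inj := P.chart_injOn f
  apart := fun x hx y hy h => by
    obtain ⟨-, rfl⟩ := P.chart_eq (mem_ball_iff_norm_lt.1 hy) (mem_closedBall_iff.1 hx) h.symm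
    exact hy
  finite := fun y => by
    have h1 : {x ∈ ball (0 : ℂ) 1 | P.chart f x = y}.Finite :=
      Subsingleton.finite fun a ha b hb => P.chart_injOn f ha.1 hb.1 (ha.2.trans hb.2.symm)
    have h2 : (⋃ i : Fin (P.deg f), ({discPoint (P.deg f) 1 i} ∪
        (fun s : ℝ => discPoint (P.deg f) 1 (i + s)) '' {s | 0 < s ∧ s < 1 ∧
          P.chart f (discPoint (P.deg f) 1 (i + s)) = y})).Finite := by
      refine finite_iUnion fun i => (finite_singleton _).union (Finite.image _ ?_)
      exact Subsingleton.finite fun a ha b hb =>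
        P.side_inj f i ha.1 ha.2.1 hb.1 hb.2.1 (ha.2.2.trans hb.2.2.symm)
    refine (h1.union h2).subset ?_
    rintro x ⟨hx, hxy⟩
    rcases (mem_closedBall_iff.1 hx).eq_or_lt with h | h
    · right
      rcases P.circle_cases f h with ⟨i, rfl⟩ | ⟨i, s, h0, h1, rfl⟩
      · exact mem_iUnion.2 ⟨i, Or.inl rfl⟩
      · exact mem_iUnion.2 ⟨i, Or.inr ⟨s, ⟨h0, h1, hxy⟩, rfl⟩⟩
    · exact Or.inl ⟨mem_ball_iff_norm_lt.2 h, hxy⟩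

theorem isOpen_chart_image (f : G.faces) {W : Set ℂ} (hW : IsOpen W) (h : W ⊆ ball 0 1) :
    IsOpen (P.chart f '' W) :=
  (P.isCell f).isOpen_image (by rw [P.chart_image]; exact face_isOpen f) hW h

theorem exists_side (e : G.edges) : ∃ (f : G.faces) (i : Fin (P.deg f)), P.side f i = e := by
  have h := P.two_sides e
  obtain ⟨⟨f, i⟩, hp⟩ := nonempty_of_ncard_ne_zero (by rw [h]; norm_num)
  exact ⟨f, i, hp⟩

theorem mark_mem (e : G.edges) : P.mark e ∈ (e : Set S2) \ G.verts := by
  obtain ⟨f, i, rfl⟩ := P.exists_side e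
  rw [← P.chart_mid]
  exact P.chart_mem_side f i (by norm_num) (by norm_num)

theorem mark_inj {Q : FaceCharts G} {e e' : G.edges} (h : P.mark e = Q.mark e') : e = e' :=
  edge_eq (P.mark_mem e).1 (h ▸ (Q.mark_mem e').1) (P.mark_mem e).2

/-- A circle point that is carried to a marked point is the midpoint of a side. -/
theorem eq_mid_of_chart_eq_mark {f : G.faces} {z : ℂ} (hz : ‖z‖ = 1) {e : G.edges}
    (h : P.chart f z = P.mark e) :
    ∃ i : Fin (P.deg f), P.side f i = e ∧ z = discPoint (P.deg f) 1 (i + 1 / 2) := by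
  rcases P.circle_cases f hz with ⟨i, rfl⟩ | ⟨i, s, h0, h1, rfl⟩
  · exact ((P.mark_mem e).2 (h ▸ P.corner_mem f i)).elim
  · have h2 := P.chart_mem_side f i h0 h1
    have h3 : P.side f i = e := edge_eq (h ▸ h2.1 : P.mark e ∈ _) (P.mark_mem e).1 (P.mark_mem e).2
    rw [← h3, ← P.chart_mid] at h
    have := P.side_inj f i h0 h1 (by norm_num) (by norm_num) h
    exact ⟨i, h3, by rw [this]⟩

theorem finite_sides : Finite ((f : G.faces) × Fin (P.deg f)) := by
  have : Finite G.edges := G.edges_finite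
  have h : (univ : Set ((f : G.faces) × Fin (P.deg f))) =
      ⋃ e : G.edges, {p | P.side p.1 p.2 = e} := by
    ext p
    simp
  rw [← finite_univ_iff, h]
  exact finite_iUnion fun e => finite_of_ncard_ne_zero (by rw [P.two_sides]; norm_num)

theorem finite_faces (P : FaceCharts G) : Finite G.faces := by
  have := P.finite_sides
  exact Finite.of_surjective (fun p : (f : G.faces) × Fin (P.deg f) => p.1)
    fun f => ⟨⟨f, ⟨0, P.deg_pos f⟩⟩, rfl⟩

/-- A closed side is mapped into its edge. -/
theorem chart_mem_edge (f : G.faces) (i : Fin (P.deg f)) {s : ℝ} (h0 : 0 ≤ s) (h1 : s ≤ 1) :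
    P.chart f (discPoint (P.deg f) 1 (i + s)) ∈ (P.side f i : Set S2) := by
  have hc : ContinuousOn (fun s : ℝ => P.chart f (discPoint (P.deg f) 1 (i + s))) univ :=
    (P.chart_continuousOn f).comp (by
      have := (discPoint_continuous (P.deg f)).comp
        (by fun_prop : Continuous fun s : ℝ => ((1 : ℝ), (i : ℝ) + s))
      exact this.continuousOn) (fun s _ => by
        rw [mem_closedBall_iff, discPoint_norm, abs_one])
  have h2 : s ∈ closure (Ioo (0 : ℝ) 1) := by
    rw [closure_Ioo zero_ne_one]; exact ⟨h0, h1⟩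
  have h3 := ((hc s trivial).mono (subset_univ (Ioo 0 1))).mem_closure_image h2
  refine (isCompact_edge (P.side f i).2).isClosed.closure_subset_iff.2 ?_ h3
  rintro _ ⟨t, ht, rfl⟩
  exact (P.chart_mem_side f i ht.1 ht.2).1

/-- The ends of an edge are the corners at the ends of each of its sides. -/
theorem end_eq_corner (f : G.faces) (i : Fin (P.deg f)) {v : S2} (hv : v ∈ G.verts)
    (h : v ∈ (P.side f i : Set S2)) : v = P.chart f (discPoint (P.deg f) 1 i) ∨
      v = P.chart f (discPoint (P.deg f) 1 (i + 1)) := by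
  have hc : Continuous (fun s : ℝ => discPoint (P.deg f) 1 (i + s)) :=
    (discPoint_continuous (P.deg f)).comp
        (by fun_prop : Continuous fun s : ℝ => ((1 : ℝ), (i : ℝ) + s))
  have hK : IsCompact ((fun s : ℝ => P.chart f (discPoint (P.deg f) 1 (i + s))) '' Icc 0 1) :=
    isCompact_Icc.image_of_continuousOn ((P.chart_continuousOn f).comp hc.continuousOn
      (fun s _ => by rw [mem_closedBall_iff, discPoint_norm, abs_one]))
  have h1 := edge_subset_closure (P.side f i).2 h
  have h2 : (P.side f i : Set S2) \ G.verts ⊆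
      (fun s : ℝ => P.chart f (discPoint (P.deg f) 1 (i + s))) '' Icc 0 1 := fun x hx => by
    obtain ⟨s, h0, h1, rfl⟩ := P.exists_of_mem_side f i hx.1 hx.2
    exact ⟨s, ⟨h0.le, h1.le⟩, rfl⟩
  obtain ⟨s, ⟨hs0, hs1⟩, rfl⟩ := hK.isClosed.closure_subset_iff.2 h2 h1
  rcases hs0.eq_or_lt with h0 | h0
  · left; simp [← h0]
  rcases hs1.eq_or_lt with h1 | h1
  · right; simp [h1]
  · exact ((P.chart_mem_side f i h0 h1).2 hv).elim

/-- The end of a side is again a corner of the polygon. -/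
theorem exists_corner_eq (f : G.faces) (i : Fin (P.deg f)) :
    ∃ j : Fin (P.deg f), discPoint (P.deg f) 1 (i + 1) = discPoint (P.deg f) 1 j := by
  obtain ⟨k, m, h⟩ := exists_fin_add_mul (P.deg_pos f) (i + 1)
  exact ⟨k, discPoint_congr (P.deg_pos f) zero_le_one m (by rw [← h]; simp)⟩

theorem closure_face (f : G.faces) : closure (f : Set S2) = P.chart f '' closedBall 0 1 := by
  have h := P.isCell f
  refine subset_antisymm (closure_minimal ?_ (h.compact.image_of_continuousOn h.cont).isClosed) ?_
  · rw [← P.chart_image f]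
    exact image_mono ball_subset_closedBall
  · rw [← P.chart_image f, ← closure_ball _ one_ne_zero]
    exact (by rw [closure_ball _ one_ne_zero]; exact P.chart_continuousOn f :
      ContinuousOn (P.chart f) (closure (ball 0 1))).image_closure

theorem mem_closure_of_side (f : G.faces) (i : Fin (P.deg f)) :
    (P.side f i : Set S2) ⊆ closure (f : Set S2) := by
  refine (edge_subset_closure (P.side f i).2).trans (closure_minimal ?_ isClosed_closure)
  intro x hx
  obtain ⟨s, h0, h1, rfl⟩ := P.exists_of_mem_side f i hx.1 hx.2
  rw [P.closure_face]
  exact mem_image_of_mem _ (by rw [mem_closedBall_iff, discPoint_norm, abs_one])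

/-- The closed faces cover the sphere. -/
theorem exists_mem_closure (P : FaceCharts G) (x : S2) :
    ∃ f : G.faces, x ∈ closure (f : Set S2) := by
  have hfin := P.finite_faces
  have hS2 := S2.connectedSpace
  have hnt : Nontrivial S2 := by
    refine ⟨⟨⟨EuclideanSpace.single 0 1, by simp⟩, -⟨EuclideanSpace.single 0 1, by simp⟩, ?_⟩⟩
    intro h
    have := congrArg (fun x : S2 => x.1 0) h
    simp at this
    norm_num at this
  have hd : Dense (univ \ G.verts) := dense_univ.sdiff_finite G.verts_finite
  have hcl : IsClosed (⋃ f : G.faces, closure (f : Set S2)) :=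
    isClosed_iUnion_of_finite fun f => isClosed_closure
  have hsub : univ \ G.verts ⊆ ⋃ f : G.faces, closure (f : Set S2) := by
    rintro y ⟨-, hy⟩
    by_cases h : y ∈ G.carrier
    · obtain ⟨e, he, hye⟩ := h.resolve_left hy
      obtain ⟨f, i, hfi⟩ := P.exists_side ⟨e, he⟩
      exact mem_iUnion.2 ⟨f, P.mem_closure_of_side f i (by rw [hfi]; exact hye)⟩
    · obtain ⟨f, hf⟩ := exists_face h
      exact mem_iUnion.2 ⟨f, subset_closure hf⟩
  have := hcl.closure_subset_iff.2 hsub (hd x)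
  exact mem_iUnion.1 this

/-- A point outside the vertices in two closed faces lies on a side of both. -/
theorem exists_common_side {f g : G.faces} (hfg : f ≠ g) {x : S2} (hx : x ∉ G.verts)
    (hf : x ∈ closure (f : Set S2)) (hg : x ∈ closure (g : Set S2)) :
    ∃ (i : Fin (P.deg f)) (j : Fin (P.deg g)), P.side f i = P.side g j := by
  rw [P.closure_face] at hf hg
  obtain ⟨z, hz, rfl⟩ := hf
  obtain ⟨w, hw, hwz⟩ := hg
  rw [mem_closedBall_iff] at hz hw
  have hz1 : ‖z‖ = 1 := hz.eq_or_lt.resolve_right fun h => hfg (P.chart_eq h hw hwz.symm).1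
  have hw1 : ‖w‖ = 1 := hw.eq_or_lt.resolve_right fun h => hfg (P.chart_eq h hz hwz).1.symm
  rcases P.circle_cases f hz1 with ⟨i, rfl⟩ | ⟨i, s, h0, h1, rfl⟩
  · exact (hx (P.corner_mem f i)).elim
  rcases P.circle_cases g hw1 with ⟨j, rfl⟩ | ⟨j, s', h0', h1', rfl⟩
  · exact (hx (hwz ▸ P.corner_mem g j)).elim
  exact ⟨i, j, edge_eq (P.chart_mem_side f i h0 h1).1 (hwz ▸ (P.chart_mem_side g j h0' h1').1) hx⟩

/-- The dual graph is connected: a set of faces closed under crossing edges contains all faces. -/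
theorem mem_of_side_closed {S : Set G.faces} (hne : S.Nonempty)
    (h : ∀ f ∈ S, ∀ g, ∀ (i : Fin (P.deg f)) (j : Fin (P.deg g)), P.side f i = P.side g j → g ∈ S)
    (g : G.faces) : g ∈ S := by
  by_contra hg
  have hfin := P.finite_faces
  obtain ⟨f, hf⟩ := hne
  have hVne : G.verts.Nonempty := ⟨_, P.corner_mem f ⟨0, P.deg_pos f⟩⟩
  have hcl : ∀ T : Set G.faces, IsClosed (⋃ f ∈ T, closure (f : Set S2)) := fun T =>
    (toFinite T).isClosed_biUnion fun f _ => isClosed_closure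
  obtain ⟨x, hxV, hx1, hx2⟩ := isPreconnected_closed_iff.1
    (isPreconnected_compl_of_finite G.verts_finite hVne) _ _ (hcl S) (hcl Sᶜ) (fun x _ => by
      obtain ⟨k, hk⟩ := P.exists_mem_closure x
      by_cases hkS : k ∈ S
      · exact Or.inl (mem_biUnion hkS hk)
      · exact Or.inr (mem_biUnion (show k ∈ Sᶜ from hkS) hk))
    ⟨P.chart f 0, fun hV => P.chart_notMem_carrier f (by simp) (vert_mem_carrier hV),
      mem_biUnion hf (subset_closure (P.chart_mem_face f (by simp)))⟩
    ⟨P.chart g 0, fun hV => P.chart_notMem_carrier g (by simp) (vert_mem_carrier hV),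
      mem_biUnion (show g ∈ Sᶜ from hg) (subset_closure (P.chart_mem_face g (by simp)))⟩
  obtain ⟨k, hk, hxk⟩ := mem_iUnion₂.1 hx1
  obtain ⟨l, hl, hxl⟩ := mem_iUnion₂.1 hx2
  obtain ⟨i, j, hij⟩ := P.exists_common_side (fun h : k = l => hl (h ▸ hk)) hxV hxk hxl
  exact hl (h k hk l i j hij)

end FaceCharts

/-! ### Faces of the medial graph and their colourings -/

/-- The midpoint of the side before corner `k` is the midpoint of a side of the polygon. -/
theorem discPoint_mid_sub {n : ℕ} (k : Fin n) : ∃ i : Fin n,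
    discPoint n 1 (k + -(1 / 2)) = discPoint n 1 (i + 1 / 2) := by
  obtain ⟨i, m, h⟩ := exists_fin_add_mul k.pos ((k : ℤ) - 1)
  refine ⟨i, discPoint_congr k.pos zero_le_one m ?_⟩
  push_cast at h
  linarith

theorem cornerArc_norm {n : ℕ} {k : Fin n} {z : ℂ} (hz : z ∈ cornerArc n k) : ‖z‖ ≤ 1 := by
  obtain ⟨s, hs, rfl⟩ := mem_cornerArc.1 hz
  rw [polar_norm (by positivity)]
  show 1 / 2 + |s| ≤ 1
  linarith

/-- A corner arc meets the circle in midpoints of sides. -/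
theorem eq_mid_of_mem_cornerArc {n : ℕ} {k : Fin n} {z : ℂ} (hz : z ∈ cornerArc n k)
    (h1 : ‖z‖ = 1) : ∃ i : Fin n, z = discPoint n 1 (i + 1 / 2) := by
  obtain ⟨s, hs, rfl⟩ := mem_cornerArc.1 hz
  rw [polar_norm (by positivity)] at h1
  have h2 : |s| = 1 / 2 := by simp only at h1; linarith
  have h3 : (1 / 2 + |s| : ℝ) = 1 := h1
  rcases (abs_eq (by norm_num)).1 h2 with h | h
  · exact ⟨k, by rw [polar, h3, h]⟩
  · rw [polar, h3, h]
    exact discPoint_mid_sub k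

theorem mid_mem_cornerArc {n : ℕ} (k : Fin n) : discPoint n 1 (k + 1 / 2) ∈ cornerArc n k := by
  refine mem_cornerArc.2 ⟨1 / 2, by norm_num [abs_of_pos], ?_⟩
  rw [polar]
  norm_num

namespace FaceCharts
open SphereGraph
variable {G M : SphereGraph} {Q : FaceCharts G}

/-- `M` is the medial graph drawn by the corner arcs of the charts `Q`. -/
def IsMedialOf (Q : FaceCharts G) (M : SphereGraph) : Prop :=
  M.verts = range Q.mark ∧
    M.edges = {a | ∃ (f : G.faces) (k : Fin (Q.deg f)), a = Q.chart f '' cornerArc (Q.deg f) k}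

theorem chart_mid_mem (Q : FaceCharts G) {f : G.faces} {k : Fin (Q.deg f)} {z : ℂ}
    (hz : z ∈ cornerArc (Q.deg f) k) (h1 : ‖z‖ = 1) : Q.chart f z ∈ range Q.mark := by
  obtain ⟨i, rfl⟩ := eq_mid_of_mem_cornerArc hz h1
  exact ⟨_, (Q.chart_mid f i).symm⟩

namespace IsMedialOf
variable (h : Q.IsMedialOf M)
include h

theorem mem_carrier {x : S2} : x ∈ M.carrier ↔
    ∃ (f : G.faces) (k : Fin (Q.deg f)) (z : ℂ), z ∈ cornerArc (Q.deg f) k ∧ x = Q.chart f z := by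
  unfold SphereGraph.carrier
  rw [h.1, h.2]
  constructor
  · rintro (⟨e, rfl⟩ | ⟨_, ⟨f, k, rfl⟩, z, hz, rfl⟩)
    · obtain ⟨f, i, rfl⟩ := Q.exists_side e
      exact ⟨f, i, _, mid_mem_cornerArc i, (Q.chart_mid f i).symm⟩
    · exact ⟨f, k, z, hz, rfl⟩
  · rintro ⟨f, k, z, hz, rfl⟩
    exact Or.inr ⟨_, ⟨f, k, rfl⟩, z, hz, rfl⟩

theorem chart_mem_carrier {f : G.faces} {z : ℂ} (hz : ‖z‖ < 1) :
    Q.chart f z ∈ M.carrier ↔ ∃ k, z ∈ cornerArc (Q.deg f) k := by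
  rw [h.mem_carrier]
  constructor
  · rintro ⟨g, k, w, hw, hwz⟩
    obtain ⟨rfl, rfl⟩ := Q.chart_eq hz (cornerArc_norm hw) hwz
    exact ⟨k, hw⟩
  · rintro ⟨k, hk⟩
    exact ⟨f, k, z, hk, rfl⟩

theorem mem_range_mark {x : S2} (hx : x ∈ M.carrier) (hxG : x ∈ G.carrier) : x ∈ range Q.mark := by
  obtain ⟨f, k, z, hz, rfl⟩ := h.mem_carrier.1 hx
  refine Q.chart_mid_mem hz ((cornerArc_norm hz).eq_or_lt.resolve_right fun h1 => ?_)
  exact Q.chart_notMem_carrier f h1 hxG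

theorem vert_notMem {v : S2} (hv : v ∈ G.verts) : v ∉ M.carrier := fun hx => by
  obtain ⟨e, rfl⟩ := h.mem_range_mark hx (vert_mem_carrier hv)
  exact (Q.mark_mem e).2 hv

theorem inner_subset (f : G.faces) : Q.chart f '' innerRegion (Q.deg f) ⊆ M.carrierᶜ := by
  rintro _ ⟨z, hz, rfl⟩ hM
  obtain ⟨k, hk⟩ := (h.chart_mem_carrier (mem_ball_iff_norm_lt.1 hz.1)).1 hM
  exact hz.2 (mem_iUnion.2 ⟨k, cornerArc_subset_closedCorner k hk⟩)

theorem region_subset (f : G.faces) (k : Fin (Q.deg f)) :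
    Q.chart f '' cornerRegion (Q.deg f) k ⊆ M.carrierᶜ := by
  rintro _ ⟨z, hz, rfl⟩ hM
  rw [cornerRegion_eq] at hz
  obtain ⟨j, hj⟩ := (h.chart_mem_carrier (mem_ball_iff_norm_lt.1 hz.1)).1 hM
  refine hz.2 (Or.inl ?_)
  obtain ⟨s, hs, rfl⟩ := mem_cornerArc.1 hj
  exact mem_iUnion.2 ⟨j, (1 / 2 + |s|, s), ⟨hs, by positivity, le_rfl⟩, rfl⟩

omit h in
theorem isPreconnected_inner (f : G.faces) : IsPreconnected (Q.chart f '' innerRegion (Q.deg f)) :=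
  (isPreconnected_innerRegion _).image _
    ((Q.chart_continuousOn f).mono (sdiff_subset.trans ball_subset_closedBall))

omit h in
theorem region_subset_ball {n : ℕ} (k : Fin n) : cornerRegion n k ⊆ ball 0 1 := by
  rw [cornerRegion_eq]; exact sdiff_subset

omit h in
theorem isPreconnected_region (f : G.faces) (k : Fin (Q.deg f)) :
    IsPreconnected (Q.chart f '' cornerRegion (Q.deg f) k) :=
  (isPreconnected_cornerRegion _).image _
    ((Q.chart_continuousOn f).mono ((region_subset_ball k).trans ball_subset_closedBall))

omit h in
theorem image_closure_subset {f : G.faces} {W : Set ℂ} (hW : W ⊆ ball 0 1) :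
    Q.chart f '' closure W ⊆ closure (Q.chart f '' W) :=
  ((Q.chart_continuousOn f).mono (by
    rw [← closure_ball _ one_ne_zero]; exact closure_mono hW)).image_closure

/-- The inner polygon of a face of `G` is a whole face of the medial graph. -/
theorem inner_eq_of_mem {φ : M.faces} {f : G.faces} {x : S2}
    (hx : x ∈ Q.chart f '' innerRegion (Q.deg f)) (hφ : x ∈ (φ : Set S2)) :
    (φ : Set S2) = Q.chart f '' innerRegion (Q.deg f) := by
  refine subset_antisymm ?_ (subset_face (isPreconnected_inner f) (h.inner_subset f) hx hφ)
  have hcl : IsClosed (Q.chart f '' closedInner (Q.deg f)) := by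
    refine ((isCompact_closedInner _).image_of_continuousOn ?_).isClosed
    refine (Q.chart_continuousOn f).mono fun z hz => ?_
    rw [mem_closedBall_iff]
    rcases closedInner_subset hz with hz | hz
    · exact (mem_ball_iff_norm_lt.1 hz.1).le
    · obtain ⟨k, hk⟩ := mem_iUnion.1 hz
      exact cornerArc_norm hk
  refine IsPreconnected.subset_left_of_subset_union
    (Q.isOpen_chart_image f (isOpen_innerRegion _) sdiff_subset) hcl.isOpen_compl ?_ ?_
    ⟨x, hφ, hx⟩ (face_isPreconnected φ)
  · rw [disjoint_compl_right_iff_subset]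
    exact image_mono (subset_closure.trans (closure_innerRegion_subset (Q.deg_pos f)))
  · intro y hy
    by_cases hc : y ∈ Q.chart f '' closedInner (Q.deg f)
    · left
      obtain ⟨z, hz, rfl⟩ := hc
      rcases closedInner_subset hz with hz | hz
      · exact mem_image_of_mem _ hz
      · obtain ⟨k, hk⟩ := mem_iUnion.1 hz
        exact (face_subset φ hy (h.mem_carrier.2 ⟨f, k, z, hk, rfl⟩)).elim
    · exact Or.inr hc

omit h in
theorem vert_notMem_inner {v : S2} (hv : v ∈ G.verts) (f : G.faces) :
    v ∉ Q.chart f '' innerRegion (Q.deg f) := by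
  rintro ⟨z, hz, rfl⟩
  exact Q.chart_notMem_carrier f (mem_ball_iff_norm_lt.1 hz.1) (vert_mem_carrier hv)

/-- A face of the medial graph that meets the closure of a corner region contains this region. -/
theorem region_subset_of_mem {φ : M.faces} {f : G.faces} {k : Fin (Q.deg f)} {x : S2}
    (hx : x ∈ closure (Q.chart f '' cornerRegion (Q.deg f) k)) (hφ : x ∈ (φ : Set S2)) :
    Q.chart f '' cornerRegion (Q.deg f) k ⊆ φ := by
  obtain ⟨y, hy, hyr⟩ := mem_closure_iff.1 hx _ (face_isOpen φ) hφ
  exact subset_face (isPreconnected_region f k) (h.region_subset f k) hyr hy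

/-- A face of the medial graph that meets the closure of a corner region contains the corner: both
lie in the closure of the corner region, which is contained in a single face. -/
theorem corner_mem_of_mem {φ : M.faces} {f : G.faces} {k : Fin (Q.deg f)} {x : S2}
    (hx : x ∈ closure (Q.chart f '' cornerRegion (Q.deg f) k)) (hφ : x ∈ (φ : Set S2)) :
    Q.chart f (discPoint (Q.deg f) 1 k) ∈ (φ : Set S2) := by
  have h1 := h.region_subset_of_mem hx hφ
  obtain ⟨ψ, hψ⟩ := exists_face (h.vert_notMem (Q.corner_mem f k))
  have h2 : Q.chart f (discPoint (Q.deg f) 1 k) ∈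
      closure (Q.chart f '' cornerRegion (Q.deg f) k) := by
    refine image_closure_subset (region_subset_ball k) (mem_image_of_mem _
      (closedCorner_subset_closure k ⟨(1, 0), ⟨?_, ?_, le_rfl⟩, by simp [polar]⟩))
    · simp
    · norm_num
  have h3 := h.region_subset_of_mem h2 hψ
  obtain ⟨y, -, hyr⟩ := mem_closure_iff.1 hx _ (face_isOpen φ) hφ
  rwa [face_eq (h1 hyr) (h3 hyr)]

/-- A face of the medial graph is an inner polygon or contains a vertex. -/
theorem face_cases (φ : M.faces) :
    (∃ f, (φ : Set S2) = Q.chart f '' innerRegion (Q.deg f)) ∨ ∃ v ∈ G.verts, v ∈ (φ : Set S2) := by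
  obtain ⟨x, hx⟩ : (φ : Set S2).Nonempty := by
    obtain ⟨_, y, hy, rfl⟩ := φ
    exact ⟨y, mem_connectedComponentIn hy⟩
  obtain ⟨f, hf⟩ := Q.exists_mem_closure x
  rw [Q.closure_face] at hf
  obtain ⟨z, hz, rfl⟩ := hf
  rw [mem_closedBall_iff] at hz
  rcases mem_disc_cases (Q.deg_pos f) hz with h1 | ⟨k, hk⟩
  · rcases closedInner_subset h1 with h1 | h1
    · exact Or.inl ⟨f, h.inner_eq_of_mem (mem_image_of_mem _ h1) hx⟩
    · obtain ⟨k, hk⟩ := mem_iUnion.1 h1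
      exact (face_subset φ hx (h.mem_carrier.2 ⟨f, k, z, hk, rfl⟩)).elim
  · exact Or.inr ⟨_, Q.corner_mem f k, h.corner_mem_of_mem (image_closure_subset
      (region_subset_ball k) (mem_image_of_mem _ (closedCorner_subset_closure k hk))) hx⟩

/-- Of two faces of the medial graph that share an edge, one is an inner polygon and the other one
contains a vertex. -/
theorem cases_of_share {φ ψ : M.faces} (hne : φ ≠ ψ)
    (hs : ∃ a ∈ M.edges, a ⊆ closure (φ : Set S2) ∧ a ⊆ closure (ψ : Set S2)) :
    (∃ f, (φ : Set S2) = Q.chart f '' innerRegion (Q.deg f) ∧ ∃ v ∈ G.verts, v ∈ (ψ : Set S2)) ∨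
      ∃ f, (ψ : Set S2) = Q.chart f '' innerRegion (Q.deg f) ∧ ∃ v ∈ G.verts, v ∈ (φ : Set S2) := by
  obtain ⟨a, ha, haφ, haψ⟩ := hs
  rw [h.2] at ha
  obtain ⟨f, k, rfl⟩ := ha
  have hz : polar (Q.deg f) k (1 / 2, 0) ∈ cornerArc (Q.deg f) k :=
    mem_cornerArc.2 ⟨0, by norm_num, by norm_num⟩
  have hz1 : ‖polar (Q.deg f) k (1 / 2, 0)‖ < 1 := by
    rw [polar_norm (by norm_num)]; norm_num
  obtain ⟨N, hN, hzN, hNb, hNs⟩ := cornerArc_nhd hz hz1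
  have hNo := Q.isOpen_chart_image f hN hNb
  have key : ∀ χ : M.faces, Q.chart f '' cornerArc (Q.deg f) k ⊆ closure (χ : Set S2) →
      (χ : Set S2) = Q.chart f '' innerRegion (Q.deg f) ∨
      (Q.chart f '' cornerRegion (Q.deg f) k ⊆ χ ∧ ∃ v ∈ G.verts, v ∈ (χ : Set S2)) := by
    intro χ hχ
    obtain ⟨_, ⟨w, hw, rfl⟩, hwχ⟩ := mem_closure_iff.1 (hχ (mem_image_of_mem _ hz)) _ hNo
      (mem_image_of_mem _ hzN)
    rcases hNs hw with (h1 | h1) | h1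
    · exact Or.inl (h.inner_eq_of_mem (mem_image_of_mem _ h1) hwχ)
    · exact (face_subset χ hwχ (h.mem_carrier.2 ⟨f, k, w, h1, rfl⟩)).elim
    · have h2 := subset_closure (mem_image_of_mem (Q.chart f) h1)
      exact Or.inr ⟨h.region_subset_of_mem h2 hwχ, _, Q.corner_mem f k, h.corner_mem_of_mem h2 hwχ⟩
  have hreg : (cornerRegion (Q.deg f) k).Nonempty := by
    by_contra hemp
    rw [not_nonempty_iff_eq_empty] at hemp
    have := closedCorner_subset_closure k (cornerArc_subset_closedCorner k hz)
    rw [hemp, closure_empty] at this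
    exact this
  rcases key φ haφ with h1 | h1 <;> rcases key ψ haψ with h2 | h2
  · exact (hne (Subtype.ext (h1.trans h2.symm))).elim
  · exact Or.inl ⟨f, h1, h2.2⟩
  · exact Or.inr ⟨f, h2, h1.2⟩
  · obtain ⟨w, hw⟩ := hreg
    exact (hne (face_eq (h1.1 (mem_image_of_mem _ hw)) (h2.1 (mem_image_of_mem _ hw)))).elim

/-- The faces are coloured by whether they contain a vertex of `G`. -/
theorem exists_properColoring : ∃ C : M.faces → Bool, M.IsProperFaceColoring C := by
  classical
  refine ⟨fun φ => decide (∃ v ∈ G.verts, v ∈ (φ : Set S2)), fun φ ψ hne hs => ?_⟩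
  have key : ∀ (χ : M.faces) (f : G.faces), (χ : Set S2) = Q.chart f '' innerRegion (Q.deg f) →
      ¬ ∃ v ∈ G.verts, v ∈ (χ : Set S2) := by
    rintro χ f hχ ⟨v, hv, hvχ⟩
    exact vert_notMem_inner hv f (hχ ▸ hvχ)
  rcases h.cases_of_share hne hs with ⟨f, hf, hv⟩ | ⟨f, hf, hv⟩
  · simp [hv, key φ f hf]
  · simp [hv, key ψ f hf]

/-- An inner polygon and the faces around its corners are separated by corner arcs. -/
theorem color_ne {C : M.faces → Bool} (hC : M.IsProperFaceColoring C) {φ ψ : M.faces} {f : G.faces}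
    (hφ : (φ : Set S2) = Q.chart f '' innerRegion (Q.deg f)) (k : Fin (Q.deg f))
    (hψ : Q.chart f (discPoint (Q.deg f) 1 k) ∈ (ψ : Set S2)) : C φ ≠ C ψ := by
  have h2 : Q.chart f (discPoint (Q.deg f) 1 k) ∈
      closure (Q.chart f '' cornerRegion (Q.deg f) k) := by
    refine image_closure_subset (region_subset_ball k) (mem_image_of_mem _
      (closedCorner_subset_closure k ⟨(1, 0), ⟨?_, ?_, le_rfl⟩, by simp [polar]⟩))
    · simp
    · norm_num
  have h3 := h.region_subset_of_mem h2 hψ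
  refine hC φ ψ ?_ ⟨Q.chart f '' cornerArc (Q.deg f) k, ?_, ?_, ?_⟩
  · rintro rfl
    exact vert_notMem_inner (Q.corner_mem f k) f (hφ ▸ hψ)
  · rw [h.2]
    exact ⟨f, k, rfl⟩
  · rw [hφ]
    exact (image_mono (cornerArc_subset_closure_innerRegion k)).trans
      (image_closure_subset sdiff_subset)
  · exact ((image_mono ((cornerArc_subset_closedCorner k).trans
      (closedCorner_subset_closure k))).trans
      (image_closure_subset (region_subset_ball k))).trans (closure_mono h3)

/-- In a proper colouring of the medial graph all inner polygons have one colour, and all faces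
around vertices have the other one. -/
theorem exists_color {C : M.faces → Bool} (hC : M.IsProperFaceColoring C) :
    ∃ b : Bool, (∀ (φ : M.faces) (f : G.faces),
      (φ : Set S2) = Q.chart f '' innerRegion (Q.deg f) → C φ = b) ∧
      ∀ (φ : M.faces), ∀ v ∈ G.verts, v ∈ (φ : Set S2) → C φ = !b := by
  have hin : ∀ f : G.faces, ∃ φ : M.faces, (φ : Set S2) = Q.chart f '' innerRegion (Q.deg f) := by
    intro f
    have h0 := mem_image_of_mem (Q.chart f) (zero_mem_innerRegion (Q.deg f))
    obtain ⟨φ, hφ⟩ := exists_face (h.inner_subset f h0)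
    exact ⟨φ, h.inner_eq_of_mem h0 hφ⟩
  choose W hW using hin
  have hbool : ∀ {x y z : Bool}, x ≠ z → y ≠ z → x = y := by decide
  obtain ⟨f₀⟩ : Nonempty G.faces := by
    obtain ⟨f, -⟩ := Q.exists_mem_closure ⟨EuclideanSpace.single 0 1, by simp⟩
    exact ⟨f⟩
  have hconst : ∀ f, C (W f) = C (W f₀) := by
    refine Q.mem_of_side_closed (S := {f | C (W f) = C (W f₀)}) ⟨f₀, rfl⟩ ?_
    intro f hf g i j hij
    obtain ⟨v, hv, hve⟩ := exists_vert_mem_edge (Q.side f i).2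
    obtain ⟨ψ, hψ⟩ := exists_face (h.vert_notMem hv)
    have key : ∀ (g : G.faces) (j : Fin (Q.deg g)), v ∈ (Q.side g j : Set S2) → C (W g) ≠ C ψ := by
      intro g j hvj
      rcases Q.end_eq_corner g j hv hvj with hc | hc
      · exact h.color_ne hC (hW g) j (hc ▸ hψ)
      · obtain ⟨l, hl⟩ := Q.exists_corner_eq g j
        rw [hl] at hc
        exact h.color_ne hC (hW g) l (hc ▸ hψ)
    have h1 := key f i hve
    have h2 := key g j (hij ▸ hve)
    exact (hbool h2 h1).trans hf
  refine ⟨C (W f₀), fun φ f hφ => ?_, fun φ v hv hvφ => ?_⟩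
  · rw [← hconst f]
    congr 1
    exact Subtype.ext (hφ.trans (hW f).symm)
  · obtain ⟨f, hf⟩ := Q.exists_mem_closure v
    rw [Q.closure_face] at hf
    obtain ⟨z, hz, rfl⟩ := hf
    have hz1 : ‖z‖ = 1 := (mem_closedBall_iff.1 hz).eq_or_lt.resolve_right fun h1 =>
      Q.chart_notMem_carrier f h1 (vert_mem_carrier hv)
    rcases Q.circle_cases f hz1 with ⟨k, rfl⟩ | ⟨i, s, h0, h1, rfl⟩
    · have := h.color_ne hC (hW f) k hvφ
      rw [← hconst f]
      revert this
      generalize C (W f) = x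
      generalize C φ = y
      revert x y
      decide
    · exact ((Q.chart_mem_side f i h0 h1).2 hv).elim

end IsMedialOf
end FaceCharts

/-! ### Antipodal duality and symmetric drawings of the medial graph -/

theorem antipodal_image_eq (S : Set S2) : antipodal '' S = {x | -x ∈ S} := by
  ext x
  constructor
  · rintro ⟨y, hy, rfl⟩
    show - -y ∈ S
    rwa [neg_neg]
  · intro h
    exact ⟨-x, h, neg_neg x⟩

theorem mem_antipodal_image {S : Set S2} {x : S2} : x ∈ antipodal '' S ↔ -x ∈ S := by
  rw [antipodal_image_eq]; rfl

theorem antipodal_antipodal_image (S : Set S2) : antipodal '' (antipodal '' S) = S := by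
  ext x
  rw [mem_antipodal_image, mem_antipodal_image, neg_neg]

theorem S2.ne_neg (x : S2) : x ≠ -x := fun h => by
  have h1 : x.1 = -x.1 := congrArg Subtype.val h
  have h2 : x.1 = 0 := by
    have h4 : (2 : ℝ) • x.1 = 0 := by
      rw [two_smul]
      nth_rewrite 2 [h1]
      exact add_neg_cancel _
    exact (smul_eq_zero.1 h4).resolve_left two_ne_zero
  have h3 : ‖x.1‖ = 1 := by simp
  rw [h2, norm_zero] at h3
  exact zero_ne_one h3

namespace FaceCharts
open SphereGraph
variable {G M : SphereGraph} {P Q : FaceCharts G}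

/-- The antipodal image of `G` is the dual graph drawn by the centres and spokes of the
charts `P`. -/
def IsAntipodalDual (P : FaceCharts G) : Prop :=
  G.antipode.verts = range (fun f => P.chart f 0) ∧ G.antipode.edges = range P.dualEdge

theorem mem_dualEdge {P : FaceCharts G} {e : G.edges} {x : S2} : x ∈ P.dualEdge e ↔
    ∃ (f : G.faces) (i : Fin (P.deg f)) (r : ℝ), P.side f i = e ∧ 0 ≤ r ∧ r ≤ 1 ∧
      x = P.chart f (discPoint (P.deg f) r (i + 1 / 2)) := by
  constructor
  · rintro ⟨f, i, hi, _, ⟨r, hr, rfl⟩, rfl⟩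
    exact ⟨f, i, r, hi, hr.1, hr.2, rfl⟩
  · rintro ⟨f, i, r, hi, h0, h1, rfl⟩
    exact ⟨f, i, hi, _, ⟨r, ⟨h0, h1⟩, rfl⟩, rfl⟩

theorem mark_mem_dualEdge (P : FaceCharts G) (e : G.edges) : P.mark e ∈ P.dualEdge e := by
  obtain ⟨f, i, rfl⟩ := P.exists_side e
  exact mem_dualEdge.2 ⟨f, i, 1, rfl, zero_le_one, le_rfl, (P.chart_mid f i).symm⟩

theorem eq_mark_of_mem_dualEdge {e : G.edges} {x : S2} (hx : x ∈ P.dualEdge e)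
    (hxG : x ∈ G.carrier) : x = P.mark e := by
  obtain ⟨f, i, r, rfl, h0, h1, rfl⟩ := mem_dualEdge.1 hx
  rcases h1.eq_or_lt with rfl | h1
  · exact P.chart_mid f i
  · exact (P.chart_notMem_carrier f (by rwa [discPoint_norm, abs_of_nonneg h0]) hxG).elim

/-- A dual edge contains the centre of a face only if the edge is a side of this face. -/
theorem exists_side_of_center_mem {e : G.edges} {f : G.faces} (h : P.chart f 0 ∈ P.dualEdge e) :
    ∃ i, P.side f i = e := by
  obtain ⟨g, i, r, hi, h0, h1, h2⟩ := mem_dualEdge.1 h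
  obtain ⟨rfl, -⟩ := P.chart_eq (by simp) (by rwa [discPoint_norm, abs_of_nonneg h0]) h2
  exact ⟨i, hi⟩

theorem center_mem_dualEdge (f : G.faces) (i : Fin (P.deg f)) :
    P.chart f 0 ∈ P.dualEdge (P.side f i) :=
  mem_dualEdge.2 ⟨f, i, 0, rfl, le_rfl, zero_le_one, by rw [discPoint_zero]⟩

theorem mark_mem_carrier (P : FaceCharts G) (e : G.edges) : P.mark e ∈ G.carrier :=
  edge_subset_carrier e.2 (P.mark_mem e).1

namespace IsAntipodalDual
variable (h : P.IsAntipodalDual)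
include h

theorem exists_center {v : S2} (hv : v ∈ G.verts) : ∃ f, P.chart f 0 = -v := by
  have : -v ∈ G.antipode.verts := mem_antipodal_image.2 (by rwa [neg_neg])
  rw [h.1] at this
  exact this

theorem neg_center_mem (f : G.faces) : -(P.chart f 0) ∈ G.verts := by
  have : P.chart f 0 ∈ G.antipode.verts := by rw [h.1]; exact ⟨f, rfl⟩
  exact mem_antipodal_image.1 this

theorem exists_dualEdge (e : G.edges) : ∃ e', antipodal '' (e : Set S2) = P.dualEdge e' := by
  have : antipodal '' (e : Set S2) ∈ G.antipode.edges := ⟨e, e.2, rfl⟩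
  rw [h.2] at this
  obtain ⟨e', he'⟩ := this
  exact ⟨e', he'.symm⟩

theorem exists_edge (e : G.edges) : ∃ e' : G.edges, antipodal '' (e' : Set S2) = P.dualEdge e := by
  have : P.dualEdge e ∈ G.antipode.edges := by rw [h.2]; exact ⟨e, rfl⟩
  obtain ⟨e', he', h'⟩ := this
  exact ⟨⟨e', he'⟩, h'⟩

/-- The antipodal image of the drawing is the union of all spokes. -/
theorem neg_mem_carrier_iff {x : S2} : -x ∈ G.carrier ↔
    ∃ (f : G.faces) (i : Fin (P.deg f)) (r : ℝ), 0 ≤ r ∧ r ≤ 1 ∧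
      x = P.chart f (discPoint (P.deg f) r (i + 1 / 2)) := by
  constructor
  · rintro (hv | ⟨e, he, hxe⟩)
    · obtain ⟨f, hf⟩ := h.exists_center hv
      rw [neg_neg] at hf
      exact ⟨f, ⟨0, P.deg_pos f⟩, 0, le_rfl, zero_le_one, by rw [discPoint_zero, hf]⟩
    · obtain ⟨e', he'⟩ := h.exists_dualEdge ⟨e, he⟩
      have : x ∈ P.dualEdge e' := by rw [← he']; exact mem_antipodal_image.2 hxe
      obtain ⟨f, i, r, -, h0, h1, h2⟩ := mem_dualEdge.1 this
      exact ⟨f, i, r, h0, h1, h2⟩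
  · rintro ⟨f, i, r, h0, h1, hx⟩
    obtain ⟨e', he'⟩ := h.exists_edge (P.side f i)
    have : x ∈ P.dualEdge (P.side f i) := mem_dualEdge.2 ⟨f, i, r, rfl, h0, h1, hx⟩
    rw [← he'] at this
    exact edge_subset_carrier e'.2 (mem_antipodal_image.1 this)

/-- The drawings of `G` and of its antipodal dual meet in the marked points only. -/
theorem mem_range_mark {x : S2} (hx : x ∈ G.carrier) (hx' : -x ∈ G.carrier) :
    ∃ e, x = P.mark e := by
  obtain ⟨f, i, r, h0, h1, h2⟩ := h.neg_mem_carrier_iff.1 hx'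
  exact ⟨_, eq_mark_of_mem_dualEdge (mem_dualEdge.2 ⟨f, i, r, rfl, h0, h1, h2⟩) hx⟩

theorem neg_mark_mem_carrier (e : G.edges) : -(P.mark e) ∈ G.carrier := by
  obtain ⟨e', he'⟩ := h.exists_edge e
  have : P.mark e ∈ antipodal '' (e' : Set S2) := by rw [he']; exact P.mark_mem_dualEdge e
  exact edge_subset_carrier e'.2 (mem_antipodal_image.1 this)

/-- The antipode of the crossing of `e` with its dual edge is the crossing of the edge antipodal to
this dual edge. -/
theorem neg_mark {e e' : G.edges} (he : antipodal '' (e' : Set S2) = P.dualEdge e) :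
    -(P.mark e) = P.mark e' := by
  have h1 : P.mark e ∈ antipodal '' (e' : Set S2) := by rw [he]; exact P.mark_mem_dualEdge e
  rw [mem_antipodal_image] at h1
  obtain ⟨e'', h2⟩ := h.mem_range_mark (x := -(P.mark e)) (edge_subset_carrier e'.2 h1)
    (by rw [neg_neg]; exact P.mark_mem_carrier e)
  rw [h2]
  have : e' = e'' := edge_eq h1 (h2 ▸ (P.mark_mem e'').1) (by rw [h2]; exact (P.mark_mem e'').2)
  rw [this]

/-- No dual edge is the antipodal image of the edge it crosses, as the crossing would be fixed. -/
theorem ne_of_dual {e e' : G.edges} (he : antipodal '' (e' : Set S2) = P.dualEdge e) : e' ≠ e := by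
  rintro rfl
  exact S2.ne_neg _ (h.neg_mark he).symm

/-- In a symmetric drawing of the medial graph the vertices lie on `G` and on its antipodal image,
so they are the marked points of `P`. -/
theorem mark_eq (hM : Q.IsMedialOf M) (hs : M.IsAntipodallySymmetric) (e : G.edges) :
    Q.mark e = P.mark e := by
  have h1 : Q.mark e ∈ M.antipode.verts := by rw [hs, hM.1]; exact ⟨e, rfl⟩
  have h2 : -(Q.mark e) ∈ M.verts := mem_antipodal_image.1 h1
  rw [hM.1] at h2
  obtain ⟨e', he'⟩ := h2
  obtain ⟨e'', h3⟩ := h.mem_range_mark (Q.mark_mem_carrier e) (he' ▸ Q.mark_mem_carrier e')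
  rw [h3, Q.mark_inj h3]

end IsAntipodalDual

theorem neg_mem_of_symmetric {H : SphereGraph} (hs : H.IsAntipodallySymmetric) {x : S2} :
    -x ∈ H.carrier ↔ x ∈ H.carrier := by
  have h1 : antipodal '' H.carrier = H.carrier := by
    conv_rhs => rw [← hs]
    unfold SphereGraph.carrier
    rw [image_union, sUnion_eq_biUnion, sUnion_eq_biUnion, image_iUnion₂]
    show _ = antipodal '' H.verts ∪ ⋃ a ∈ (fun e => antipodal '' e) '' H.edges, a
    rw [biUnion_image]
  constructor
  · intro h
    rw [← h1]
    exact mem_antipodal_image.2 h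
  · intro h
    rw [← h1] at h
    exact mem_antipodal_image.1 h

/-- The antipodal image of a face of a symmetric drawing. -/
theorem exists_antipodal_face {H : SphereGraph} (hs : H.IsAntipodallySymmetric) (φ : H.faces) :
    ∃ ψ : H.faces, (ψ : Set S2) = antipodal '' (φ : Set S2) := by
  obtain ⟨_, x, hx, rfl⟩ := φ
  have hc : antipodal '' H.carrierᶜ = H.carrierᶜ := by
    ext y
    rw [mem_antipodal_image, mem_compl_iff, mem_compl_iff, neg_mem_of_symmetric hs]
  refine ⟨⟨_, -x, fun h => hx ((neg_mem_of_symmetric hs).1 h), rfl⟩, ?_⟩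
  have := (Homeomorph.neg S2).image_connectedComponentIn hx
  rw [show ⇑(Homeomorph.neg S2) = antipodal from rfl, hc] at this
  exact this.symm

/-- If a centre of `P` lies in the inner polygon of `Q`, then the antipodal function carries this inner
polygon to a face around a vertex, hence it reverses every proper colouring. -/
theorem IsAntipodalDual.colorReversing_of_center (h : P.IsAntipodalDual) (hM : Q.IsMedialOf M)
    (hs : M.IsAntipodallySymmetric) {f₀ : G.faces}
    (h₀ : P.chart f₀ 0 ∈ Q.chart f₀ '' innerRegion (Q.deg f₀)) {C : M.faces → Bool}
    (hC : M.IsProperFaceColoring C) : M.AntipodalColorReversing C := by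
  choose a ha using exists_antipodal_face hs
  have haa : ∀ φ, a (a φ) = φ := fun φ => Subtype.ext (by
    rw [ha, ha, antipodal_antipodal_image])
  have hC' : M.IsProperFaceColoring (C ∘ a) := by
    rintro φ ψ hne ⟨e, he, h1, h2⟩
    refine hC (a φ) (a ψ) (fun h => hne (by rw [← haa φ, h, haa])) ⟨antipodal '' e, ?_, ?_, ?_⟩
    · rw [← hs]
      exact ⟨e, he, rfl⟩
    · rw [ha]
      exact (image_mono h1).trans (image_closure_subset_closure_image antipodal_continuous)
    · rw [ha]
      exact (image_mono h2).trans (image_closure_subset_closure_image antipodal_continuous)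
  obtain ⟨b, hb1, hb2⟩ := hM.exists_color hC
  obtain ⟨b', hb1', hb2'⟩ := hM.exists_color hC'
  obtain ⟨φ₀, hφ₀⟩ := exists_face (hM.inner_subset f₀ h₀)
  have hφ₀' := hM.inner_eq_of_mem h₀ hφ₀
  have hbb : b' = !b := by
    rw [← hb1' φ₀ f₀ hφ₀']
    refine hb2 (a φ₀) _ (h.neg_center_mem f₀) ?_
    rw [ha]
    exact mem_antipodal_image.2 (by rwa [neg_neg])
  intro φ
  refine ⟨a φ, ha φ, ?_⟩
  rcases hM.face_cases φ with ⟨f, hf⟩ | ⟨v, hv, hvφ⟩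
  · have h1 := hb1 φ f hf
    have h2 := hb1' φ f hf
    rw [Function.comp_apply] at h2
    rw [h1, h2, hbb]
    simp
  · have h1 := hb2 φ v hv hvφ
    have h2 := hb2' φ v hv hvφ
    rw [Function.comp_apply] at h2
    rw [h1, h2, hbb]
    simp

/-- If the centre of a face of degree at least three lay beyond a corner arc, then the spokes, which
do not cross the medial graph, would end on all the sides, but the region beyond the arc
touches only two of them. -/
theorem IsAntipodalDual.deg_le_two (h : P.IsAntipodalDual) (hM : Q.IsMedialOf M)
    (hs : M.IsAntipodallySymmetric) {f : G.faces}
    (hf : P.chart f 0 ∉ Q.chart f '' innerRegion (Q.deg f)) : P.deg f ≤ 2 := by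
  obtain ⟨T, S, hT, -, hTK, -, hTU, -, hQT, -, hST, -⟩ :=
    (P.isCell f).exists_homeo (Q.isCell f) (by rw [Q.chart_image, P.chart_image])
  have hinj : InjOn T (closedBall 0 1) := fun x hx y hy hxy => by rw [← hST x hx, hxy, hST y hy]
  have h0K : (0 : ℂ) ∈ closedBall (0 : ℂ) 1 := by simp
  have hT0 : ‖T 0‖ < 1 := mem_ball_iff_norm_lt.1 (hTU (mem_ball_self one_pos))
  obtain ⟨k, hk⟩ : ∃ k, T 0 ∈ cornerRegion (Q.deg f) k := by
    rcases ball_cases (Q.deg_pos f) hT0 with h1 | ⟨k, h1 | h1⟩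
    · exact (hf ⟨_, h1, hQT 0 h0K⟩).elim
    · exact ⟨k, h1⟩
    · have h2 : P.chart f 0 ∈ M.carrier := hM.mem_carrier.2 ⟨f, k, _, h1, (hQT 0 h0K).symm⟩
      exact (hM.vert_notMem (h.neg_center_mem f) ((neg_mem_of_symmetric hs).2 h2)).elim
  have hnorm : ∀ (i : Fin (P.deg f)) {r : ℝ}, 0 ≤ r → ‖discPoint (P.deg f) r (i + 1 / 2)‖ = r :=
    fun i r hr => by rw [discPoint_norm, abs_of_nonneg hr]
  -- the open spokes avoid the medial graph
  have havoid : ∀ (i : Fin (P.deg f)) {r : ℝ}, 0 ≤ r → r < 1 →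
      P.chart f (discPoint (P.deg f) r (i + 1 / 2)) ∉ M.carrier := by
    intro i r h0 h1 hmem
    have h2 := h.neg_mem_carrier_iff.2 ⟨f, i, r, h0, h1.le, rfl⟩
    obtain ⟨e, he⟩ := hM.mem_range_mark ((neg_mem_of_symmetric hs).2 hmem) h2
    rw [h.mark_eq hM hs] at he
    have h3 := h.neg_mark_mem_carrier e
    rw [he, neg_neg] at h3
    exact P.chart_notMem_carrier f (by rwa [hnorm i h0]) h3
  have hsub : cornerRegion (Q.deg f) k ⊆ closedCorner (Q.deg f) k := by
    rintro _ ⟨p, ⟨h1, h2, h3⟩, rfl⟩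
    exact ⟨p, ⟨h1.le, h2.le, h3.le⟩, rfl⟩
  have hspoke : ∀ i : Fin (P.deg f), ∀ r ∈ Ico (0 : ℝ) 1,
      T (discPoint (P.deg f) r (i + 1 / 2)) ∈ cornerRegion (Q.deg f) k := by
    intro i
    have hc : Continuous fun r : ℝ => discPoint (P.deg f) r (i + 1 / 2) :=
      (discPoint_continuous _).comp (by fun_prop : Continuous fun r : ℝ => (r, (i : ℝ) + 1 / 2))
    have hball : ∀ r ∈ Ico (0 : ℝ) 1, discPoint (P.deg f) r (i + 1 / 2) ∈ ball (0 : ℂ) 1 :=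
      fun r hr => by rw [mem_ball_iff_norm_lt, hnorm i hr.1]; exact hr.2
    have hpre : IsPreconnected ((fun r : ℝ => T (discPoint (P.deg f) r (i + 1 / 2))) '' Ico 0 1) :=
      isPreconnected_Ico.image _ (hT.comp hc.continuousOn
        fun r hr => ball_subset_closedBall (hball r hr))
    have hun : (fun r : ℝ => T (discPoint (P.deg f) r (i + 1 / 2))) '' Ico 0 1 ⊆
        cornerRegion (Q.deg f) k ∪ (closedCorner (Q.deg f) k)ᶜ := by
      rintro _ ⟨r, hr, rfl⟩
      by_cases hcl : T (discPoint (P.deg f) r (i + 1 / 2)) ∈ closedCorner (Q.deg f) k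
      · rcases closedCorner_subset hcl (mem_ball_iff_norm_lt.1 (hTU (hball r hr))) with h1 | h1
        · exact Or.inl h1
        · exact (havoid i hr.1 hr.2 (hM.mem_carrier.2 ⟨f, k, _, h1,
            (hQT _ (ball_subset_closedBall (hball r hr))).symm⟩)).elim
      · exact Or.inr hcl
    have := hpre.subset_left_of_subset_union (isOpen_cornerRegion k)
      (isCompact_closedCorner (Q.deg f) k).isClosed.isOpen_compl
      (disjoint_compl_right_iff_subset.2 hsub) hun
      ⟨T 0, ⟨0, by simp, by simp [discPoint_zero]⟩, hk⟩
    exact fun r hr => this ⟨r, hr, rfl⟩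
  have hmid : ∀ i : Fin (P.deg f), T (discPoint (P.deg f) 1 (i + 1 / 2)) ∈
      ({polar (Q.deg f) k (1, 1 / 2), polar (Q.deg f) k (1, -(1 / 2))} : Finset ℂ) := by
    intro i
    have hc : Continuous fun r : ℝ => discPoint (P.deg f) r (i + 1 / 2) :=
      (discPoint_continuous _).comp (by fun_prop : Continuous fun r : ℝ => (r, (i : ℝ) + 1 / 2))
    have hTc : ContinuousOn (fun r : ℝ => T (discPoint (P.deg f) r (i + 1 / 2))) (Icc 0 1) :=
      hT.comp hc.continuousOn fun r hr => by rw [mem_closedBall_iff, hnorm i hr.1]; exact hr.2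
    have h1K : discPoint (P.deg f) 1 (i + 1 / 2) ∈ closedBall (0 : ℂ) 1 := by
      rw [mem_closedBall_iff, hnorm i zero_le_one]
    have h1 : T (discPoint (P.deg f) 1 (i + 1 / 2)) ∈ closedCorner (Q.deg f) k := by
      have h2 : (1 : ℝ) ∈ closure (Ico (0 : ℝ) 1) := by
        rw [closure_Ico zero_ne_one]; simp
      have h3 := ((hTc 1 (by simp)).mono Ico_subset_Icc_self).mem_closure_image h2
      refine (isCompact_closedCorner (Q.deg f) k).isClosed.closure_subset_iff.2 ?_ h3
      rintro _ ⟨r, hr, rfl⟩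
      exact hsub (hspoke i r hr)
    have h2 : Q.chart f (T (discPoint (P.deg f) 1 (i + 1 / 2))) = Q.mark (P.side f i) := by
      rw [hQT _ h1K, P.chart_mid, h.mark_eq hM hs]
    have h3 : ‖T (discPoint (P.deg f) 1 (i + 1 / 2))‖ = 1 :=
      (mem_closedBall_iff.1 (hTK h1K)).eq_or_lt.resolve_right fun h3 =>
        Q.chart_notMem_carrier f h3 (h2 ▸ Q.mark_mem_carrier _)
    obtain ⟨j, -, hj⟩ := Q.eq_mid_of_chart_eq_mark h3 h2
    obtain ⟨p, ⟨h4, h5, h6⟩, h7⟩ := h1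
    have hp := abs_nonneg p.2
    have h8 : polar (Q.deg f) k p = polar (Q.deg f) j (1, 1 / 2) := h7.trans hj
    obtain ⟨h9, h10⟩ := polar_abs_eq (by linarith) zero_le_one h4 (by norm_num [abs_of_pos]) h8
    simp only [Finset.mem_insert, Finset.mem_singleton]
    rw [← h7]
    have h11 : |p.2| = 1 / 2 := h10.trans (abs_of_pos (by norm_num))
    rcases (abs_eq (by norm_num)).1 h11 with h12 | h12
    · exact Or.inl (congrArg _ (Prod.ext h9 h12))
    · exact Or.inr (congrArg _ (Prod.ext h9 h12))
  have hcard := Finset.card_le_card_of_injOn (s := Finset.univ)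
    (fun i : Fin (P.deg f) => T (discPoint (P.deg f) 1 (i + 1 / 2))) (fun i _ => hmid i)
    fun i _ j _ hij => by
      have := hinj (by rw [mem_closedBall_iff, hnorm i zero_le_one])
        (by rw [mem_closedBall_iff, hnorm j zero_le_one]) hij
      exact (discPoint_inj one_pos zero_le_one (by simp) this).2.1
  rw [Finset.card_univ, Fintype.card_fin] at hcard
  exact hcard.trans Finset.card_le_two

end FaceCharts

/-! ### A face with at least three sides, and colour reversal -/

namespace FaceCharts
open SphereGraph
variable {G M : SphereGraph} {P Q : FaceCharts G}

/-- On a face of degree at most two every side runs through all corners. -/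
theorem vert_mem_side {k : G.faces} (hd : P.deg k ≤ 2) {j : Fin (P.deg k)} {u : S2}
    (hu : u ∈ G.verts) (huj : u ∈ (P.side k j : Set S2)) (j' : Fin (P.deg k)) :
    u ∈ (P.side k j' : Set S2) := by
  obtain ⟨l, hl⟩ : ∃ l : Fin (P.deg k), u = P.chart k (discPoint (P.deg k) 1 l) := by
    rcases P.end_eq_corner k j hu huj with h | h
    · exact ⟨j, h⟩
    · obtain ⟨l, hl⟩ := P.exists_corner_eq k j
      exact ⟨l, by rw [h, hl]⟩
  rw [hl]
  by_cases hjl : j' = l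
  · subst hjl
    simpa using P.chart_mem_edge k j' le_rfl zero_le_one
  · have h1 := P.chart_mem_edge k j' zero_le_one le_rfl
    convert h1 using 2
    have hne : (j' : ℕ) ≠ l := fun h => hjl (Fin.ext h)
    have h2 := j'.2
    have h3 := l.2
    rcases (by omega : ((l : ℕ) = 1 ∧ (j' : ℕ) = 0) ∨ ((l : ℕ) = 0 ∧ (j' : ℕ) = 1 ∧ P.deg k = 2))
      with ⟨h4, h5⟩ | ⟨h4, h5, h6⟩
    · rw [h4, h5]; simp
    · -- the end of the second side of a digon is corner `2`, which is corner `0` again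
      refine discPoint_congr (P.deg_pos k) zero_le_one (-1) ?_
      rw [h4, h5, h6]
      norm_num

namespace IsAntipodalDual
variable (h : P.IsAntipodalDual)
include h

theorem exists_edge_of_vert {u : S2} (hu : u ∈ G.verts) : ∃ e : G.edges, u ∈ (e : Set S2) := by
  obtain ⟨f, hf⟩ := h.exists_center hu
  obtain ⟨e, he⟩ := h.exists_edge (P.side f ⟨0, P.deg_pos f⟩)
  have := P.center_mem_dualEdge f ⟨0, P.deg_pos f⟩
  rw [← he, hf, mem_antipodal_image, neg_neg] at this
  exact ⟨e, this⟩

/-- If all faces have degree at most two, then every edge runs through every vertex. -/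
theorem vert_mem_edge (hd : ∀ f, P.deg f ≤ 2) {u : S2} (hu : u ∈ G.verts) (e : G.edges) :
    u ∈ (e : Set S2) := by
  obtain ⟨e₀, he₀⟩ := h.exists_edge_of_vert hu
  obtain ⟨f₀, i₀, rfl⟩ := P.exists_side e₀
  obtain ⟨f, i, rfl⟩ := P.exists_side e
  exact P.mem_of_side_closed (S := {k | ∀ j, u ∈ (P.side k j : Set S2)})
    ⟨f₀, fun j => vert_mem_side (hd f₀) hu he₀ j⟩
    (fun k hk g i j hij => fun j' => vert_mem_side (hd g) hu (hij ▸ hk i) j') f i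

/-- If all faces have degree at most two, then there are at most two edges: the antipodal images of
all edges are dual edges at the centre of one face. -/
theorem edge_pigeonhole (hd : ∀ f, P.deg f ≤ 2) (e₁ e₂ e₃ : G.edges) :
    e₁ = e₂ ∨ e₁ = e₃ ∨ e₂ = e₃ := by
  obtain ⟨u, hu, -⟩ := exists_vert_mem_edge e₁.2
  obtain ⟨f, hf⟩ := h.exists_center hu
  have key : ∀ e : G.edges, ∃ i, antipodal '' (e : Set S2) = P.dualEdge (P.side f i) := by
    intro e
    obtain ⟨e', he'⟩ := h.exists_dualEdge e
    have : P.chart f 0 ∈ P.dualEdge e' := by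
      rw [← he', hf, mem_antipodal_image, neg_neg]
      exact h.vert_mem_edge hd hu e
    obtain ⟨i, rfl⟩ := exists_side_of_center_mem this
    exact ⟨i, he'⟩
  have hinj : ∀ {e e' : G.edges} {i i' : Fin (P.deg f)},
      antipodal '' (e : Set S2) = P.dualEdge (P.side f i) →
      antipodal '' (e' : Set S2) = P.dualEdge (P.side f i') → i = i' → e = e' := by
    rintro e e' i _ h1 h2 rfl
    exact Subtype.ext (antipodal_injective.image_injective (h1.trans h2.symm))
  obtain ⟨i₁, h₁⟩ := key e₁
  obtain ⟨i₂, h₂⟩ := key e₂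
  obtain ⟨i₃, h₃⟩ := key e₃
  have := hd f
  have : i₁ = i₂ ∨ i₁ = i₃ ∨ i₂ = i₃ := by
    have := i₁.2
    have := i₂.2
    have := i₃.2
    simp only [Fin.ext_iff]
    omega
  rcases this with h4 | h4 | h4
  · exact Or.inl (hinj h₁ h₂ h4)
  · exact Or.inr (Or.inl (hinj h₁ h₃ h4))
  · exact Or.inr (Or.inr (hinj h₂ h₃ h4))

/-- Some face has at least three sides. Otherwise the drawing is a closed curve through two
vertices, and the points antipodal to these lie on different sides of it, which is impossible. -/
theorem exists_two_lt_deg : ∃ f, 2 < P.deg f := by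
  by_contra! hd
  obtain ⟨f⟩ : Nonempty G.faces := by
    obtain ⟨f, -⟩ := P.exists_mem_closure ⟨EuclideanSpace.single 0 1, by simp⟩
    exact ⟨f⟩
  set e₁ := P.side f ⟨0, P.deg_pos f⟩ with he₁
  obtain ⟨e₂, he₂⟩ := h.exists_edge e₁
  have hne := h.ne_of_dual he₂
  have hE : ∀ e, e = e₁ ∨ e = e₂ := fun e => by
    rcases h.edge_pigeonhole hd e e₁ e₂ with h1 | h1 | h1
    · exact Or.inl h1
    · exact Or.inr h1
    · exact (hne h1.symm).elim
  -- a second face, as one face has only two of the four sides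
  obtain ⟨g, hgf⟩ : ∃ g, g ≠ f := by
    by_contra! hall
    obtain ⟨⟨f₁, i₁⟩, ⟨f₂, i₂⟩, hpq, hset⟩ := ncard_eq_two.1 (P.two_sides e₁)
    obtain ⟨f₃, i₃, h₃⟩ := P.exists_side e₂
    have hside : ∀ p ∈ ({⟨f₁, i₁⟩, ⟨f₂, i₂⟩} : Set ((f : G.faces) × Fin (P.deg f))),
        P.side p.1 p.2 = e₁ := fun p hp => hset.symm.subset hp
    have h1 : P.side f₁ i₁ = e₁ := hside _ (Or.inl rfl)
    have h2 : P.side f₂ i₂ = e₁ := hside _ (Or.inr rfl)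
    obtain rfl := hall f₁
    obtain rfl := (hall f₂).symm
    obtain rfl := (hall f₃).symm
    have := hd f₁
    have a1 := i₁.2
    have a2 := i₂.2
    have a3 := i₃.2
    have b1 : (i₁ : ℕ) ≠ i₂ := fun hh => hpq (by rw [Fin.ext hh])
    have b2 : (i₁ : ℕ) ≠ i₃ := fun hh => hne (by rw [← h₃, ← h1, Fin.ext hh])
    have b3 : (i₂ : ℕ) ≠ i₃ := fun hh => hne (by rw [← h₃, ← h2, Fin.ext hh])
    omega
  -- there is no third face, as the edge has only two ends
  have hF : ∀ k, k = f ∨ k = g := by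
    set i₀ : Fin (P.deg f) := ⟨0, P.deg_pos f⟩
    have key : ∀ k, -(P.chart k 0) = P.chart f (discPoint (P.deg f) 1 i₀) ∨
        -(P.chart k 0) = P.chart f (discPoint (P.deg f) 1 (i₀ + 1)) :=
      fun k => P.end_eq_corner f i₀ (h.neg_center_mem k)
        (h.vert_mem_edge hd (h.neg_center_mem k) e₁)
    have hinj : ∀ {k l : G.faces} {x : S2}, -(P.chart k 0) = x → -(P.chart l 0) = x → k = l :=
      fun {k l x} hk hl => (P.chart_eq (by simp) (by simp) (neg_injective (hk.trans hl.symm))).1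
    intro k
    rcases key k with hk | hk <;> rcases key f with hf | hf <;> rcases key g with hg | hg
    · exact Or.inl (hinj hk hf)
    · exact Or.inl (hinj hk hf)
    · exact Or.inr (hinj hk hg)
    · exact (hgf (hinj hg hf)).elim
    · exact (hgf (hinj hg hf)).elim
    · exact Or.inr (hinj hk hg)
    · exact Or.inl (hinj hk hf)
    · exact Or.inl (hinj hk hf)
  have hcl : ∀ k : G.faces, -(P.chart k 0) ∈ closure (k : Set S2) := fun k =>
    P.mem_closure_of_side k ⟨0, P.deg_pos k⟩ (h.vert_mem_edge hd (h.neg_center_mem k) _)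
  have hin : ∀ k : G.faces, - -(P.chart k 0) ∈ (k : Set S2) := fun k => by
    rw [neg_neg]; exact P.chart_mem_face k (by simp)
  refine false_of_inter_antipode_eq_pair (K := G.carrier) (m := P.mark e₁) (face_isOpen f)
    (face_isOpen g) ?_ ?_ (face_isPreconnected f) (face_isPreconnected g) (P.mark_mem_carrier e₁)
    (h.neg_mark_mem_carrier e₁) ?_ (vert_mem_carrier (h.neg_center_mem f)) (hcl f) (hin f)
    (vert_mem_carrier (h.neg_center_mem g)) (hcl g) (hin g)
  · rw [Set.disjoint_left]
    exact fun x hx hx' => hgf (face_eq hx' hx)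
  · refine subset_antisymm (fun x hx => ?_) (union_subset (face_subset f) (face_subset g))
    obtain ⟨k, hk⟩ := exists_face hx
    rcases hF k with rfl | rfl
    · exact Or.inl hk
    · exact Or.inr hk
  · intro x hx hx'
    obtain ⟨e, rfl⟩ := h.mem_range_mark hx hx'
    rcases hE e with rfl | rfl
    · exact Or.inl rfl
    · exact Or.inr (h.neg_mark he₂).symm

/-- Every proper colouring of the faces of a symmetric drawing of the medial graph is reversed by
the antipodal function. -/
theorem colorReversing (hM : Q.IsMedialOf M) (hs : M.IsAntipodallySymmetric) {C : M.faces → Bool}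
    (hC : M.IsProperFaceColoring C) : M.AntipodalColorReversing C := by
  obtain ⟨f, hf⟩ := h.exists_two_lt_deg
  by_cases hc : P.chart f 0 ∈ Q.chart f '' innerRegion (Q.deg f)
  · exact h.colorReversing_of_center hM hs hc hC
  · exact absurd (h.deg_le_two hM hs hc) (by omega)

end IsAntipodalDual
end FaceCharts

/-! ### The quadrilaterals of a polygon and their homeomorphisms -/

/-- The taxicab norm of the plane. -/
def taxi (z : ℂ) : ℝ := |z.re| + |z.im|

/-- The closed unit ball of the taxicab norm, used as a model of the quadrilaterals into which the
sectors of a polygon are divided by a drawing and its dual: `-I` is the centre of the polygon, `I`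
the corner, and `±1` are the midpoints of the sides at this corner. -/
def diamond : Set ℂ := {z | taxi z ≤ 1}

/-- The open unit ball of the taxicab norm. -/
def openDiamond : Set ℂ := {z | taxi z < 1}

/-- The horizontal diagonal of the diamond. -/
def diamondDiagonal : Set ℂ := {z | z ∈ diamond ∧ z.im = 0}

theorem taxi_continuous : Continuous taxi := by
  unfold taxi; fun_prop

theorem taxi_nonneg (z : ℂ) : 0 ≤ taxi z := add_nonneg (abs_nonneg _) (abs_nonneg _)

theorem taxi_smul (t : ℝ) (z : ℂ) : taxi (t • z) = |t| * taxi z := by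
  simp [taxi, abs_mul, mul_add]

theorem norm_le_taxi (z : ℂ) : ‖z‖ ≤ taxi z := Complex.norm_le_abs_re_add_abs_im z

theorem eq_zero_of_taxi {z : ℂ} (h : taxi z = 0) : z = 0 :=
  norm_le_zero_iff.1 ((norm_le_taxi z).trans h.le)

theorem taxi_zero : taxi 0 = 0 := by simp [taxi]

theorem openDiamond_subset : openDiamond ⊆ diamond :=
  fun z (h : taxi z < 1) => (le_of_lt h : taxi z ≤ 1)

theorem taxi_eq_one {z : ℂ} (h : z ∈ diamond) (h' : z ∉ openDiamond) : taxi z = 1 :=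
  le_antisymm h (not_lt.1 h')

theorem isOpen_openDiamond : IsOpen openDiamond := isOpen_lt taxi_continuous continuous_const

theorem isCompact_diamond : IsCompact diamond := by
  refine (isCompact_closedBall (0 : ℂ) 1).of_isClosed_subset
    (isClosed_le taxi_continuous continuous_const) fun z hz => ?_
  rw [mem_closedBall_zero_iff]
  exact (norm_le_taxi z).trans hz

theorem convex_openDiamond : Convex ℝ openDiamond := by
  intro z hz w hw a b ha hb hab
  change taxi z < 1 at hz
  change taxi w < 1 at hw
  show taxi (a • z + b • w) < 1
  have h1 : taxi (a • z + b • w) ≤ taxi (a • z) + taxi (b • w) := by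
    unfold taxi
    have := abs_add_le (a • z).re (b • w).re
    have := abs_add_le (a • z).im (b • w).im
    rw [Complex.add_re, Complex.add_im]
    linarith
  rw [taxi_smul, taxi_smul, abs_of_nonneg ha, abs_of_nonneg hb] at h1
  rcases ha.eq_or_lt with h | h
  · have : b = 1 := by linarith
    subst this
    rw [← h] at h1 ⊢
    linarith
  · nlinarith

theorem diamond_subset_closure : diamond ⊆ closure openDiamond := by
  intro z hz
  have hc : Continuous fun t : ℝ => (1 - t) • z := by fun_prop
  have ht := (hc.tendsto 0).mono_left (nhdsWithin_le_nhds (s := Ioi 0))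
  simp only [sub_zero, one_smul] at ht
  refine mem_closure_of_tendsto ht ?_
  filter_upwards [Ioo_mem_nhdsGT (zero_lt_one' ℝ)] with t h'
  show taxi _ < 1
  change taxi z ≤ 1 at hz
  rw [taxi_smul, abs_of_pos (by linarith [h'.2])]
  nlinarith [h'.1, h'.2, taxi_nonneg z]

theorem zero_mem_openDiamond : (0 : ℂ) ∈ openDiamond := by
  show taxi 0 < 1
  rw [taxi_zero]; exact one_pos

/-- Polar coordinates of a point of the diamond in a sector of the polygon. The horizontal diagonal
becomes the corner arc. -/
def sectorCoord (z : ℂ) : ℝ × ℝ := ((1 + z.im + |z.re|) / 2, z.re / (2 * (1 + z.im)))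

/-- The inverse of `sectorCoord`. -/
def diamondPoint (p : ℝ × ℝ) : ℂ :=
  ⟨2 * p.2 * (p.1 / (1 / 2 + |p.2|)), p.1 / (1 / 2 + |p.2|) - 1⟩

theorem diamond_bounds {z : ℂ} (hz : z ∈ diamond) : 0 ≤ 1 + z.im ∧ |z.re| ≤ 1 + z.im ∧
    z.im + |z.re| ≤ 1 := by
  have h1 : |z.re| + |z.im| ≤ 1 := hz
  have h2 := neg_abs_le z.im
  have h3 := le_abs_self z.im
  have h4 := abs_nonneg z.re
  exact ⟨by linarith, by linarith, by linarith⟩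

theorem sectorCoord_snd {z : ℂ} (hz : z ∈ diamond) : |(sectorCoord z).2| ≤ 1 / 2 := by
  obtain ⟨h1, h2, h3⟩ := diamond_bounds hz
  show |z.re / (2 * (1 + z.im))| ≤ 1 / 2
  rcases h1.eq_or_lt with h | h
  · rw [← h]; simp
  · rw [abs_div, abs_of_pos (by linarith : 0 < 2 * (1 + z.im)), div_le_iff₀ (by linarith)]
    linarith

theorem sectorCoord_fst {z : ℂ} (hz : z ∈ diamond) :
    0 ≤ (sectorCoord z).1 ∧ (sectorCoord z).1 ≤ 1 := by
  obtain ⟨h1, h2, h3⟩ := diamond_bounds hz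
  have := abs_nonneg z.re
  exact ⟨by show 0 ≤ (1 + z.im + |z.re|) / 2; linarith,
    by show (1 + z.im + |z.re|) / 2 ≤ 1; linarith⟩

theorem diamondPoint_sectorCoord {z : ℂ} (hz : z ∈ diamond) :
    diamondPoint (sectorCoord z) = z := by
  obtain ⟨h1, h2, h3⟩ := diamond_bounds hz
  have h4 : (sectorCoord z).1 / (1 / 2 + |(sectorCoord z).2|) = 1 + z.im := by
    show (1 + z.im + |z.re|) / 2 / (1 / 2 + |z.re / (2 * (1 + z.im))|) = 1 + z.im
    rcases h1.eq_or_lt with h | h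
    · have : |z.re| = 0 := le_antisymm (by linarith) (abs_nonneg _)
      rw [← h, this]; simp
    · have := abs_nonneg z.re
      rw [abs_div, abs_of_pos (by linarith : 0 < 2 * (1 + z.im))]
      field_simp
  apply Complex.ext
  · show 2 * (sectorCoord z).2 * ((sectorCoord z).1 / (1 / 2 + |(sectorCoord z).2|)) = z.re
    rw [h4]
    show 2 * (z.re / (2 * (1 + z.im))) * (1 + z.im) = z.re
    rcases h1.eq_or_lt with h | h
    · have : |z.re| = 0 := le_antisymm (by linarith) (abs_nonneg _)
      rw [abs_eq_zero] at this
      rw [this]; simp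
    · field_simp
  · show (sectorCoord z).1 / (1 / 2 + |(sectorCoord z).2|) - 1 = z.im
    rw [h4]; ring

theorem sectorCoord_diamondPoint {p : ℝ × ℝ} (h0 : 0 < p.1) : sectorCoord (diamondPoint p) = p := by
  have hs := abs_nonneg p.2
  have hpos : 0 < 1 / 2 + |p.2| := by linarith
  have hq : 0 < p.1 / (1 / 2 + |p.2|) := div_pos h0 hpos
  refine Prod.ext ?_ ?_
  · show (1 + (p.1 / (1 / 2 + |p.2|) - 1) + |2 * p.2 * (p.1 / (1 / 2 + |p.2|))|) / 2 = p.1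
    rw [abs_mul, abs_mul, abs_of_pos hq, abs_two]
    field_simp
    ring
  · show 2 * p.2 * (p.1 / (1 / 2 + |p.2|)) / (2 * (1 + (p.1 / (1 / 2 + |p.2|) - 1))) = p.2
    field_simp
    ring

theorem diamondPoint_mem {p : ℝ × ℝ} (h0 : 0 ≤ p.1) (h1 : p.1 ≤ 1) (h2 : |p.2| ≤ 1 / 2) :
    diamondPoint p ∈ diamond := by
  have hs := abs_nonneg p.2
  have hpos : 0 < 1 / 2 + |p.2| := by linarith
  set q := p.1 / (1 / 2 + |p.2|) with hq
  have hq0 : 0 ≤ q := div_nonneg h0 hpos.le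
  have hqp : q * (1 / 2 + |p.2|) = p.1 := div_mul_cancel₀ _ hpos.ne'
  show |2 * p.2 * q| + |q - 1| ≤ 1
  rw [abs_mul, abs_mul, abs_of_nonneg hq0, abs_two]
  rcases abs_cases (q - 1) with ⟨h, -⟩ | ⟨h, -⟩ <;> rw [h] <;> nlinarith

/-- The `k`-th sector of the `n`-gon, parametrized by the diamond. -/
def sectorMap (n : ℕ) (k : Fin n) (z : ℂ) : ℂ := polar n k (sectorCoord z)

theorem sectorMap_norm {n : ℕ} {k : Fin n} {z : ℂ} (hz : z ∈ diamond) :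
    ‖sectorMap n k z‖ = (sectorCoord z).1 := polar_norm (sectorCoord_fst hz).1

theorem sectorMap_norm_le {n : ℕ} {k : Fin n} {z : ℂ} (hz : z ∈ diamond) :
    ‖sectorMap n k z‖ ≤ 1 := by
  rw [sectorMap_norm hz]; exact (sectorCoord_fst hz).2

theorem sectorMap_continuousOn (n : ℕ) (k : Fin n) : ContinuousOn (sectorMap n k) diamond := by
  intro z hz
  rcases (diamond_bounds hz).1.eq_or_lt with h | h
  · have h1 : (sectorCoord z).1 = 0 := by
      have h2 := abs_nonneg z.re
      have h3 := (diamond_bounds hz).2.1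
      show (1 + z.im + |z.re|) / 2 = 0
      linarith
    have h2 : sectorMap n k z = 0 := by rw [← norm_eq_zero, sectorMap_norm hz, h1]
    unfold ContinuousWithinAt
    rw [h2, tendsto_zero_iff_norm_tendsto_zero]
    have hc : Continuous fun z : ℂ => (sectorCoord z).1 := by
      show Continuous fun z : ℂ => (1 + z.im + |z.re|) / 2
      fun_prop
    have h3 := (hc.tendsto z).mono_left (nhdsWithin_le_nhds (s := diamond))
    rw [h1] at h3
    refine h3.congr' ?_
    filter_upwards [self_mem_nhdsWithin] with w hw
    exact (sectorMap_norm hw).symm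
  · refine ContinuousAt.continuousWithinAt ?_
    refine (polar_continuous n k).continuousAt.comp (ContinuousAt.prodMk ?_ ?_)
    · have : Continuous fun z : ℂ => (1 + z.im + |z.re|) / 2 := by fun_prop
      exact this.continuousAt
    · exact ContinuousAt.div Complex.continuous_re.continuousAt
        (continuous_const.mul (continuous_const.add Complex.continuous_im)).continuousAt (by linarith)

theorem openDiamond_coord {z : ℂ} (hz : z ∈ openDiamond) :
    0 < (sectorCoord z).1 ∧ (sectorCoord z).1 < 1 ∧ |(sectorCoord z).2| < 1 / 2 := by
  have h1 : |z.re| + |z.im| < 1 := hz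
  have h2 := neg_abs_le z.im
  have h3 := le_abs_self z.im
  have h4 := abs_nonneg z.re
  have h5 : 0 < 1 + z.im := by linarith
  refine ⟨?_, ?_, ?_⟩
  · show 0 < (1 + z.im + |z.re|) / 2; linarith
  · show (1 + z.im + |z.re|) / 2 < 1; linarith
  · show |z.re / (2 * (1 + z.im))| < 1 / 2
    rw [abs_div, abs_of_pos (by linarith : 0 < 2 * (1 + z.im)), div_lt_iff₀ (by linarith)]
    linarith

theorem sectorMap_inj {n : ℕ} {k j : Fin n} {z w : ℂ} (hz : z ∈ openDiamond) (hw : w ∈ diamond)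
    (h : sectorMap n k z = sectorMap n j w) : k = j ∧ z = w := by
  obtain ⟨h1, -, h2⟩ := openDiamond_coord hz
  obtain ⟨h3, h4⟩ := polar_inj h1 (sectorCoord_fst hw).1 h2 (sectorCoord_snd hw) h
  refine ⟨h3, ?_⟩
  rw [← diamondPoint_sectorCoord (openDiamond_subset hz), h4, diamondPoint_sectorCoord hw]

theorem sectorMap_norm_lt {n : ℕ} {k : Fin n} {z : ℂ} (hz : z ∈ openDiamond) :
    ‖sectorMap n k z‖ < 1 := by
  rw [sectorMap_norm (openDiamond_subset hz)]; exact (openDiamond_coord hz).2.1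

/-- The interior of the diamond avoids the spokes. -/
theorem sectorMap_ne_spoke {n : ℕ} {k : Fin n} {z : ℂ} (hz : z ∈ openDiamond) (j : Fin n) {r : ℝ}
    (hr : 0 ≤ r) : sectorMap n k z ≠ discPoint n r (j + 1 / 2) := by
  intro h
  obtain ⟨h1, -, h2⟩ := openDiamond_coord hz
  obtain ⟨-, h4⟩ := polar_inj (p' := (r, 1 / 2)) h1 hr h2 (by norm_num [abs_of_pos]) h
  rw [h4] at h2
  norm_num [abs_of_pos] at h2

/-- The upper sides of the diamond go to the circle and the lower ones to spokes. -/
theorem sectorMap_boundary {n : ℕ} {k : Fin n} {z : ℂ} (hz : z ∈ diamond) (hz' : z ∉ openDiamond) :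
    ‖sectorMap n k z‖ = 1 ∨ ∃ (j : Fin n) (r : ℝ), 0 ≤ r ∧ r ≤ 1 ∧
      sectorMap n k z = discPoint n r (j + 1 / 2) := by
  have h1 : |z.re| + |z.im| = 1 := taxi_eq_one hz hz'
  rcases le_total 0 z.im with h | h
  · left
    rw [sectorMap_norm hz]
    rw [abs_of_nonneg h] at h1
    show (1 + z.im + |z.re|) / 2 = 1
    linarith
  · right
    rw [abs_of_nonpos h] at h1
    obtain ⟨h2, h3⟩ := sectorCoord_fst hz
    have h5 : ∃ j : Fin n, ∃ m : ℤ, (k : ℝ) + (sectorCoord z).2 = j + 1 / 2 + m * n ∨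
        (sectorCoord z).1 = 0 := by
      by_cases h0 : 1 + z.im = 0
      · refine ⟨k, 0, Or.inr ?_⟩
        show (1 + z.im + |z.re|) / 2 = 0
        linarith
      · have h6 : |z.re| = 1 + z.im := by linarith
        rcases abs_cases z.re with ⟨h7, -⟩ | ⟨h7, -⟩
        · refine ⟨k, 0, Or.inl ?_⟩
          show (k : ℝ) + z.re / (2 * (1 + z.im)) = _
          rw [show z.re = 1 + z.im by linarith]
          field_simp
          simp
        · obtain ⟨j, m, hj⟩ := exists_fin_add_mul k.pos ((k : ℤ) - 1)
          refine ⟨j, m, Or.inl ?_⟩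
          show (k : ℝ) + z.re / (2 * (1 + z.im)) = _
          have h8 : z.re / (2 * (1 + z.im)) = -(1 / 2) := by
            rw [show z.re = -(1 + z.im) by linarith]
            field_simp
          rw [h8]
          push_cast at hj
          linarith
    obtain ⟨j, m, h6 | h6⟩ := h5
    · exact ⟨j, (sectorCoord z).1, h2, h3, discPoint_congr k.pos h2 m h6⟩
    · refine ⟨j, 0, le_rfl, zero_le_one, ?_⟩
      show discPoint n (sectorCoord z).1 _ = _
      rw [h6, discPoint_zero, discPoint_zero]

theorem exists_sectorMap_eq {n : ℕ} (hn : 0 < n) {w : ℂ} (hw : ‖w‖ ≤ 1) :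
    ∃ (k : Fin n), ∃ z ∈ diamond, sectorMap n k z = w := by
  obtain ⟨k, p, h1, h2, rfl⟩ := exists_polar hn w
  have h0 : 0 ≤ p.1 := h2 ▸ norm_nonneg _
  refine ⟨k, diamondPoint p, diamondPoint_mem h0 (h2 ▸ hw) h1, ?_⟩
  rcases h0.eq_or_lt with h | h
  · have : sectorMap n k (diamondPoint p) = 0 := by
      rw [← norm_eq_zero, sectorMap_norm (diamondPoint_mem h0 (h2 ▸ hw) h1)]
      show (1 + (p.1 / (1 / 2 + |p.2|) - 1) + |2 * p.2 * (p.1 / (1 / 2 + |p.2|))|) / 2 = 0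
      rw [← h]; simp
    rw [this, polar, ← h, discPoint_zero]
  · rw [sectorMap, sectorCoord_diamondPoint h]

theorem sectorMap_finite {n : ℕ} (k : Fin n) (w : ℂ) :
    {z ∈ diamond | sectorMap n k z = w}.Finite := by
  rcases eq_or_ne w 0 with rfl | hw
  · refine (finite_singleton (-Complex.I)).subset ?_
    rintro z ⟨hz, h⟩
    have h1 : (1 + z.im + |z.re|) / 2 = 0 := by
      have := sectorMap_norm (n := n) (k := k) hz
      rw [h, norm_zero] at this
      exact this.symm
    have h2 := abs_nonneg z.re
    have h3 := (diamond_bounds hz).1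
    refine Complex.ext ?_ ?_
    · simp only [Complex.neg_re, Complex.I_re, neg_zero]
      exact abs_eq_zero.1 (by linarith)
    · simp only [Complex.neg_im, Complex.I_im]
      linarith
  · rcases {z ∈ diamond | sectorMap n k z = w}.eq_empty_or_nonempty with h | ⟨z₀, hz₀, h₀⟩
    · rw [h]; exact finite_empty
    · refine (toFinite {diamondPoint (‖w‖, (sectorCoord z₀).2),
        diamondPoint (‖w‖, -(sectorCoord z₀).2)}).subset ?_
      rintro z ⟨hz, h⟩
      have h1 : (sectorCoord z).1 = ‖w‖ := by rw [← sectorMap_norm (n := n) (k := k) hz, h]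
      have hpos : 0 < (sectorCoord z).1 := by rw [h1]; exact norm_pos_iff.2 hw
      obtain ⟨-, h2⟩ := polar_abs_eq hpos (sectorCoord_fst hz₀).1 (sectorCoord_snd hz)
        (sectorCoord_snd hz₀) (h.trans h₀.symm)
      rw [← diamondPoint_sectorCoord hz]
      rcases abs_eq_abs.1 h2 with h3 | h3
      · left; congr 1; exact Prod.ext h1 h3
      · right; exact congrArg _ (Prod.ext h1 h3)

theorem sectorMap_diagonal {n : ℕ} (k : Fin n) :
    sectorMap n k '' diamondDiagonal = cornerArc n k := by
  ext w
  rw [mem_cornerArc]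
  constructor
  · rintro ⟨z, ⟨hz, h0⟩, rfl⟩
    refine ⟨(sectorCoord z).2, sectorCoord_snd hz, ?_⟩
    show polar n k (sectorCoord z) = _
    congr 1
    refine Prod.ext ?_ rfl
    show (1 + z.im + |z.re|) / 2 = 1 / 2 + |z.re / (2 * (1 + z.im))|
    rw [h0, abs_div]
    norm_num
    ring
  · rintro ⟨s, hs, rfl⟩
    refine ⟨((2 * s : ℝ) : ℂ), ⟨?_, by simp⟩, ?_⟩
    · show |_| + |_| ≤ (1 : ℝ)
      rw [Complex.ofReal_re, Complex.ofReal_im, abs_mul, abs_two, abs_zero]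
      linarith
    · show polar n k (sectorCoord _) = _
      congr 1
      refine Prod.ext ?_ ?_
      · show (1 + ((2 * s : ℝ) : ℂ).im + |((2 * s : ℝ) : ℂ).re|) / 2 = 1 / 2 + |s|
        rw [Complex.ofReal_re, Complex.ofReal_im, abs_mul, abs_two]
        ring
      · show ((2 * s : ℝ) : ℂ).re / (2 * (1 + ((2 * s : ℝ) : ℂ).im)) = s
        rw [Complex.ofReal_re, Complex.ofReal_im]
        ring

theorem one_mem_diamond : (1 : ℂ) ∈ diamond := by
  show |_| + |_| ≤ (1 : ℝ); simp

theorem neg_one_mem_diamond : (-1 : ℂ) ∈ diamond := by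
  show |_| + |_| ≤ (1 : ℝ); simp

theorem sectorMap_one {n : ℕ} (k : Fin n) : sectorMap n k 1 = discPoint n 1 (k + 1 / 2) := by
  show discPoint n _ _ = _
  congr 1
  · show (1 + (1 : ℂ).im + |(1 : ℂ).re|) / 2 = 1
    norm_num
  · show (k : ℝ) + (1 : ℂ).re / (2 * (1 + (1 : ℂ).im)) = _
    norm_num

theorem sectorMap_neg_one {n : ℕ} (k : Fin n) :
    sectorMap n k (-1) = discPoint n 1 (k + -(1 / 2)) := by
  show discPoint n _ _ = _
  congr 1
  · show (1 + (-1 : ℂ).im + |(-1 : ℂ).re|) / 2 = 1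
    norm_num
  · show (k : ℝ) + (-1 : ℂ).re / (2 * (1 + (-1 : ℂ).im)) = _
    norm_num

theorem eq_one_of_sectorMap_eq_mid {n : ℕ} {k j : Fin n} {z : ℂ} (hz : z ∈ diamond)
    (h : sectorMap n k z = discPoint n 1 (j + 1 / 2)) : z = 1 ∨ z = -1 := by
  have h1 : (sectorCoord z).1 = 1 := by
    rw [← sectorMap_norm (n := n) (k := k) hz, h, discPoint_norm, abs_one]
  have h2 : sectorMap n k z = polar n j (1, 1 / 2) := h
  obtain ⟨-, h3⟩ := polar_abs_eq (by rw [h1]; exact one_pos) zero_le_one (sectorCoord_snd hz)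
    (by norm_num [abs_of_pos]) h2
  have h4 : |(sectorCoord z).2| = 1 / 2 := h3.trans (abs_of_pos (by norm_num))
  rw [← diamondPoint_sectorCoord hz]
  rcases (abs_eq (by norm_num)).1 h4 with h5 | h5
  · left
    rw [show sectorCoord z = (1, 1 / 2) from Prod.ext h1 h5]
    apply Complex.ext <;> simp [diamondPoint] <;> norm_num [abs_of_pos]
  · right
    rw [show sectorCoord z = (1, -(1 / 2)) from Prod.ext h1 h5]
    apply Complex.ext <;> simp [diamondPoint] <;> norm_num [abs_of_pos]

/-- The radial extension of a self-map of the boundary of the diamond. -/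
def cone (S : ℂ → ℂ) (z : ℂ) : ℂ := taxi z • S ((taxi z)⁻¹ • z)

section cone
variable {S T : ℂ → ℂ}

theorem taxi_inv_smul {z : ℂ} (hz : z ≠ 0) : taxi ((taxi z)⁻¹ • z) = 1 := by
  have : taxi z ≠ 0 := fun h => hz (eq_zero_of_taxi h)
  rw [taxi_smul, abs_of_nonneg (inv_nonneg.2 (taxi_nonneg z)), inv_mul_cancel₀ this]

theorem cone_zero (S : ℂ → ℂ) : cone S 0 = 0 := by simp [cone, taxi_zero]

theorem taxi_cone (hS : ∀ z, taxi z = 1 → taxi (S z) = 1) (z : ℂ) : taxi (cone S z) = taxi z := by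
  rcases eq_or_ne z 0 with rfl | hz
  · rw [cone_zero]
  · rw [cone, taxi_smul, hS _ (taxi_inv_smul hz), mul_one, abs_of_nonneg (taxi_nonneg z)]

theorem cone_of_taxi_eq_one {z : ℂ} (hz : taxi z = 1) : cone S z = S z := by
  simp [cone, hz]

/-- The cone of an inverse is an inverse of the cone. -/
theorem cone_cone (hS : ∀ z, taxi z = 1 → taxi (S z) = 1) (hTS : ∀ z, taxi z = 1 → T (S z) = z)
    (z : ℂ) : cone T (cone S z) = z := by
  rcases eq_or_ne z 0 with rfl | hz
  · rw [cone_zero, cone_zero]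
  · have h0 : taxi z ≠ 0 := fun h => hz (eq_zero_of_taxi h)
    have h1 : (taxi z)⁻¹ • cone S z = S ((taxi z)⁻¹ • z) := by
      rw [cone, smul_smul, inv_mul_cancel₀ h0, one_smul]
    rw [cone, taxi_cone hS, h1, hTS _ (taxi_inv_smul hz), smul_smul, mul_inv_cancel₀ h0, one_smul]

theorem cone_continuous (hc : ContinuousOn S diamond) (hS : ∀ z, taxi z = 1 → taxi (S z) = 1) :
    Continuous (cone S) := by
  rw [continuous_iff_continuousAt]
  intro z
  rcases eq_or_ne z 0 with rfl | hz
  · unfold ContinuousAt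
    rw [cone_zero, tendsto_zero_iff_norm_tendsto_zero]
    have h := taxi_continuous.tendsto 0
    rw [taxi_zero] at h
    refine squeeze_zero (fun _ => norm_nonneg _) (fun z => ?_) h
    exact (norm_le_taxi _).trans (taxi_cone hS z).le
  · have h1 : ContinuousOn (cone S) {0}ᶜ := by
      refine taxi_continuous.continuousOn.smul (hc.comp ?_ fun z hz => ?_)
      · exact (taxi_continuous.continuousOn.inv₀ fun z (hz : z ∈ ({0}ᶜ : Set ℂ)) h =>
          hz (eq_zero_of_taxi h)).smul continuousOn_id
      · exact (taxi_inv_smul hz).le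
    exact h1.continuousAt (isOpen_compl_singleton.mem_nhds hz)

theorem cone_mem_diagonal (h1 : S 1 = 1 ∨ S 1 = -1) (h2 : S (-1) = 1 ∨ S (-1) = -1) {z : ℂ}
    (hS : ∀ z, taxi z = 1 → taxi (S z) = 1) (hz : z ∈ diamondDiagonal) :
    cone S z ∈ diamondDiagonal := by
  refine ⟨?_, ?_⟩
  · show taxi _ ≤ 1
    rw [taxi_cone hS]
    exact hz.1
  · rcases eq_or_ne z 0 with rfl | h0
    · rw [cone_zero]; rfl
    · have h3 := taxi_inv_smul h0
      set w := (taxi z)⁻¹ • z with hw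
      have h4 : w.im = 0 := by rw [hw, Complex.smul_im, hz.2, smul_zero]
      have h5 : w = 1 ∨ w = -1 := by
        rw [taxi, h4, abs_zero, add_zero] at h3
        rcases (abs_eq zero_le_one).1 h3 with h | h
        · left; exact Complex.ext h h4
        · right; exact Complex.ext h (by rw [h4]; simp)
      have h6 : (S w).im = 0 := by
        rcases h5 with h | h <;> rw [h]
        · rcases h1 with h | h <;> rw [h] <;> simp
        · rcases h2 with h | h <;> rw [h] <;> simp
      rw [cone, ← hw, Complex.smul_im, h6, smul_zero]

end cone

/-- A homeomorphism of the diamond that fixes the boundary. -/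
structure IsTwist (η : ℂ → ℂ) : Prop where
  cont : ContinuousOn η diamond
  fixed : ∀ z, taxi z = 1 → η z = z
  bij : BijOn η openDiamond openDiamond

theorem isTwist_id : IsTwist id := ⟨continuousOn_id, fun _ _ => rfl, bijOn_id _⟩

theorem IsTwist.mapsTo {η : ℂ → ℂ} (h : IsTwist η) : MapsTo η diamond diamond := fun z hz => by
  by_cases hz' : z ∈ openDiamond
  · exact openDiamond_subset (h.bij.mapsTo hz')
  · rwa [h.fixed z (taxi_eq_one hz hz')]

/-- A homeomorphism of the diamond that preserves the pair `±1` agrees on the diagonal, as a set,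
with a homeomorphism that fixes the boundary: compose it with the cone over its inverse. -/
theorem exists_twist {T S : ℂ → ℂ} (hT : ContinuousOn T diamond) (hS : ContinuousOn S diamond)
    (hTU : MapsTo T openDiamond openDiamond) (hSU : MapsTo S openDiamond openDiamond)
    (hTK : MapsTo T diamond diamond) (hSK : MapsTo S diamond diamond)
    (hST : ∀ z ∈ diamond, S (T z) = z) (hTS : ∀ z ∈ diamond, T (S z) = z)
    (h1 : T 1 = 1 ∨ T 1 = -1) (h2 : T (-1) = 1 ∨ T (-1) = -1) :
    ∃ η, IsTwist η ∧ η '' diamondDiagonal = T '' diamondDiagonal := by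
  have hb : ∀ {T S : ℂ → ℂ}, MapsTo S openDiamond openDiamond → MapsTo T diamond diamond →
      (∀ z ∈ diamond, S (T z) = z) → ∀ z, taxi z = 1 → taxi (T z) = 1 := by
    intro T S hSU hTK hST z hz
    refine taxi_eq_one (hTK hz.le) fun h => ?_
    have h3 : S (T z) ∈ openDiamond := hSU h
    rw [hST z hz.le] at h3
    exact (show taxi z < 1 from h3).ne hz
  have hbT := hb hSU hTK hST
  have hbS := hb hTU hSK hTS
  have hne : (1 : ℂ) ≠ -1 := by norm_num
  have hT1 : T 1 ≠ T (-1) := fun h =>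
    hne ((hST 1 one_mem_diamond).symm.trans ((congrArg S h).trans (hST _ neg_one_mem_diamond)))
  have hS1 : (S 1 = 1 ∨ S 1 = -1) ∧ (S (-1) = 1 ∨ S (-1) = -1) := by
    have a := hST 1 one_mem_diamond
    have b := hST (-1) neg_one_mem_diamond
    rcases h1 with h1 | h1 <;> rcases h2 with h2 | h2
    · exact (hT1 (h1.trans h2.symm)).elim
    · rw [h1] at a; rw [h2] at b; exact ⟨Or.inl a, Or.inr b⟩
    · rw [h1] at a; rw [h2] at b; exact ⟨Or.inr b, Or.inl a⟩
    · exact (hT1 (h1.trans h2.symm)).elim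
  have hcU : ∀ {R : ℂ → ℂ}, (∀ z, taxi z = 1 → taxi (R z) = 1) →
      MapsTo (cone R) openDiamond openDiamond := fun hR z hz => by
    show taxi _ < 1
    rw [taxi_cone hR]; exact hz
  have hcK : MapsTo (cone S) diamond diamond := fun z hz => by
    show taxi _ ≤ 1
    rw [taxi_cone hbS]; exact hz
  refine ⟨T ∘ cone S, ⟨hT.comp (cone_continuous hS hbS).continuousOn hcK, fun z hz => ?_, ?_⟩, ?_⟩
  · rw [Function.comp_apply, cone_of_taxi_eq_one hz, hTS z hz.le]
  · refine ⟨hTU.comp (hcU hbS), ?_, ?_⟩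
    · intro z hz w hw hzw
      have h3 := congrArg (fun x => cone T (S x)) hzw
      simp only [Function.comp_apply, hST _ (hcK (openDiamond_subset hz)),
        hST _ (hcK (openDiamond_subset hw))] at h3
      rwa [cone_cone hbS fun z hz => hTS z hz.le, cone_cone hbS fun z hz => hTS z hz.le] at h3
    · intro z hz
      refine ⟨cone T (S z), hcU hbT (hSU hz), ?_⟩
      rw [Function.comp_apply, cone_cone hbT fun z hz => hST z hz.le,
        hTS z (openDiamond_subset hz)]
  · rw [image_comp]
    congr 1
    refine subset_antisymm ?_ ?_
    · rintro _ ⟨z, hz, rfl⟩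
      exact cone_mem_diagonal hS1.1 hS1.2 hbS hz
    · intro z hz
      exact ⟨cone T z, cone_mem_diagonal h1 h2 hbT hz, cone_cone hbT (fun z hz => hST z hz.le) z⟩

/-! ### Construction of a symmetric medial graph -/

namespace IsCell
variable {Y Z : Type*} [TopologicalSpace Y] [TopologicalSpace Z] {K U : Set ℂ} {κ : ℂ → Y}

theorem comp_injective (h : IsCell K U κ) {g : Y → Z} (hc : Continuous g)
    (hg : Function.Injective g) : IsCell K U (g ∘ κ) where
  compact := h.compact
  isOpen := h.isOpen
  convex := h.convex
  subset := h.subset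
  dense := h.dense
  cont := hc.comp_continuousOn h.cont
  inj := hg.comp_injOn h.inj
  apart := fun x hx y hy he => h.apart x hx y hy (hg he)
  finite := fun y => by
    by_cases hy : ∃ x, g x = y
    · obtain ⟨x, rfl⟩ := hy
      refine (h.finite x).subset fun z hz => ⟨hz.1, hg hz.2⟩
    · refine finite_empty.subset fun z hz => (hy ⟨_, hz.2⟩).elim

end IsCell

namespace FaceCharts
open SphereGraph
variable {G : SphereGraph} {P : FaceCharts G}

/-- The medial graph drawn by the corner arcs of the charts `Q`. -/
def medialGraph (Q : FaceCharts G) : SphereGraph where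
  verts := range Q.mark
  edges := {a | ∃ (f : G.faces) (k : Fin (Q.deg f)), a = Q.chart f '' cornerArc (Q.deg f) k}
  verts_finite := by
    have : Finite G.edges := G.edges_finite
    exact finite_range _
  edges_finite := by
    have := Q.finite_sides
    refine (finite_range fun p : (f : G.faces) × Fin (Q.deg f) =>
      Q.chart p.1 '' cornerArc (Q.deg p.1) p.2).subset ?_
    rintro _ ⟨f, k, rfl⟩
    exact ⟨⟨f, k⟩, rfl⟩
  edge_curve := by
    rintro _ ⟨f, k, rfl⟩
    have habs : ∀ t ∈ Icc (0 : ℝ) 1, |t - 1 / 2| ≤ 1 / 2 := fun t ht =>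
      abs_le.2 ⟨by linarith [ht.1], by linarith [ht.2]⟩
    have habs' : ∀ t ∈ Ioo (0 : ℝ) 1, |t - 1 / 2| < 1 / 2 := fun t ht =>
      abs_lt.2 ⟨by linarith [ht.1], by linarith [ht.2]⟩
    set c : ℝ → ℂ := fun t => polar (Q.deg f) k (1 / 2 + |t - 1 / 2|, t - 1 / 2) with hc
    have hmem : ∀ t ∈ Icc (0 : ℝ) 1, c t ∈ cornerArc (Q.deg f) k := fun t ht =>
      mem_cornerArc.2 ⟨_, habs t ht, rfl⟩
    have hnorm : ∀ t, ‖c t‖ = 1 / 2 + |t - 1 / 2| := fun t => polar_norm (by positivity)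
    have hlt : ∀ t ∈ Ioo (0 : ℝ) 1, ‖c t‖ < 1 := fun t ht => by
      rw [hnorm]; linarith [habs' t ht]
    have hcc : Continuous c := (polar_continuous _ k).comp (by fun_prop)
    refine ⟨fun t => Q.chart f (c t), (Q.chart_continuousOn f).comp hcc.continuousOn fun t ht =>
      mem_closedBall_iff.2 (cornerArc_norm (hmem t ht)), fun t ht s hs h => ?_, ?_, ?_,
      fun t ht => ?_, ?_⟩
    · have h1 := (Q.chart_eq (hlt t ht) (hlt s hs).le h).2
      have h2 := (polar_inj (by positivity) (by positivity) (habs' t ht) (habs' s hs).le h1).2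
      linarith [congrArg Prod.snd h2]
    · exact Q.chart_mid_mem (hmem 0 (by simp)) (by rw [hnorm]; norm_num [abs_of_pos])
    · exact Q.chart_mid_mem (hmem 1 (by simp)) (by rw [hnorm]; norm_num [abs_of_pos])
    · rintro ⟨e, he⟩
      refine Q.chart_notMem_carrier f (hlt t ht) ?_
      rw [← show Q.mark e = Q.chart f (c t) from he]
      exact Q.mark_mem_carrier e
    · refine subset_antisymm ?_ ?_
      · rintro _ ⟨z, hz, rfl⟩
        obtain ⟨s, hs, rfl⟩ := mem_cornerArc.1 hz
        rw [abs_le] at hs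
        refine ⟨s + 1 / 2, ⟨by linarith, by linarith⟩, ?_⟩
        simp only [hc, add_sub_cancel_right]
      · rintro _ ⟨t, ht, rfl⟩
        exact ⟨_, hmem t ht, rfl⟩
  edge_inter := by
    rintro _ ⟨f, k, rfl⟩ _ ⟨g, j, rfl⟩ hne x ⟨⟨z, hz, hzx⟩, w, hw, rfl⟩
    rcases (cornerArc_norm hz).eq_or_lt with h1 | h1
    · rw [← hzx]
      exact Q.chart_mid_mem hz h1
    · obtain ⟨rfl, rfl⟩ := Q.chart_eq h1 (cornerArc_norm hw) hzx
      obtain ⟨s, hs, rfl⟩ := mem_cornerArc.1 hz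
      obtain ⟨t, ht, h⟩ := mem_cornerArc.1 hw
      rw [polar_norm (by positivity)] at h1
      have h2 : |s| < 1 / 2 := by simp only at h1; linarith
      obtain ⟨rfl, -⟩ := polar_inj (by positivity) (by positivity) h2 ht h
      exact (hne rfl).elim

theorem isMedialOf_medialGraph (Q : FaceCharts G) : Q.IsMedialOf Q.medialGraph := ⟨rfl, rfl⟩

/-- The charts composed with a homeomorphism of the sphere that fixes the drawing pointwise and
preserves every face. -/
def push (P : FaceCharts G) (φ : S2 → S2) (hc : Continuous φ) (hi : Function.Injective φ)
    (hG : ∀ x ∈ G.carrier, φ x = x) (hf : ∀ f : G.faces, φ '' f = f) : FaceCharts G where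
  deg := P.deg
  deg_pos := P.deg_pos
  chart f z := φ (P.chart f z)
  side := P.side
  mark := P.mark
  chart_continuousOn f := hc.comp_continuousOn (P.chart_continuousOn f)
  chart_injOn f := hi.comp_injOn (P.chart_injOn f)
  chart_image f := by
    rw [← image_image φ, P.chart_image, hf]
  corner_mem f i := by
    rw [hG _ (vert_mem_carrier (P.corner_mem f i))]
    exact P.corner_mem f i
  side_injOn f i := hi.comp_injOn (P.side_injOn f i)
  side_image f i := by
    rw [← P.side_image f i]
    refine image_congr fun t _ => hG _ (P.chart_mem_carrier f ?_)
    rw [discPoint_norm, abs_one]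
  two_sides := P.two_sides
  chart_mid f i := by
    rw [P.chart_mid]
    exact hG _ (P.mark_mem_carrier _)

/-- The sectors of the faces, one for each corner. -/
abbrev Quad (P : FaceCharts G) : Type := (f : G.faces) × Fin (P.deg f)

/-- The chart of a face, restricted to a sector that is parametrized by the diamond. -/
def quadMap (P : FaceCharts G) (q : P.Quad) (z : ℂ) : S2 :=
  P.chart q.1 (sectorMap (P.deg q.1) q.2 z)

theorem quadMap_continuousOn (q : P.Quad) : ContinuousOn (P.quadMap q) diamond :=
  (P.chart_continuousOn q.1).comp (sectorMap_continuousOn _ _) fun _ hz =>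
    mem_closedBall_iff.2 (sectorMap_norm_le hz)

/-- The open quadrilaterals are disjoint from each other and from all boundaries of quadrilaterals.
-/
theorem quadMap_eq {q q' : P.Quad} {z w : ℂ} (hz : z ∈ openDiamond) (hw : w ∈ diamond)
    (h : P.quadMap q z = P.quadMap q' w) : q = q' ∧ z = w := by
  obtain ⟨f, k⟩ := q
  obtain ⟨g, j⟩ := q'
  obtain ⟨h1, h2⟩ := P.chart_eq (sectorMap_norm_lt hz) (sectorMap_norm_le hw) h
  simp only at h1
  subst h1
  obtain ⟨h3, h4⟩ := sectorMap_inj hz hw h2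
  exact ⟨by rw [show k = j from h3], h4⟩

theorem exists_quadMap_eq (P : FaceCharts G) (x : S2) : ∃ q, ∃ z ∈ diamond, P.quadMap q z = x := by
  obtain ⟨f, hf⟩ := P.exists_mem_closure x
  rw [P.closure_face] at hf
  obtain ⟨w, hw, rfl⟩ := hf
  obtain ⟨k, z, hz, rfl⟩ := exists_sectorMap_eq (P.deg_pos f) (mem_closedBall_iff.1 hw)
  exact ⟨⟨f, k⟩, z, hz, rfl⟩

theorem isCell_quadMap (q : P.Quad) : IsCell diamond openDiamond (P.quadMap q) where
  compact := isCompact_diamond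
  isOpen := isOpen_openDiamond
  convex := convex_openDiamond
  subset := openDiamond_subset
  dense := diamond_subset_closure
  cont := quadMap_continuousOn q
  inj := fun z hz w hw h => (quadMap_eq hz (openDiamond_subset hw) h).2
  apart := fun z hz w hw h => by rwa [← (quadMap_eq hw hz h.symm).2]
  finite := fun x => by
    have h1 := (P.isCell q.1).finite x
    refine (h1.biUnion fun w _ => sectorMap_finite q.2 w).subset fun z hz => ?_
    exact mem_biUnion (x := sectorMap (P.deg q.1) q.2 z)
      ⟨mem_closedBall_iff.2 (sectorMap_norm_le hz.1), hz.2⟩ ⟨hz.1, rfl⟩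

theorem isClosed_quadMap_image (q : P.Quad) {C : Set ℂ} (hC : IsClosed C) (h : C ⊆ diamond) :
    IsClosed (P.quadMap q '' C) :=
  ((isCompact_diamond.of_isClosed_subset hC h).image_of_continuousOn
    ((quadMap_continuousOn q).mono h)).isClosed

theorem quadMap_one_mem (q : P.Quad) {z : ℂ} (hz : z = 1 ∨ z = -1) :
    P.quadMap q z ∈ range P.mark := by
  rcases hz with rfl | rfl
  · exact ⟨_, by rw [quadMap, sectorMap_one, P.chart_mid]⟩
  · obtain ⟨i, hi⟩ := discPoint_mid_sub q.2
    exact ⟨_, by rw [quadMap, sectorMap_neg_one, hi, P.chart_mid]⟩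

/-- On the boundary of a quadrilateral, only the two ends of the diagonal are marked points. -/
theorem eq_one_of_quadMap_mem {q : P.Quad} {z : ℂ} (hz : z ∈ diamond)
    (h : P.quadMap q z ∈ range P.mark) : z = 1 ∨ z = -1 := by
  obtain ⟨e, he⟩ := h
  have h1 : ‖sectorMap (P.deg q.1) q.2 z‖ = 1 :=
    (sectorMap_norm_le hz).eq_or_lt.resolve_right fun h1 =>
      P.chart_notMem_carrier q.1 h1 (by
        have := P.mark_mem_carrier e
        rwa [he] at this)
  obtain ⟨i, -, hi⟩ := P.eq_mid_of_chart_eq_mark h1 he.symm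
  exact eq_one_of_sectorMap_eq_mid hz hi

/-- Twists of the sectors fit together to a homeomorphism of the sphere. -/
theorem exists_glue (P : FaceCharts G) {η : P.Quad → ℂ → ℂ} (hη : ∀ q, IsTwist (η q)) :
    ∃ φ : S2 → S2, Continuous φ ∧ Function.Injective φ ∧ (∀ x ∈ G.carrier, φ x = x) ∧
      (∀ f : G.faces, φ '' f = f) ∧
      ∀ q, ∀ z ∈ diamond, φ (P.quadMap q z) = P.quadMap q (η q z) := by
  have hdef : ∀ x, ∃ y, (∀ q, ∀ z ∈ openDiamond, P.quadMap q z = x → y = P.quadMap q (η q z)) ∧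
      ((∀ q, ∀ z ∈ openDiamond, P.quadMap q z ≠ x) → y = x) := fun x => by
    by_cases hx : ∃ q, ∃ z ∈ openDiamond, P.quadMap q z = x
    · obtain ⟨q, z, hz, rfl⟩ := hx
      refine ⟨P.quadMap q (η q z), fun q' w hw h => ?_, fun h => (h q z hz rfl).elim⟩
      obtain ⟨rfl, rfl⟩ := quadMap_eq hz (openDiamond_subset hw) h.symm
      rfl
    · push Not at hx
      exact ⟨x, fun q z hz h => (hx q z hz h).elim, fun _ => rfl⟩
  choose φ hφ hφ' using hdef
  have hq : ∀ q, ∀ z ∈ diamond, φ (P.quadMap q z) = P.quadMap q (η q z) := fun q z hz => by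
    by_cases hz' : z ∈ openDiamond
    · exact hφ _ q z hz' rfl
    · rw [(hη q).fixed z (taxi_eq_one hz hz')]
      refine hφ' _ fun q' w hw h => hz' ?_
      rwa [← (quadMap_eq hw hz h).2]
  have hG : ∀ x ∈ G.carrier, φ x = x := fun x hx => hφ' _ fun q z hz h =>
    P.chart_notMem_carrier q.1 (sectorMap_norm_lt hz) (by
      rw [← h] at hx; exact hx)
  have hcov : ∀ {f : G.faces} {x : S2}, x ∈ (f : Set S2) →
      ∃ k, ∃ z ∈ diamond, P.quadMap ⟨f, k⟩ z = x := fun {f x} hx => by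
    rw [← P.chart_image f] at hx
    obtain ⟨w, hw, rfl⟩ := hx
    obtain ⟨k, z, hz, rfl⟩ := exists_sectorMap_eq (P.deg_pos f) (mem_ball_iff_norm_lt.1 hw).le
    exact ⟨k, z, hz, rfl⟩
  refine ⟨φ, ?_, fun x y hxy => ?_, hG, fun f => ?_, hq⟩
  · rw [continuous_iff_isClosed]
    intro C hC
    have h1 : φ ⁻¹' C = ⋃ q, P.quadMap q '' (diamond ∩ (fun z => P.quadMap q (η q z)) ⁻¹' C) := by
      ext x
      rw [mem_preimage, mem_iUnion]
      constructor
      · intro hx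
        obtain ⟨q, z, hz, rfl⟩ := P.exists_quadMap_eq x
        exact ⟨q, z, ⟨hz, by rwa [hq q z hz] at hx⟩, rfl⟩
      · rintro ⟨q, z, ⟨hz, hx⟩, rfl⟩
        rwa [hq q z hz]
    rw [h1]
    have := P.finite_sides
    refine isClosed_iUnion_of_finite fun q => isClosed_quadMap_image q ?_ inter_subset_left
    exact ((quadMap_continuousOn q).comp (hη q).cont (hη q).mapsTo).preimage_isClosed_of_isClosed
      isCompact_diamond.isClosed hC
  · obtain ⟨q, z, hz, rfl⟩ := P.exists_quadMap_eq x
    obtain ⟨q', w, hw, rfl⟩ := P.exists_quadMap_eq y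
    rw [hq q z hz, hq q' w hw] at hxy
    have hopen : ∀ {q : P.Quad} {z : ℂ}, z ∈ diamond → η q z ∈ openDiamond → z ∈ openDiamond :=
      fun {q z} hz h => by
        by_contra hz'
        rw [(hη q).fixed z (taxi_eq_one hz hz')] at h
        exact hz' h
    by_cases hz' : z ∈ openDiamond
    · have h1 := (hη q).bij.mapsTo hz'
      obtain ⟨rfl, h2⟩ := quadMap_eq h1 ((hη q').mapsTo hw) hxy
      rw [(hη q).bij.injOn hz' (hopen hw (h2 ▸ h1)) h2]
    · by_cases hw' : w ∈ openDiamond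
      · have h1 := (hη q').bij.mapsTo hw'
        obtain ⟨rfl, h2⟩ := quadMap_eq h1 ((hη q).mapsTo hz) hxy.symm
        exact (hz' (hopen hz (h2 ▸ h1))).elim
      · rwa [(hη q).fixed z (taxi_eq_one hz hz'), (hη q').fixed w (taxi_eq_one hw hw')] at hxy
  · refine subset_antisymm ?_ fun x hx => ?_
    · rintro _ ⟨x, hx, rfl⟩
      obtain ⟨k, z, hz, rfl⟩ := hcov hx
      rw [hq _ z hz]
      by_cases hz' : z ∈ openDiamond
      · exact P.chart_mem_face f (sectorMap_norm_lt ((hη ⟨f, k⟩).bij.mapsTo hz'))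
      · rwa [(hη ⟨f, k⟩).fixed z (taxi_eq_one hz hz')]
    · obtain ⟨k, z, hz, rfl⟩ := hcov hx
      by_cases hz' : z ∈ openDiamond
      · obtain ⟨w, hw, rfl⟩ := (hη ⟨f, k⟩).bij.surjOn hz'
        exact ⟨_, P.chart_mem_face f (sectorMap_norm_lt hw), hq ⟨f, k⟩ w (openDiamond_subset hw)⟩
      · exact ⟨_, hx, by rw [hq _ z hz, (hη ⟨f, k⟩).fixed z (taxi_eq_one hz hz')]⟩

namespace IsAntipodalDual

/-- The boundaries of the sectors make up the union of `G` and its antipodal image. -/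
theorem mem_openDiamond_iff (h : P.IsAntipodalDual) {q : P.Quad} {z : ℂ} (hz : z ∈ diamond) :
    z ∈ openDiamond ↔ P.quadMap q z ∉ G.carrier ∧ -(P.quadMap q z) ∉ G.carrier := by
  constructor
  · refine fun hz' => ⟨P.chart_notMem_carrier q.1 (sectorMap_norm_lt hz'), fun hn => ?_⟩
    obtain ⟨f, i, r, h0, h1, h2⟩ := h.neg_mem_carrier_iff.1 hn
    obtain ⟨rfl, h3⟩ := P.chart_eq (sectorMap_norm_lt hz')
      (by rwa [discPoint_norm, abs_of_nonneg h0]) h2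
    exact sectorMap_ne_spoke hz' i h0 h3
  · rintro ⟨h1, h2⟩
    by_contra hz'
    rcases sectorMap_boundary (k := q.2) hz hz' with h3 | ⟨j, r, h0, hr, h3⟩
    · exact h1 (P.chart_mem_carrier q.1 h3)
    · exact h2 (h.neg_mem_carrier_iff.2 ⟨q.1, j, r, h0, hr, congrArg _ h3⟩)

theorem isOpen_quadMap_image (h : P.IsAntipodalDual) (q : P.Quad) :
    IsOpen (P.quadMap q '' openDiamond) := by
  have h1 : P.quadMap q '' openDiamond = (G.carrier ∪ Neg.neg ⁻¹' G.carrier ∪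
      ⋃ q' ∈ ({q}ᶜ : Set P.Quad), P.quadMap q' '' diamond)ᶜ := by
    ext x
    constructor
    · rintro ⟨z, hz, rfl⟩ (hx | hx)
      · have := (h.mem_openDiamond_iff (q := q) (openDiamond_subset hz)).1 hz
        exact hx.elim this.1 this.2
      · obtain ⟨q', hq', w, hw, h2⟩ := mem_iUnion₂.1 hx
        exact hq' (quadMap_eq hz hw h2.symm).1.symm
    · intro hx
      obtain ⟨q', z, hz, rfl⟩ := P.exists_quadMap_eq x
      obtain rfl : q' = q := by
        by_contra hne
        exact hx (Or.inr (mem_iUnion₂.2 ⟨q', hne, z, hz, rfl⟩))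
      exact ⟨z, (h.mem_openDiamond_iff hz).2
        ⟨fun h1 => hx (Or.inl (Or.inl h1)), fun h1 => hx (Or.inl (Or.inr h1))⟩, rfl⟩
  rw [h1, isOpen_compl_iff]
  have := P.finite_sides
  exact (G.isClosed_carrier.union (G.isClosed_carrier.preimage continuous_neg)).union
    ((toFinite _).isClosed_biUnion fun q' _ =>
      isClosed_quadMap_image q' isCompact_diamond.isClosed subset_rfl)

/-- The antipodal function permutes the sectors. -/
theorem exists_antipodal_quad (h : P.IsAntipodalDual) (q : P.Quad) :
    ∃ q', antipodal '' (P.quadMap q '' openDiamond) ⊆ P.quadMap q' '' openDiamond := by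
  have hcov : ∀ z ∈ openDiamond, ∃ q', ∃ w ∈ openDiamond, P.quadMap q' w = -(P.quadMap q z) := by
    intro z hz
    obtain ⟨h1, h2⟩ := (h.mem_openDiamond_iff (q := q) (openDiamond_subset hz)).1 hz
    obtain ⟨q', w, hw, h3⟩ := P.exists_quadMap_eq (-(P.quadMap q z))
    exact ⟨q', w, (h.mem_openDiamond_iff hw).2 (by rw [h3, neg_neg]; exact ⟨h2, h1⟩), h3⟩
  obtain ⟨q', w, hw, h1⟩ := hcov 0 zero_mem_openDiamond
  refine ⟨q', ?_⟩
  have hpre : IsPreconnected (antipodal '' (P.quadMap q '' openDiamond)) :=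
    ((convex_openDiamond.isPreconnected).image _
      ((quadMap_continuousOn q).mono openDiamond_subset)).image _ antipodal_continuous.continuousOn
  refine hpre.subset_left_of_subset_union (h.isOpen_quadMap_image q')
    (v := ⋃ p ∈ ({q'}ᶜ : Set P.Quad), P.quadMap p '' openDiamond)
    (isOpen_biUnion fun p _ => h.isOpen_quadMap_image p) ?_ ?_ ?_
  · rw [disjoint_left]
    rintro _ ⟨z, hz, rfl⟩ hx
    obtain ⟨p, hp, u, hu, h2⟩ := mem_iUnion₂.1 hx
    exact hp (quadMap_eq hz (openDiamond_subset hu) h2.symm).1.symm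
  · rintro _ ⟨_, ⟨z, hz, rfl⟩, rfl⟩
    obtain ⟨p, u, hu, h2⟩ := hcov z hz
    by_cases hp : p = q'
    · exact Or.inl ⟨u, hu, by rw [← hp]; exact h2⟩
    · exact Or.inr (mem_iUnion₂.2 ⟨p, hp, u, hu, h2⟩)
  · exact ⟨_, ⟨_, ⟨0, zero_mem_openDiamond, rfl⟩, rfl⟩, w, hw, h1⟩

/-- The antipodal function permutes the sectors without fixed sectors: an involution of an open
disc has a fixed point, but the antipodal function has none. -/
theorem exists_antipodal_perm (h : P.IsAntipodalDual) : ∃ a : P.Quad → P.Quad,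
    (∀ q, antipodal '' (P.quadMap q '' openDiamond) = P.quadMap (a q) '' openDiamond) ∧
      (∀ q, a (a q) = q) ∧ ∀ q, a q ≠ q := by
  choose a ha using h.exists_antipodal_quad
  have haa : ∀ q, a (a q) = q := fun q => by
    obtain ⟨z, hz, h1⟩ := ha q ⟨_, ⟨0, zero_mem_openDiamond, rfl⟩, rfl⟩
    obtain ⟨w, hw, h2⟩ := ha (a q) ⟨_, ⟨z, hz, rfl⟩, rfl⟩
    rw [h1] at h2
    have h3 : P.quadMap (a (a q)) w = P.quadMap q 0 := h2.trans (neg_neg _)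
    exact (quadMap_eq hw (openDiamond_subset zero_mem_openDiamond) h3).1
  have heq : ∀ q, antipodal '' (P.quadMap q '' openDiamond) = P.quadMap (a q) '' openDiamond :=
    fun q => by
      refine subset_antisymm (ha q) ?_
      have h1 := image_mono (f := antipodal) (ha (a q))
      rwa [antipodal_antipodal_image, haa] at h1
  refine ⟨a, heq, haa, fun q hq => ?_⟩
  have him : (antipodal ∘ P.quadMap q) '' openDiamond = P.quadMap q '' openDiamond := by
    rw [image_comp, heq, hq]
  obtain ⟨T, -, hTc, -, -, -, hTU, -, hT, -⟩ :=
    ((isCell_quadMap q).comp_injective antipodal_continuous antipodal_injective).exists_homeo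
      (isCell_quadMap q) him
  have hT' : ∀ z ∈ openDiamond, P.quadMap q (T z) = -(P.quadMap q z) := fun z hz =>
    hT z (openDiamond_subset hz)
  obtain ⟨z, hz, hfix⟩ := exists_fixed_of_involution isOpen_openDiamond convex_openDiamond
    ⟨0, zero_mem_openDiamond⟩ (hTc.mono openDiamond_subset) hTU fun z hz =>
      (isCell_quadMap q).inj (hTU (hTU hz)) hz (by rw [hT' _ (hTU hz), hT' z hz, neg_neg])
  have := hT' z hz
  rw [hfix] at this
  exact S2.ne_neg _ this

theorem neg_mem_range_mark (h : P.IsAntipodalDual) {x : S2} (hx : x ∈ range P.mark) :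
    -x ∈ range P.mark := by
  obtain ⟨e, rfl⟩ := hx
  obtain ⟨e', he'⟩ := h.mem_range_mark (h.neg_mark_mem_carrier e)
    (by rw [neg_neg]; exact P.mark_mem_carrier e)
  exact ⟨e', he'.symm⟩

/-- In each sector, the antipodal image of the diagonal of the antipodal sector is the image of the
diagonal under a twist. -/
theorem exists_antipodal_twist (h : P.IsAntipodalDual) {q q' : P.Quad}
    (hq : antipodal '' (P.quadMap q' '' openDiamond) = P.quadMap q '' openDiamond) :
    ∃ η, IsTwist η ∧ P.quadMap q '' (η '' diamondDiagonal) =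
      antipodal '' (P.quadMap q' '' diamondDiagonal) := by
  obtain ⟨T, S, hTc, hSc, hTK, hSK, hTU, hSU, hT, -, hST, hTS⟩ :=
    ((isCell_quadMap q').comp_injective antipodal_continuous antipodal_injective).exists_homeo
      (isCell_quadMap q) (by rw [image_comp, hq])
  have hone : ∀ z, z = 1 ∨ z = -1 → T z = 1 ∨ T z = -1 := fun z hz => by
    have hzd : z ∈ diamond := by
      rcases hz with rfl | rfl
      exacts [one_mem_diamond, neg_one_mem_diamond]
    refine eq_one_of_quadMap_mem (q := q) (hTK hzd) ?_
    rw [hT z hzd]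
    exact h.neg_mem_range_mark (quadMap_one_mem q' hz)
  obtain ⟨η, hη, hd⟩ := exists_twist hTc hSc hTU hSU hTK hSK hST hTS (hone 1 (Or.inl rfl))
    (hone (-1) (Or.inr rfl))
  refine ⟨η, hη, ?_⟩
  rw [hd, image_image, image_image]
  exact image_congr fun z hz => hT z hz.1

/-- The sectors can be twisted in such a way that the antipodal function permutes the twisted
diagonals: of two antipodal sectors, only one has to be twisted. -/
theorem exists_symmetric_twists (h : P.IsAntipodalDual) :
    ∃ (a : P.Quad → P.Quad) (η : P.Quad → ℂ → ℂ), (∀ q, IsTwist (η q)) ∧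
      ∀ q, antipodal '' (P.quadMap q '' (η q '' diamondDiagonal)) =
        P.quadMap (a q) '' (η (a q) '' diamondDiagonal) := by
  classical
  obtain ⟨a, ha, haa, hne⟩ := h.exists_antipodal_perm
  have hH : ∀ q, ∃ η, IsTwist η ∧ P.quadMap q '' (η '' diamondDiagonal) =
      antipodal '' (P.quadMap (a q) '' diamondDiagonal) := fun q =>
    h.exists_antipodal_twist (by rw [ha, haa])
  choose H hH hd using hH
  have := P.finite_sides
  obtain ⟨n, ⟨ι⟩⟩ := Finite.exists_equiv_fin P.Quad
  refine ⟨a, fun q => if ι q < ι (a q) then id else H q, fun q => ?_, fun q => ?_⟩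
  · dsimp only
    split_ifs
    exacts [isTwist_id, hH q]
  · dsimp only
    rw [haa]
    rcases lt_trichotomy (ι q) (ι (a q)) with h1 | h1 | h1
    · rw [if_pos h1, if_neg h1.not_gt, hd, haa, image_id]
    · exact (hne q (ι.injective h1).symm).elim
    · rw [if_neg h1.not_gt, if_pos h1, hd, antipodal_antipodal_image, image_id]

/-- The charts twisted by `exists_symmetric_twists` draw a symmetric medial graph. -/
theorem exists_symmetric_medial (h : P.IsAntipodalDual) :
    ∃ (Q : FaceCharts G) (M : SphereGraph), Q.IsMedialOf M ∧ M.IsAntipodallySymmetric := by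
  obtain ⟨a, η, hη, ha⟩ := h.exists_symmetric_twists
  obtain ⟨φ, hc, hi, hG, hf, hφ⟩ := P.exists_glue hη
  set Q := P.push φ hc hi hG hf with hQ
  have hedge : ∀ q : P.Quad, Q.chart q.1 '' cornerArc (P.deg q.1) q.2 =
      P.quadMap q '' (η q '' diamondDiagonal) := fun q => by
    rw [← sectorMap_diagonal, image_image, image_image]
    exact image_congr fun z hz => hφ q z hz.1
  have hneg : ∀ {S : Set S2}, antipodal '' S ⊆ S → antipodal '' S = S := fun {S} hS =>
    subset_antisymm hS (by
      have := image_mono (f := antipodal) hS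
      rwa [antipodal_antipodal_image] at this)
  refine ⟨Q, Q.medialGraph, Q.isMedialOf_medialGraph, SphereGraph.ext ?_ ?_⟩
  · refine hneg ?_
    rintro _ ⟨x, hx, rfl⟩
    exact h.neg_mem_range_mark hx
  · have hsub : ∀ e ∈ Q.medialGraph.edges, antipodal '' e ∈ Q.medialGraph.edges := by
      rintro _ ⟨f, k, rfl⟩
      refine ⟨(a ⟨f, k⟩).1, (a ⟨f, k⟩).2, ?_⟩
      exact (congrArg _ (hedge ⟨f, k⟩)).trans ((ha ⟨f, k⟩).trans (hedge (a ⟨f, k⟩)).symm)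
    refine subset_antisymm ?_ fun e he => ⟨_, hsub e he, antipodal_antipodal_image e⟩
    rintro _ ⟨e, he, rfl⟩
    exact hsub e he

end IsAntipodalDual
end FaceCharts

end

theorem corollary3p3 (G : SphereGraph) (hG : G.IsAntipodallySelfDual) :
    (∃ M : SphereGraph, G.IsMedial M ∧ M.IsAntipodallySymmetric) ∧
    ∀ M : SphereGraph, G.IsMedial M → M.IsAntipodallySymmetric →
      (∃ C : M.faces → Bool, M.IsProperFaceColoring C) ∧
      ∀ C : M.faces → Bool, M.IsProperFaceColoring C → M.AntipodalColorReversing C := by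
  obtain ⟨P, hP⟩ : ∃ P : FaceCharts G, P.IsAntipodalDual := hG
  obtain ⟨Q, M, hM, hs⟩ := hP.exists_symmetric_medial
  refine ⟨⟨M, ⟨Q, hM⟩, hs⟩, ?_⟩
  rintro M ⟨Q, hM : Q.IsMedialOf M⟩ hs
  exact ⟨hM.exists_properColoring, fun C hC => hP.colorReversing hM hs hC⟩
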